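/- Let $V=(\mathbb Z/n\mathbb Z)^2$, and let the puzzle graph be the two-dimensional discrete torus on $V$ (edges between nearest neighbors, periodic boundary). Let the people graph be the Erdős–Rényi random graph on $V$ in which every pair of distinct vertices is an edge independently with probability $p$. For $v\in V$ and $S\subset V$, let $c_{\mathrm{ppl}}(v,S)$ and $c_{\mathrm{puz}}(v,S)$ be the numbers of neighbors of $v$ in $S$ in the people graph and in the puzzle graph. Jigsaw percolation with thresholds $\sigma,\tau,\theta$ starts from the partition $\mathcal P^0$ of $V$ into singletons. Given the partition $\mathcal P^t$, join two distinct blocks $W,W'$ by an edge if, for $(A,B)=(W,W')$ or $(A,B)=(W',W)$, at least one of the following holds: some $v\in A$ and $w\in B$ are adjacent in both graphs; some $v\in A$ has $c_{\mathrm{puz}}(v,B)\ge\theta$; some $v\in A$ has $c_{\mathrm{ppl}}(v,B)\ge\sigma$ and $c_{\mathrm{puz}}(v,B)\ge\tau$. Then $\mathcal P^{t+1}$ is obtained by merging all blocks in the same connected component of the resulting graph on $\mathcal P^t$. Let $\mathrm{Solve}$ be the event that $\mathcal P^t=\{V\}$ for some $t$, and, for $n\ge 2$, let the critical probability $p_c=p_c(n)$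 be the unique $p\in[0,1]$ with $P_p(\mathrm{Solve})=\tfrac12$. **Theorem.** Assume $\tau=1$, $\theta=2$ and let $\sigma\ge 1$ be an integer. Let $$\nu_\sigma=\int_0^\infty -\log\left(1-e^{-x^{2\sigma+1}/\sigma!}\right)dx,$$ which is a convergent integral. For every $n\ge 2$ the critical probability $p_c(n)$ exists and is unique, and, as $n\to\infty$, $$p_c(\log n)^{2+\frac1\sigma}\to\nu_\sigma^{2+\frac1\sigma},$$ with sharp transition: for every $\epsilon>0$, $P_{(1-\epsilon)p_c}(\mathrm{Solve})\to 0$ and $P_{(1+\epsilon)p_c}(\mathrm{Solve})\to 1$ (where an edge probability outside $[0,1]$ is replaced with the closest point of $[0,1]$). -/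

import Mathlib

open MeasureTheory Filter Topology Set

noncomputable section

namespace Jigsaw

variable {V : Type*}

/-- The number of neighbors of the vertex `v` in the set `S`, with respect to the graph `G`.
Simple graphs have no loops, so `v` itself is never counted. -/
def nbrCount (G : SimpleGraph V) (v : V) (S : Set V) : ℕ∞ :=
  {w ∈ S | G.Adj v w}.encard

/-- The merging conditions between two clusters `A` and `B`, for the puzzle graph `puz`, the people
graph `ppl`, the verification threshold `σ`, the link threshold `τ` and the exemption
threshold `θ`. -/
def Fits (puz ppl : SimpleGraph V) (σ τ θ : ℕ∞) (A B : Set V) : Prop :=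
  (∃ v ∈ A, ∃ w ∈ B, ppl.Adj v w ∧ puz.Adj v w) ∨
  (∃ v ∈ A, θ ≤ nbrCount puz v B) ∨
  (∃ v ∈ A, σ ≤ nbrCount ppl v B ∧ τ ≤ nbrCount puz v B)

/-- The block of the partition `r` of `V` corresponding to a point of the quotient. -/
def block (r : Setoid V) (q : Quotient r) : Set V :=
  {v | Quotient.mk r v = q}

/-- The graph on the clusters of the partition `r`: two distinct clusters are joined by an
(unoriented) edge if they satisfy one of the merging conditions, in one of the two orders. -/
def clusterGraph (puz ppl : SimpleGraph V) (σ τ θ : ℕ∞) (r : Setoid V) :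
    SimpleGraph (Quotient r) :=
  SimpleGraph.fromRel fun A B => Fits puz ppl σ τ θ (block r A) (block r B)

/-- One step of jigsaw percolation: merge all clusters that belong to the same connected
component of the cluster graph. Partitions of `V` are represented by setoids. -/
def step (puz ppl : SimpleGraph V) (σ τ θ : ℕ∞) (r : Setoid V) : Setoid V :=
  Setoid.comap (Quotient.mk r) (clusterGraph puz ppl σ τ θ r).reachableSetoid

/-- The partition at time `t`, started from the partition into singletons. -/
def partitionAt (puz ppl : SimpleGraph V) (σ τ θ : ℕ∞) (t : ℕ) : Setoid V :=
  (step puz ppl σ τ θ)^[t] ⊥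

/-- The puzzle is solved: at some time, all the vertices form a single cluster. -/
def Solve (puz ppl : SimpleGraph V) (σ τ θ : ℕ∞) : Prop :=
  ∃ t : ℕ, partitionAt puz ppl σ τ θ t = ⊤

/-- The two-dimensional discrete torus with `n ^ 2` vertices and nearest neighbor edges. -/
def torus (n : ℕ) : SimpleGraph (Fin n × Fin n) :=
  SimpleGraph.boxProd (SimpleGraph.cycleGraph n) (SimpleGraph.cycleGraph n)

/-- The probability that the torus puzzle is solved, when the people graph is the Erdős–Rényi
graph with edge probability `p`. -/
def solveProb (σ τ θ : ℕ∞) (n : ℕ) (p : unitInterval) : ℝ :=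
  (SimpleGraph.binomialRandom (Fin n × Fin n) p).real {ppl | Solve (torus n) ppl σ τ θ}

/-- `p` is a critical probability: the torus puzzle is solved with probability one half. -/
def IsCriticalProb (σ τ θ : ℕ∞) (n : ℕ) (p : unitInterval) : Prop :=
  solveProb σ τ θ n p = 1 / 2

/-- There is a sharp transition at `pc n`: for every `ε > 0`, the solving probability tends to `0`
at `(1 - ε) * pc n`, and to `1` at `(1 + ε) * pc n`. A number outside `[0, 1]` is replaced with the
closest point of `[0, 1]`, to be an edge probability. -/
def SharpTransition (σ τ θ : ℕ∞) (pc : ℕ → unitInterval) : Prop :=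
  ∀ ε : ℝ, 0 < ε →
    Tendsto (fun n => solveProb σ τ θ n (projIcc 0 1 zero_le_one ((1 - ε) * (pc n : ℝ))))
      atTop (𝓝 0) ∧
    Tendsto (fun n => solveProb σ τ θ n (projIcc 0 1 zero_le_one ((1 + ε) * (pc n : ℝ))))
      atTop (𝓝 1)

/-- The integrand `-log (1 - exp (-x ^ (2 * σ + 1) / σ!))`. -/
def nuIntegrand (σ : ℕ) (x : ℝ) : ℝ :=
  -Real.log (1 - Real.exp (-(x ^ (2 * σ + 1) / (Nat.factorial σ : ℝ))))

/-- The constant `ν_σ`. -/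
def nu (σ : ℕ) : ℝ := ∫ x in Ioi (0 : ℝ), nuIntegrand σ x

end Jigsaw

end

/-!
The natural scaling is `p = q ^ (2 + 1 / σ)` with `q = a / log n`. Then a vertex next to a rectangle
with sides `x / q` and `y / q` has `σ` people neighbors in the rectangle with probability about
`p ^ σ (x y / q ^ 2) ^ σ / σ! = q (x y) ^ σ / σ!`, so that a side of length `x / q` with `x = y` has
such a vertex with probability about `1 - exp (-x ^ (2 σ + 1) / σ!)`. When it has one, the cluster
that fills the rectangle absorbs the whole adjacent line, because every other vertex of the line then
has two puzzle neighbors in the cluster. The cost, minus the logarithm of the probability, of growing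
a square by one line in both directions at all scales is therefore about `2 ν / q`. There are
`n ^ 2 = exp (2 a / q)` places to start from, so the puzzle is solved if `a > ν` and not solved if
`a < ν`. The two regimes are `tendsto_solveProb_one` and `tendsto_solveProb_zero`. The solving
probability is a strictly increasing continuous function of `p` (`existsUnique_isCriticalProb`), so
they locate the critical probability, and give the sharp transition (`tendsto_criticalProb`,
`sharpTransition`).

*Supercritical regime.* A nucleus is a bounded solved square which grows by one line in both
directions at every side length, up to about `q ^ (-3)`. The growth events are increasing, so by the
Harris inequality the probability of a nucleus is at least the product of their probabilities, which
is `exp (-2 (ν + η) / q)` up to a power of `q` (`le_bprob_nucleus`, `exists_growth_bound`). Nuclei in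
disjoint squares are independent, and with high probability all squares of side length `q ^ (-3)`
can grow further, so one nucleus solves the puzzle (`solve_of_nucleus`, `one_sub_solveProb_le`).

*Subcritical regime.* A set of vertices is internally solved if it can be assembled from singletons
by merging two disjoint sets that fit together at a time. Such sets at most double in size when they
merge, so a solved torus contains an internally solved set whose bounding box has order `1 / q`; it
lifts to the square lattice (`exists_spans_of_solve`). By the union bound (`solveProb_le`) it is
enough that a given box of this order is spanned with probability at most `exp (-(2 ν - η) / q)`
(`exists_box_bound`). The bound rests on the following points.

* In an internally solved set, each boundary between two adjacent lines is crossed by a merging step,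
  and the people edges used for different boundaries are disjoint (`IS.exists_disjoint_witnesses`).
  By the van den Berg–Kesten inequality (`bprob_disjFam_le`), the probability that a spanned box grows
  to a larger one is at most the product of the probabilities that the new lines are crossed.
* Going down the merging history of an internally solved set, one finds either an internally solved
  set whose box is smaller by a small multiple of `1 / q`, or two disjoint ones that nearly cover the
  box (`IS.descent`). By induction, the probability that a box is spanned is at most `exp (-W)`, where
  `W` is the minimal cost of a path of rectangles that grows to the box (`pot`, `bprob_spEvent_le`).
  The coalescence of two large boxes is no cheaper, because `W` is subadditive
  (`IsStepCost.pot_subadd`). The steps of a coarse grained growth are so large that the number of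
  choices is negligible compared with an arbitrarily small part of the cost.
* The cost function `-log (1 - exp (-t))` is convex and decreasing, so a path becomes cheaper when
  it is moved towards the diagonal (`IsStepCost.diag_le_pot`): the squares are optimal, and their cost
  is a Riemann sum of the integral `2 ν / q` (`eventually_le_pot`).

All probabilities are finite sums over the subsets of a finite set of possible edges (`bprob`).
-/

noncomputable section

namespace Jigsaw

/-! ### Product Bernoulli measure on the subsets of a finite set -/

section Bernoulli

variable {α β : Type*}

open Classical in
/-- The probability that a random subset of the finite set `E`, which contains each element
independently with probability `p`, satisfies `Q`. -/
def bprob (E : Finset α) (p : ℝ) (Q : Finset α → Prop) : ℝ :=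
  ∑ S ∈ E.powerset, if Q S then p ^ S.card * (1 - p) ^ (E.card - S.card) else 0

lemma bprob_congr {E : Finset α} {p : ℝ} {Q Q' : Finset α → Prop}
    (h : ∀ S ⊆ E, Q S ↔ Q' S) : bprob E p Q = bprob E p Q' := by
  unfold bprob
  refine Finset.sum_congr rfl fun S hS => ?_
  rw [propext (h S (Finset.mem_powerset.1 hS))]

lemma bprob_empty (p : ℝ) (Q : Finset α → Prop) [Decidable (Q ∅)] :
    bprob ∅ p Q = if Q ∅ then 1 else 0 := by
  simp [bprob]

lemma bprob_insert [DecidableEq α] {E : Finset α} {e : α} (he : e ∉ E) (p : ℝ)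
    (Q : Finset α → Prop) :
    bprob (insert e E) p Q =
      (1 - p) * bprob E p Q + p * bprob E p (fun S => Q (insert e S)) := by
  classical
  unfold bprob
  rw [Finset.sum_powerset_insert he, Finset.mul_sum, Finset.mul_sum]
  congr 1
  · refine Finset.sum_congr rfl fun S hS => ?_
    have hc := Finset.card_le_card (Finset.mem_powerset.1 hS)
    rw [Finset.card_insert_of_notMem he, Nat.sub_add_comm hc, mul_ite, mul_zero]
    congr 1
    ring
  · refine Finset.sum_congr rfl fun S hS => ?_
    have hS' := Finset.mem_powerset.1 hS
    have hc := Finset.card_le_card hS'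
    rw [Finset.card_insert_of_notMem he, Finset.card_insert_of_notMem (fun h => he (hS' h)),
      Nat.add_sub_add_right, mul_ite, mul_zero]
    congr 1
    ring

lemma bprob_nonneg {E : Finset α} {p : ℝ} (h0 : 0 ≤ p) (h1 : p ≤ 1) (Q : Finset α → Prop) :
    0 ≤ bprob E p Q := by
  have : 0 ≤ 1 - p := by linarith
  refine Finset.sum_nonneg fun S _ => ?_
  split_ifs <;> positivity

lemma bprob_mono {E : Finset α} {p : ℝ} (h0 : 0 ≤ p) (h1 : p ≤ 1) {Q Q' : Finset α → Prop}
    (h : ∀ S ⊆ E, Q S → Q' S) : bprob E p Q ≤ bprob E p Q' := by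
  have : 0 ≤ 1 - p := by linarith
  refine Finset.sum_le_sum fun S hS => ?_
  have := h S (Finset.mem_powerset.1 hS)
  split_ifs <;> first | positivity | tauto

lemma bprob_true (E : Finset α) (p : ℝ) : bprob E p (fun _ => True) = 1 := by
  classical
  induction E using Finset.induction_on with
  | empty => simp [bprob]
  | insert e E he ih => rw [bprob_insert he, ih]; ring

lemma bprob_false (E : Finset α) (p : ℝ) : bprob E p (fun _ => False) = 0 := by
  simp [bprob]

lemma bprob_le_one {E : Finset α} {p : ℝ} (h0 : 0 ≤ p) (h1 : p ≤ 1) (Q : Finset α → Prop) :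
    bprob E p Q ≤ 1 :=
  (bprob_mono h0 h1 fun _ _ _ => trivial).trans (bprob_true E p).le

lemma bprob_not (E : Finset α) (p : ℝ) (Q : Finset α → Prop) :
    bprob E p (fun S => ¬ Q S) = 1 - bprob E p Q := by
  rw [eq_sub_iff_add_eq, ← bprob_true E p, bprob, bprob, bprob, ← Finset.sum_add_distrib]
  refine Finset.sum_congr rfl fun S _ => ?_
  by_cases h : Q S <;> simp [h]

lemma bprob_or_le {E : Finset α} {p : ℝ} (h0 : 0 ≤ p) (h1 : p ≤ 1) (Q Q' : Finset α → Prop) :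
    bprob E p (fun S => Q S ∨ Q' S) ≤ bprob E p Q + bprob E p Q' := by
  have : 0 ≤ 1 - p := by linarith
  rw [bprob, bprob, bprob, ← Finset.sum_add_distrib]
  refine Finset.sum_le_sum fun S _ => ?_
  by_cases h : Q S <;> by_cases h' : Q' S <;> (simp [h, h']; try positivity)

/-- The union bound. -/
lemma bprob_exists_le {ι : Type*} {E : Finset α} {p : ℝ} (h0 : 0 ≤ p) (h1 : p ≤ 1)
    (I : Finset ι) (Q : ι → Finset α → Prop) :
    bprob E p (fun S => ∃ i ∈ I, Q i S) ≤ ∑ i ∈ I, bprob E p (Q i) := by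
  classical
  induction I using Finset.induction_on with
  | empty => simp [bprob]
  | insert i I hi ih =>
    rw [Finset.sum_insert hi]
    refine le_trans (le_trans (bprob_mono h0 h1 ?_) 
      (bprob_or_le h0 h1 (Q i) fun S => ∃ i ∈ I, Q i S))
      (by linarith)
    intro S _ h
    simpa using h

lemma bprob_subset [DecidableEq α] {E : Finset α} (p : ℝ) {T : Finset α} (hT : T ⊆ E) :
    bprob E p (fun S => T ⊆ S) = p ^ T.card := by
  induction E using Finset.induction_on generalizing T with
  | empty => simp [Finset.subset_empty.1 hT, bprob]
  | insert e E he ih =>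
    rw [bprob_insert he]
    by_cases heT : e ∈ T
    · have h1 : bprob E p (fun S => T ⊆ S) = 0 := by
        rw [← bprob_false E p]
        exact bprob_congr fun S hS => ⟨fun h => he (hS (h heT)), False.elim⟩
      have h2 : bprob E p (fun S => T ⊆ insert e S) = bprob E p (fun S => T.erase e ⊆ S) :=
        bprob_congr fun S hS => Finset.subset_insert_iff
      rw [h1, h2, ih (Finset.subset_insert_iff.1 hT), ← Finset.card_erase_add_one heT]
      ring
    · have hTE : T ⊆ E := (Finset.subset_insert_iff_of_notMem heT).1 hT
      have h2 : bprob E p (fun S => T ⊆ insert e S) = bprob E p (fun S => T ⊆ S) :=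
        bprob_congr fun S hS => Finset.subset_insert_iff_of_notMem heT
      rw [h2, ih hTE]
      ring

/-- Events that depend on complementary sets of coordinates are independent. -/
lemma bprob_and_of_indep [DecidableEq α] {E : Finset α} (p : ℝ) (F : Finset α)
    {Q Q' : Finset α → Prop} (hQ : ∀ S ⊆ E, Q S ↔ Q (S ∩ F)) (hQ' : ∀ S ⊆ E, Q' S ↔ Q' (S \ F)) :
    bprob E p (fun S => Q S ∧ Q' S) = bprob E p Q * bprob E p Q' := by
  induction E using Finset.induction_on generalizing Q Q' with
  | empty =>
    classical
    rw [bprob_empty, bprob_empty, bprob_empty]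
    by_cases h : Q ∅ <;> by_cases h' : Q' ∅ <;> simp [h, h']
  | insert e E he ih =>
    have hsub : ∀ S ⊆ E, S ⊆ insert e E := fun S hS => hS.trans (Finset.subset_insert _ _)
    have hins : ∀ S ⊆ E, insert e S ⊆ insert e E := fun S hS => Finset.insert_subset_insert e hS
    have IH0 := ih (fun S hS => hQ S (hsub S hS)) (fun S hS => hQ' S (hsub S hS))
    rw [bprob_insert he, bprob_insert he, bprob_insert he, IH0]
    by_cases heF : e ∈ F
    · have h2 : ∀ S ⊆ E, Q' (insert e S) ↔ Q' S := fun S hS => by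
        rw [hQ' _ (hins S hS), hQ' _ (hsub S hS), Finset.insert_sdiff_of_mem _ heF]
      have h3 := ih (Q := fun S => Q (insert e S)) (Q' := Q')
        (fun S hS => by
          have h1 : insert e (S ∩ F) ⊆ insert e E :=
            Finset.insert_subset_insert e (Finset.inter_subset_left.trans hS)
          rw [hQ _ (hins S hS), hQ _ h1, Finset.insert_inter_of_mem heF,
            Finset.insert_inter_of_mem heF, Finset.inter_assoc, Finset.inter_self])
        (fun S hS => hQ' S (hsub S hS))
      rw [bprob_congr (Q' := fun S => Q (insert e S) ∧ Q' S)
          (fun S hS => and_congr_right fun _ => h2 S hS),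
        h3, bprob_congr (Q := fun S => Q' (insert e S)) h2]
      ring
    · have h2 : ∀ S ⊆ E, Q (insert e S) ↔ Q S := fun S hS => by
        rw [hQ _ (hins S hS), hQ _ (hsub S hS), Finset.insert_inter_of_notMem heF]
      have h3 := ih (Q := Q) (Q' := fun S => Q' (insert e S))
        (fun S hS => hQ S (hsub S hS))
        (fun S hS => by
          have h1 : insert e (S \ F) ⊆ insert e E :=
            Finset.insert_subset_insert e (Finset.sdiff_subset.trans hS)
          rw [hQ' _ (hins S hS), hQ' _ h1, Finset.insert_sdiff_of_notMem _ heF,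
            Finset.insert_sdiff_of_notMem _ heF, Finset.sdiff_idem])
      rw [bprob_congr (Q' := fun S => Q S ∧ Q' (insert e S))
          (fun S hS => and_congr_left fun _ => h2 S hS),
        h3, bprob_congr (Q := fun S => Q (insert e S)) h2]
      ring

/-- Events that depend on pairwise disjoint sets of coordinates are independent. -/
lemma bprob_forall_of_indep [DecidableEq α] {ι : Type*} {E : Finset α} (p : ℝ) (I : Finset ι)
    (F : ι → Finset α) (Q : ι → Finset α → Prop)
    (hF : ∀ i ∈ I, ∀ j ∈ I, i ≠ j → Disjoint (F i) (F j))
    (hQ : ∀ i ∈ I, ∀ S ⊆ E, Q i S ↔ Q i (S ∩ F i)) :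
    bprob E p (fun S => ∀ i ∈ I, Q i S) = ∏ i ∈ I, bprob E p (Q i) := by
  classical
  induction I using Finset.induction_on with
  | empty => simp [bprob_true]
  | insert i I hi ih =>
    rw [Finset.prod_insert hi, ← ih (fun a ha b hb => hF a (Finset.mem_insert_of_mem ha) b
        (Finset.mem_insert_of_mem hb)) (fun a ha => hQ a (Finset.mem_insert_of_mem ha)),
      ← bprob_and_of_indep p (F i) (hQ i (Finset.mem_insert_self _ _))]
    · exact bprob_congr fun S hS => by simp
    · intro S hS
      refine forall₂_congr fun j hj => ?_
      have hd := hF i (Finset.mem_insert_self _ _) j (Finset.mem_insert_of_mem hj)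
        (fun h => hi (h ▸ hj))
      rw [hQ j (Finset.mem_insert_of_mem hj) S hS,
        hQ j (Finset.mem_insert_of_mem hj) (S \ F i) (Finset.sdiff_subset.trans hS)]
      have : S \ F i ∩ F j = S ∩ F j := by
        ext x
        have hx : x ∈ F i → x ∉ F j := fun h => Finset.disjoint_left.1 hd h
        simp only [Finset.mem_inter, Finset.mem_sdiff]
        tauto
      rw [this]

/-- The restriction of the random set to a subset of the ground set. -/
lemma bprob_inter [DecidableEq α] {E F : Finset α} (p : ℝ) (hF : F ⊆ E) (Q : Finset α → Prop) :
    bprob E p (fun S => Q (S ∩ F)) = bprob F p Q := by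
  induction E using Finset.induction_on generalizing F Q with
  | empty =>
    rw [Finset.subset_empty.1 hF]
    exact bprob_congr fun S hS => by simp [Finset.subset_empty.1 hS]
  | insert e E he ih =>
    rw [bprob_insert he]
    by_cases heF : e ∈ F
    · have hFE : F.erase e ⊆ E := Finset.subset_insert_iff.1 hF
      have h1 : bprob E p (fun S => Q (S ∩ F)) = bprob E p (fun S => Q (S ∩ F.erase e)) :=
        bprob_congr fun S hS => by
          rw [Finset.inter_erase, Finset.erase_eq_of_notMem]
          exact fun h => he (hS (Finset.mem_of_mem_inter_left h))
      have h2 : bprob E p (fun S => Q (insert e S ∩ F)) =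
          bprob E p (fun S => (fun S => Q (insert e S)) (S ∩ F.erase e)) :=
        bprob_congr fun S hS => by
          have : insert e S ∩ F = insert e (S ∩ F.erase e) := by
            ext x
            by_cases hx : x = e <;> simp [hx, heF]
          simp only [this]
      rw [h1, h2, ih hFE, ih hFE (fun S => Q (insert e S)), 
          ← bprob_insert (Finset.notMem_erase e F), Finset.insert_erase heF]
    · have hFE : F ⊆ E := (Finset.subset_insert_iff_of_notMem heF).1 hF
      have h2 : bprob E p (fun S => Q (insert e S ∩ F)) = bprob E p (fun S => Q (S ∩ F)) :=
        bprob_congr fun S hS => by rw [Finset.insert_inter_of_notMem heF]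
      rw [h2, ih hFE]
      ring

/-- Transport of the random set along an injective map. -/
lemma bprob_image [DecidableEq α] [DecidableEq β] {E : Finset α} (p : ℝ) {f : α → β}
    (hf : InjOn f E) (Q : Finset β → Prop) :
    bprob (E.image f) p Q = bprob E p (fun S => Q (S.image f)) := by
  induction E using Finset.induction_on generalizing Q with
  | empty => exact bprob_congr fun S hS => by simp
  | insert e E he ih =>
    have hf' : InjOn f E := hf.mono (by simp)
    have hfe : f e ∉ E.image f := by
      intro h
      obtain ⟨x, hx, hxe⟩ := Finset.mem_image.1 h
      have := hf (by simp [hx]) (by simp) hxe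
      exact he (this ▸ hx)
    rw [Finset.image_insert, bprob_insert hfe, bprob_insert he, ih hf', ih hf']
    simp only [Finset.image_insert]

/-- The Harris inequality for two increasing events. -/
lemma bprob_harris [DecidableEq α] {E : Finset α} {p : ℝ} (h0 : 0 ≤ p) (h1 : p ≤ 1)
    {Q Q' : Finset α → Prop} (hQ : Monotone Q) (hQ' : Monotone Q') :
    bprob E p Q * bprob E p Q' ≤ bprob E p (fun S => Q S ∧ Q' S) := by
  induction E using Finset.induction_on generalizing Q Q' with
  | empty =>
    classical
    rw [bprob_empty, bprob_empty, bprob_empty]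
    by_cases h : Q ∅ <;> by_cases h' : Q' ∅ <;> simp [h, h']
  | insert e E he ih =>
    rw [bprob_insert he, bprob_insert he, bprob_insert he]
    have hins : Monotone (fun S : Finset α => insert e S) :=
      fun S T h => Finset.insert_subset_insert e h
    have i0 := ih hQ hQ'
    have i1 := ih (hQ.comp hins) (hQ'.comp hins)
    simp only [Function.comp_def] at i1
    have a : bprob E p Q ≤ bprob E p (fun S => Q (insert e S)) :=
      bprob_mono h0 h1 fun S _ h => hQ (Finset.subset_insert e S) h
    have b : bprob E p Q' ≤ bprob E p (fun S => Q' (insert e S)) :=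
      bprob_mono h0 h1 fun S _ h => hQ' (Finset.subset_insert e S) h
    set a0 := bprob E p Q
    set b0 := bprob E p Q'
    set a1 := bprob E p (fun S => Q (insert e S))
    set b1 := bprob E p (fun S => Q' (insert e S))
    have h1' : 0 ≤ 1 - p := by linarith
    have := mul_nonneg (mul_nonneg h0 h1') (mul_nonneg (sub_nonneg.2 a) (sub_nonneg.2 b))
    nlinarith [mul_le_mul_of_nonneg_left i0 h1', mul_le_mul_of_nonneg_left i1 h0]

/-- The probability of a nontrivial increasing event is strictly increasing in `p`, in a
quantitative form that is proved by induction on the ground set. -/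
lemma bprob_sub_ge [DecidableEq α] {E : Finset α} {p p' : ℝ} (h0 : 0 ≤ p) (hp : p ≤ p')
    (h1 : p' ≤ 1) {Q : Finset α → Prop} (hQ : Monotone Q) :
    bprob E p Q ≤ bprob E p' Q ∧
      (¬ Q ∅ → Q E → (p' - p) ^ E.card ≤ bprob E p' Q - bprob E p Q) := by
  induction E using Finset.induction_on generalizing Q with
  | empty =>
    classical
    rw [bprob_empty, bprob_empty]
    exact ⟨le_rfl, fun h h' => absurd h' h⟩
  | insert e E he ih =>
    have hins : Monotone (fun S : Finset α => insert e S) :=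
      fun S T h => Finset.insert_subset_insert e h
    rw [bprob_insert he, bprob_insert he, Finset.card_insert_of_notMem he]
    obtain ⟨i0, i0'⟩ := ih hQ
    obtain ⟨i1, i1'⟩ := ih (hQ.comp hins)
    simp only [Function.comp_def] at i1 i1'
    have ab : bprob E p Q ≤ bprob E p (fun S => Q (insert e S)) :=
      bprob_mono h0 (hp.trans h1) fun S _ h => hQ (Finset.subset_insert e S) h
    have b1 : bprob E p' (fun S => Q (insert e S)) ≤ 1 := bprob_le_one (h0.trans hp) h1 _
    have a1 : bprob E p' Q ≤ 1 := bprob_le_one (h0.trans hp) h1 _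
    have hδ : 0 ≤ p' - p := by linarith
    have hδ1 : p' - p ≤ 1 := by linarith
    have hpow : 0 ≤ (p' - p) ^ E.card := pow_nonneg hδ _
    have hpow1 : (p' - p) ^ E.card ≤ 1 := pow_le_one₀ hδ hδ1
    have k1 : 0 ≤ (1 - p') * (bprob E p' Q - bprob E p Q) :=
      mul_nonneg (by linarith) (by linarith)
    have k2 : 0 ≤ p' * (bprob E p' (fun S => Q (insert e S)) -
        bprob E p (fun S => Q (insert e S))) := mul_nonneg (by linarith) (by linarith)
    have k3 : 0 ≤ (p' - p) * (bprob E p (fun S => Q (insert e S)) - bprob E p Q) :=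
      mul_nonneg (by linarith) (by linarith)
    refine ⟨by nlinarith, fun hn hE => ?_⟩
    rw [pow_succ]
    by_cases hQe : Q (insert e ∅)
    · have hb : ∀ r, bprob E r (fun S => Q (insert e S)) = 1 := fun r => by
        rw [← bprob_true E r]
        exact bprob_congr fun S hS =>
          ⟨fun _ => trivial, fun _ => hQ (Finset.insert_subset_insert e (Finset.empty_subset S)) hQe⟩
      rw [hb, hb] at *
      by_cases hQE : Q E
      · have := i0' hn hQE
        nlinarith [mul_le_mul_of_nonneg_left this hδ]
      · have ha : ∀ r, bprob E r Q = 0 := fun r => by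
          rw [← bprob_false E r]
          exact bprob_congr fun S hS => ⟨fun h => hQE (hQ hS h), False.elim⟩
        rw [ha, ha]
        nlinarith [mul_le_mul_of_nonneg_left hpow1 hδ]
    · have := i1' hQe hE
      nlinarith [mul_le_mul_of_nonneg_left this (h0.trans hp),
        mul_le_mul_of_nonneg_right (show p' - p ≤ p' by linarith) hpow]

lemma continuous_bprob (E : Finset α) (Q : Finset α → Prop) :
    Continuous fun p => bprob E p Q := by
  unfold bprob
  refine continuous_finsetSum _ fun S _ => ?_
  by_cases h : Q S <;> simp only [h, if_true, if_false] <;> fun_prop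

/-- The event that `Q` and `Q'` occur on disjoint subsets of the random set. -/
def DisjOcc (Q Q' : Finset α → Prop) (S : Finset α) : Prop :=
  ∃ A B, Disjoint A B ∧ A ⊆ S ∧ B ⊆ S ∧ Q A ∧ Q' B

open Classical in
/-- The probability of an event for a pair of independent random subsets of `E`. -/
def bprobTwo (E : Finset α) (p : ℝ) (Q : Finset α → Finset α → Prop) : ℝ :=
  ∑ S ∈ E.powerset, p ^ S.card * (1 - p) ^ (E.card - S.card) * bprob E p (Q S)

lemma bprobTwo_insert [DecidableEq α] {E : Finset α} {e : α} (he : e ∉ E) (p : ℝ)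
    (Q : Finset α → Finset α → Prop) :
    bprobTwo (insert e E) p Q =
      (1 - p) * (1 - p) * bprobTwo E p Q + (1 - p) * p * bprobTwo E p (fun S T => Q S (insert e T))
      + p * (1 - p) * bprobTwo E p (fun S T => Q (insert e S) T)
      + p * p * bprobTwo E p (fun S T => Q (insert e S) (insert e T)) := by
  unfold bprobTwo
  rw [Finset.sum_powerset_insert he]
  simp only [Finset.mul_sum]
  rw [← Finset.sum_add_distrib, ← Finset.sum_add_distrib, ← Finset.sum_add_distrib,
    ← Finset.sum_add_distrib]
  refine Finset.sum_congr rfl fun S hS => ?_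
  have hS' := Finset.mem_powerset.1 hS
  have hc := Finset.card_le_card hS'
  rw [Finset.card_insert_of_notMem he, Finset.card_insert_of_notMem (fun h => he (hS' h)),
    Nat.sub_add_comm hc, Nat.add_sub_add_right, bprob_insert he, bprob_insert he]
  ring

lemma bprobTwo_mono {E : Finset α} {p : ℝ} (h0 : 0 ≤ p) (h1 : p ≤ 1)
    {Q Q' : Finset α → Finset α → Prop} (h : ∀ S T, Q S T → Q' S T) :
    bprobTwo E p Q ≤ bprobTwo E p Q' := by
  have : 0 ≤ 1 - p := by linarith
  exact Finset.sum_le_sum fun S _ =>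
    mul_le_mul_of_nonneg_left (bprob_mono h0 h1 fun T _ => h S T) (by positivity)

lemma bprobTwo_or_add_and {E : Finset α} {p : ℝ} (Q Q' : Finset α → Finset α → Prop) :
    bprobTwo E p (fun S T => Q S T ∨ Q' S T) + bprobTwo E p (fun S T => Q S T ∧ Q' S T) =
      bprobTwo E p Q + bprobTwo E p Q' := by
  unfold bprobTwo
  rw [← Finset.sum_add_distrib, ← Finset.sum_add_distrib]
  refine Finset.sum_congr rfl fun S _ => ?_
  rw [← mul_add, ← mul_add]
  congr 1
  unfold bprob
  rw [← Finset.sum_add_distrib, ← Finset.sum_add_distrib]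
  refine Finset.sum_congr rfl fun T _ => ?_
  by_cases h : Q S T <;> by_cases h' : Q' S T <;> simp [h, h']

lemma bprobTwo_prod (E : Finset α) (p : ℝ) (Q Q' : Finset α → Prop) :
    bprobTwo E p (fun S T => Q S ∧ Q' T) = bprob E p Q * bprob E p Q' := by
  unfold bprobTwo
  rw [bprob, Finset.sum_mul]
  refine Finset.sum_congr rfl fun S _ => ?_
  by_cases h : Q S
  · simp [h]
  · simp [h, bprob_false]

/-- The van den Berg–Kesten inequality, for an arbitrary family `T` of pairs of witnesses. It is
proved by duplicating the coordinates of the ground set one after the other. -/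
lemma bprob_disjoint_pair_le [DecidableEq α] {E : Finset α} {p : ℝ} (h0 : 0 ≤ p) (h1 : p ≤ 1)
    (T : Finset α → Finset α → Prop) :
    bprob E p (fun S => ∃ A B, T A B ∧ Disjoint A B ∧ A ⊆ S ∧ B ⊆ S) ≤
      bprobTwo E p (fun S S' => ∃ A B, T A B ∧ A ⊆ S ∧ B ⊆ S') := by
  induction E using Finset.induction_on generalizing T with
  | empty =>
    classical
    rw [bprob_empty, bprobTwo]
    simp only [Finset.powerset_empty, Finset.sum_singleton, bprob_empty]
    by_cases h : T ∅ ∅ <;> simp [h, Finset.subset_empty]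
  | insert e E he ih =>
    have h1' : 0 ≤ 1 - p := by linarith
    rw [bprob_insert he, bprobTwo_insert he]
    -- the witness pairs that remain after `e` has been revealed to be present
    set T' : Finset α → Finset α → Prop := fun A B =>
      T A B ∨ T (insert e A) B ∨ T A (insert e B) with hT'
    have i0 := ih T
    have i1 := ih T'
    have e1 : bprob E p (fun S => ∃ A B, T A B ∧ Disjoint A B ∧ A ⊆ insert e S ∧ B ⊆ insert e S) ≤
        bprob E p (fun S => ∃ A B, T' A B ∧ Disjoint A B ∧ A ⊆ S ∧ B ⊆ S) := by
      refine bprob_mono h0 h1 ?_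
      rintro S - ⟨A, B, hT, hd, hA, hB⟩
      refine ⟨A.erase e, B.erase e, ?_, hd.mono (Finset.erase_subset _ _) (Finset.erase_subset _ _),
        Finset.subset_insert_iff.1 hA, Finset.subset_insert_iff.1 hB⟩
      by_cases heA : e ∈ A
      · have heB : e ∉ B := Finset.disjoint_left.1 hd heA
        exact Or.inr (Or.inl (by rwa [Finset.insert_erase heA, Finset.erase_eq_of_notMem heB]))
      · by_cases heB : e ∈ B
        · exact Or.inr (Or.inr (by rwa [Finset.insert_erase heB, Finset.erase_eq_of_notMem heA]))
        · exact Or.inl (by rwa [Finset.erase_eq_of_notMem heA, Finset.erase_eq_of_notMem heB])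
    set U : Finset α → Finset α → Prop := fun S S' => ∃ A B, T A B ∧ A ⊆ S ∧ B ⊆ S' with hU
    have e2 : bprobTwo E p (fun S S' => ∃ A B, T' A B ∧ A ⊆ S ∧ B ⊆ S') ≤
        bprobTwo E p (fun S S' => U (insert e S) S' ∨ U S (insert e S')) := by
      refine bprobTwo_mono h0 h1 ?_
      rintro S S' ⟨A, B, hT | hT | hT, hA, hB⟩
      · exact Or.inl ⟨A, B, hT, hA.trans (Finset.subset_insert _ _), hB⟩
      · exact Or.inl ⟨_, B, hT, Finset.insert_subset_insert e hA, hB⟩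
      · exact Or.inr ⟨A, _, hT, hA, Finset.insert_subset_insert e hB⟩
    have e3 : bprobTwo E p (fun S S' => U (insert e S) S' ∨ U S (insert e S')) ≤
        bprobTwo E p (fun S S' => U (insert e S) (insert e S')) := by
      refine bprobTwo_mono h0 h1 ?_
      rintro S S' (⟨A, B, hT, hA, hB⟩ | ⟨A, B, hT, hA, hB⟩)
      · exact ⟨A, B, hT, hA, hB.trans (Finset.subset_insert _ _)⟩
      · exact ⟨A, B, hT, hA.trans (Finset.subset_insert _ _), hB⟩
    have e4 : bprobTwo E p U ≤
        bprobTwo E p (fun S S' => U (insert e S) S' ∧ U S (insert e S')) := by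
      refine bprobTwo_mono h0 h1 ?_
      rintro S S' ⟨A, B, hT, hA, hB⟩
      exact ⟨⟨A, B, hT, hA.trans (Finset.subset_insert _ _), hB⟩,
        ⟨A, B, hT, hA, hB.trans (Finset.subset_insert _ _)⟩⟩
    have e5 := bprobTwo_or_add_and (E := E) (p := p) (fun S S' => U (insert e S) S')
      (fun S S' => U S (insert e S'))
    set w := bprobTwo E p (fun S S' => U (insert e S) S' ∨ U S (insert e S'))
    set x := bprobTwo E p (fun S S' => U (insert e S) S')
    set y := bprobTwo E p (fun S S' => U S (insert e S'))
    set z := bprobTwo E p (fun S S' => U S S')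
    set v := bprobTwo E p (fun S S' => U (insert e S) (insert e S'))
    -- by inclusion and exclusion `w ≤ x + y - z`, since the conjunction contains `U` itself: this is
    -- what makes the duplicated coordinate at least as favourable as the shared one
    have f1 := mul_le_mul_of_nonneg_left (i1.trans e2) h0
    have f2 := mul_le_mul_of_nonneg_left e1 h0
    have f3 := mul_le_mul_of_nonneg_left i0 h1'
    have f4 := mul_le_mul_of_nonneg_left e3 (mul_nonneg h0 h0)
    have f5 : 0 ≤ (p * (1 - p)) * (x + y - w - z) :=
      mul_nonneg (mul_nonneg h0 h1') (by linarith)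
    nlinarith

/-- The van den Berg–Kesten inequality for two increasing events. -/
lemma bprob_disjOcc_le [DecidableEq α] {E : Finset α} {p : ℝ} (h0 : 0 ≤ p) (h1 : p ≤ 1)
    {Q Q' : Finset α → Prop} (hQ : Monotone Q) (hQ' : Monotone Q') :
    bprob E p (DisjOcc Q Q') ≤ bprob E p Q * bprob E p Q' := by
  rw [← bprobTwo_prod]
  refine le_trans (bprob_mono h0 h1 ?_) ((bprob_disjoint_pair_le h0 h1 fun A B => Q A ∧ Q' B).trans
    (bprobTwo_mono h0 h1 ?_))
  · rintro S - ⟨A, B, hd, hA, hB, hQA, hQB⟩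
    exact ⟨A, B, ⟨hQA, hQB⟩, hd, hA, hB⟩
  · rintro S S' ⟨A, B, ⟨hQA, hQB⟩, hA, hB⟩
    exact ⟨hQ hA hQA, hQ' hB hQB⟩

/-- The event that the events `Q i`, for `i ∈ I`, occur on pairwise disjoint subsets of the random
set. -/
def DisjFam {ι : Type*} (I : Finset ι) (Q : ι → Finset α → Prop) (S : Finset α) : Prop :=
  ∃ A : ι → Finset α, (∀ i ∈ I, ∀ j ∈ I, i ≠ j → Disjoint (A i) (A j)) ∧
    ∀ i ∈ I, A i ⊆ S ∧ Q i (A i)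

lemma monotone_disjFam {ι : Type*} (I : Finset ι) (Q : ι → Finset α → Prop) :
    Monotone (DisjFam I Q) := by
  rintro S S' hS ⟨A, hd, hA⟩
  exact ⟨A, hd, fun j hj => ⟨(hA j hj).1.trans hS, (hA j hj).2⟩⟩

/-- The van den Berg–Kesten inequality for a finite family of increasing events. -/
lemma bprob_disjFam_le [DecidableEq α] {ι : Type*} {E : Finset α} {p : ℝ} (h0 : 0 ≤ p)
    (h1 : p ≤ 1) (I : Finset ι) (Q : ι → Finset α → Prop) (hQ : ∀ i, Monotone (Q i)) :
    bprob E p (DisjFam I Q) ≤ ∏ i ∈ I, bprob E p (Q i) := by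
  classical
  induction I using Finset.induction_on with
  | empty => simpa using bprob_le_one h0 h1 _
  | insert i I hi ih =>
    rw [Finset.prod_insert hi]
    refine le_trans (le_trans (bprob_mono h0 h1 ?_) (bprob_disjOcc_le h0 h1 (hQ i)
      (monotone_disjFam I Q))) (mul_le_mul_of_nonneg_left ih (bprob_nonneg h0 h1 _))
    rintro S - ⟨A, hd, hA⟩
    refine ⟨A i, I.biUnion A, ?_, (hA i (Finset.mem_insert_self _ _)).1, ?_,
      (hA i (Finset.mem_insert_self _ _)).2, A, ?_, ?_⟩
    · rw [Finset.disjoint_biUnion_right]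
      exact fun j hj => hd i (Finset.mem_insert_self _ _) j (Finset.mem_insert_of_mem hj)
        (fun h => hi (h ▸ hj))
    · exact Finset.biUnion_subset.2 fun j hj => (hA j (Finset.mem_insert_of_mem hj)).1
    · exact fun a ha b hb =>
        hd a (Finset.mem_insert_of_mem ha) b (Finset.mem_insert_of_mem hb)
    · exact fun j hj => ⟨Finset.subset_biUnion_of_mem A hj, (hA j (Finset.mem_insert_of_mem hj)).2⟩

/-- Lower bound for the upper tail of the binomial distribution, by a single point mass. -/
lemma le_bprob_card_ge [DecidableEq α] {E F : Finset α} {p : ℝ} (h0 : 0 ≤ p) (h1 : p ≤ 1)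
    (hF : F ⊆ E) (k : ℕ) :
    (F.card.choose k : ℝ) * (p ^ k * (1 - p) ^ (F.card - k)) ≤
      bprob E p (fun S => k ≤ (S ∩ F).card) := by
  have : 0 ≤ 1 - p := by linarith
  have hsum : bprob F p (fun S => k ≤ S.card) =
      ∑ S ∈ F.powerset with k ≤ S.card, p ^ S.card * (1 - p) ^ (F.card - S.card) := by
    rw [Finset.sum_filter, bprob]
    exact Finset.sum_congr rfl fun S _ => by congr
  rw [bprob_inter p hF (fun S => k ≤ S.card), hsum,
    ← Finset.card_powersetCard, ← nsmul_eq_mul, ← Finset.sum_const]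
  refine le_trans (Finset.sum_le_sum (g := fun S => p ^ S.card * (1 - p) ^ (F.card - S.card))
    fun S hS => ?_) (Finset.sum_le_sum_of_subset_of_nonneg (fun S hS => ?_) fun S _ _ => ?_)
  · rw [(Finset.mem_powersetCard.1 hS).2]
  · obtain ⟨a, b⟩ := Finset.mem_powersetCard.1 hS
    simp [a, b]
  · positivity

/-- Upper bound for the upper tail of the binomial distribution, by the union bound. -/
lemma bprob_card_ge_le [DecidableEq α] {E F : Finset α} {p : ℝ} (h0 : 0 ≤ p) (h1 : p ≤ 1)
    (hF : F ⊆ E) (k : ℕ) :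
    bprob E p (fun S => k ≤ (S ∩ F).card) ≤ (F.card.choose k : ℝ) * p ^ k := by
  have : ∀ S ⊆ E, k ≤ (S ∩ F).card → ∃ T ∈ F.powersetCard k, T ⊆ S := by
    intro S _ h
    obtain ⟨T, hT, hc⟩ := Finset.exists_subset_card_eq h
    exact ⟨T, Finset.mem_powersetCard.2 ⟨hT.trans Finset.inter_subset_right, hc⟩,
      hT.trans Finset.inter_subset_left⟩
  refine (bprob_mono h0 h1 this).trans ((bprob_exists_le h0 h1 _ _).trans ?_)
  rw [← Finset.card_powersetCard, ← nsmul_eq_mul, ← Finset.sum_const]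
  refine Finset.sum_le_sum fun T hT => ?_
  obtain ⟨a, b⟩ := Finset.mem_powersetCard.1 hT
  rw [bprob_subset p (a.trans hF), b]

/-- The possible edges between the vertex `v` and the set `A`. -/
def star [DecidableEq α] (v : α) (A : Finset α) : Finset (Sym2 α) := A.image fun w => s(v, w)

lemma card_star [DecidableEq α] (v : α) (A : Finset α) : (star v A).card = A.card :=
  Finset.card_image_of_injective _ fun _ _ h => Sym2.congr_right.1 h

lemma card_inter_star [DecidableEq α] (v : α) (A : Finset α) (S : Finset (Sym2 α)) :
    (S ∩ star v A).card = (A.filter fun w => s(v, w) ∈ S).card := by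
  rw [← card_star v (A.filter fun w => s(v, w) ∈ S)]
  congr 1
  ext e
  simp only [star, Finset.mem_inter, Finset.mem_image, Finset.mem_filter]
  constructor
  · rintro ⟨h, w, hw, rfl⟩
    exact ⟨w, ⟨hw, h⟩, rfl⟩
  · rintro ⟨w, ⟨hw, h⟩, rfl⟩
    exact ⟨h, w, hw, rfl⟩

lemma disjoint_star [DecidableEq α] {V A : Finset α} (hd : Disjoint V A) {v v' : α} (hv' : v' ∈ V)
    (hne : v ≠ v') : Disjoint (star v A) (star v' A) := by
  rw [Finset.disjoint_left]
  intro e h h'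
  obtain ⟨w, hw, rfl⟩ := Finset.mem_image.1 h
  obtain ⟨w', hw', h2⟩ := Finset.mem_image.1 h'
  rcases Sym2.eq_iff.1 h2 with ⟨h3, -⟩ | ⟨h3, -⟩
  · exact hne h3.symm
  · exact Finset.disjoint_left.1 hd hv' (h3 ▸ hw)

/-- The probability that some vertex of `V` has at least `k` neighbors in `A`, for disjoint `V` and
`A`. -/
lemma bprob_exists_star [DecidableEq α] {E : Finset (Sym2 α)} (p : ℝ) {V A : Finset α}
    (hd : Disjoint V A) (k : ℕ) :
    bprob E p (fun S => ∃ v ∈ V, k ≤ (A.filter fun w => s(v, w) ∈ S).card) =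
      1 - ∏ v ∈ V, (1 - bprob E p (fun S => k ≤ (S ∩ star v A).card)) := by
  have h1 := bprob_forall_of_indep (E := E) p V (fun v => star v A)
    (fun v S => ¬ k ≤ (S ∩ star v A).card) (fun v _ v' hv' => disjoint_star hd hv')
    (fun v _ S _ => by rw [Finset.inter_assoc, Finset.inter_self])
  simp only [bprob_not] at h1
  rw [← h1, eq_sub_iff_add_eq, ← eq_sub_iff_add_eq', ← bprob_not]
  refine bprob_congr fun S _ => ?_
  simp only [card_inter_star]
  push Not
  rfl

/-- Union bound for the probability that a vertex has at least `k` neighbors in `A`. -/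
lemma bprob_star_le [DecidableEq α] {E : Finset (Sym2 α)} {p : ℝ} (h0 : 0 ≤ p) (h1 : p ≤ 1)
    (v : α) {A : Finset α} {m : ℕ} (hA : A.card ≤ m) (k : ℕ) :
    bprob E p (fun S => k ≤ (S ∩ star v A).card) ≤ (m * p) ^ k / (k.factorial : ℝ) := by
  have h2 : bprob E p (fun S => k ≤ (S ∩ star v A).card) =
      bprob E p (fun S => k ≤ (S ∩ (star v A ∩ E)).card) :=
    bprob_congr fun S hS => by
      rw [Finset.inter_comm (star v A), ← Finset.inter_assoc, Finset.inter_eq_left.2 hS]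
  have h3 : (star v A ∩ E).card ≤ m :=
    (Finset.card_le_card Finset.inter_subset_left).trans ((card_star v A).le.trans hA)
  rw [h2]
  refine (bprob_card_ge_le h0 h1 Finset.inter_subset_right k).trans ?_
  rw [mul_pow, mul_div_right_comm]
  refine mul_le_mul_of_nonneg_right (le_trans ?_ (Nat.choose_le_pow_div k m)) (by positivity)
  exact_mod_cast Nat.choose_le_choose k h3

end Bernoulli

/-! ### Internally solved sets of the square lattice -/

section Grid

/-- Nearest neighbors in the square lattice. -/
def GAdj (u w : ℤ × ℤ) : Prop :=
  (u.1 = w.1 ∧ (u.2 = w.2 + 1 ∨ w.2 = u.2 + 1)) ∨ (u.2 = w.2 ∧ (u.1 = w.1 + 1 ∨ w.1 = u.1 + 1))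

lemma GAdj.symm {u w : ℤ × ℤ} (h : GAdj u w) : GAdj w u := by
  unfold GAdj at *; omega

open Classical in
/-- The people neighbors of `v` in `B`. -/
def nbrs (P : ℤ × ℤ → ℤ × ℤ → Prop) (v : ℤ × ℤ) (B : Finset (ℤ × ℤ)) : Finset (ℤ × ℤ) :=
  B.filter (P v)

lemma mem_nbrs {P : ℤ × ℤ → ℤ × ℤ → Prop} {v w : ℤ × ℤ} {B : Finset (ℤ × ℤ)} :
    w ∈ nbrs P v B ↔ w ∈ B ∧ P v w := by
  classical
  simp [nbrs]

/-- The merging conditions with thresholds `σ`, `1`, `2`, for finite subsets of the lattice and the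
people relation `P`. -/
def GFits (P : ℤ × ℤ → ℤ × ℤ → Prop) (σ : ℕ) (A B : Finset (ℤ × ℤ)) : Prop :=
  (∃ v ∈ A, ∃ w ∈ B, GAdj v w ∧ P v w) ∨
  (∃ v ∈ A, ∃ w ∈ B, ∃ w' ∈ B, w ≠ w' ∧ GAdj v w ∧ GAdj v w') ∨
  (∃ v ∈ A, σ ≤ (nbrs P v B).card ∧ ∃ w ∈ B, GAdj v w)

/-- The internally solved sets: those that can be assembled from singletons, merging two disjoint
internally solved sets at a time. -/
inductive IS (P : ℤ × ℤ → ℤ × ℤ → Prop) (σ : ℕ) : Finset (ℤ × ℤ) → Prop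
  | single (v : ℤ × ℤ) : IS P σ {v}
  | merge (A B : Finset (ℤ × ℤ)) (hA : IS P σ A) (hB : IS P σ B) (hd : Disjoint A B)
      (hf : GFits P σ A B) : IS P σ (A ∪ B)

lemma IS.nonempty {P : ℤ × ℤ → ℤ × ℤ → Prop} {σ : ℕ} {W : Finset (ℤ × ℤ)} (h : IS P σ W) :
    W.Nonempty := by
  induction h with
  | single v => exact Finset.singleton_nonempty v
  | merge A B hA hB hd hf ihA ihB => exact ihA.mono Finset.subset_union_left

lemma GFits.exists_adj {P : ℤ × ℤ → ℤ × ℤ → Prop} {σ : ℕ} {A B : Finset (ℤ × ℤ)}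
    (h : GFits P σ A B) : ∃ v ∈ A, ∃ w ∈ B, GAdj v w := by
  obtain ⟨v, hv, w, hw, h, _⟩ | ⟨v, hv, w, hw, _, _, _, h, _⟩ | ⟨v, hv, _, w, hw, h⟩ := h <;>
  exact ⟨v, hv, w, hw, h⟩

lemma GFits.image {P P' : ℤ × ℤ → ℤ × ℤ → Prop} {σ : ℕ} {A B : Finset (ℤ × ℤ)}
    (h : GFits P σ A B) {τ : ℤ × ℤ → ℤ × ℤ} (hτ : Function.Injective τ)
    (hadj : ∀ u w, GAdj u w → GAdj (τ u) (τ w))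
    (hP : ∀ u ∈ A, ∀ w ∈ B, P u w → P' (τ u) (τ w)) :
    GFits P' σ (A.image τ) (B.image τ) := by
  obtain ⟨v, hv, w, hw, h, h'⟩ | ⟨v, hv, w, hw, w', hw', hne, h, h'⟩ | ⟨v, hv, hc, w, hw, h⟩ := h
  · exact Or.inl ⟨_, Finset.mem_image_of_mem τ hv, _, Finset.mem_image_of_mem τ hw, hadj _ _ h,
      hP _ hv _ hw h'⟩
  · exact Or.inr (Or.inl ⟨_, Finset.mem_image_of_mem τ hv, _, Finset.mem_image_of_mem τ hw, _,
      Finset.mem_image_of_mem τ hw', hτ.ne hne, hadj _ _ h, hadj _ _ h'⟩)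
  · refine Or.inr (Or.inr ⟨_, Finset.mem_image_of_mem τ hv, hc.trans ?_, _,
      Finset.mem_image_of_mem τ hw, hadj _ _ h⟩)
    rw [← Finset.card_image_of_injective (nbrs P v B) hτ]
    refine Finset.card_le_card fun x hx => ?_
    obtain ⟨y, hy, rfl⟩ := Finset.mem_image.1 hx
    obtain ⟨hyB, hy⟩ := mem_nbrs.1 hy
    exact mem_nbrs.2 ⟨Finset.mem_image_of_mem τ hyB, hP _ hv _ hyB hy⟩

lemma IS.image {P P' : ℤ × ℤ → ℤ × ℤ → Prop} {σ : ℕ} {W : Finset (ℤ × ℤ)} (h : IS P σ W)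
    {τ : ℤ × ℤ → ℤ × ℤ} (hτ : Function.Injective τ)
    (hadj : ∀ u w, GAdj u w → GAdj (τ u) (τ w))
    (hP : ∀ u ∈ W, ∀ w ∈ W, P u w → P' (τ u) (τ w)) : IS P' σ (W.image τ) := by
  induction h with
  | single v => exact IS.single _
  | merge A B hA hB hd hf ihA ihB =>
    rw [Finset.image_union]
    have hl : ∀ u ∈ A, u ∈ A ∪ B := fun u => Finset.mem_union_left B
    have hr : ∀ u ∈ B, u ∈ A ∪ B := fun u => Finset.mem_union_right A
    exact IS.merge _ _ (ihA fun u hu w hw => hP u (hl u hu) w (hl w hw))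
      (ihB fun u hu w hw => hP u (hr u hu) w (hr w hw))
      ((Finset.disjoint_image hτ).2 hd)
      (hf.image hτ hadj fun u hu w hw => hP u (hl u hu) w (hr w hw))

lemma IS.congr {P P' : ℤ × ℤ → ℤ × ℤ → Prop} {σ : ℕ} {W : Finset (ℤ × ℤ)} (h : IS P σ W)
    (hP : ∀ u ∈ W, ∀ w ∈ W, P u w → P' u w) : IS P' σ W := by
  simpa using h.image (τ := id) Function.injective_id (fun _ _ h => h) hP

/-- The people relation with edge set `S`. -/
def edgeRel (S : Finset (Sym2 (ℤ × ℤ))) (u w : ℤ × ℤ) : Prop := s(u, w) ∈ S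

/-- The coordinates of a point, indexed by `Bool`. -/
def co (o : Bool) (v : ℤ × ℤ) : ℤ := cond o v.1 v.2

@[simp] lemma co_true (v : ℤ × ℤ) : co true v = v.1 := rfl
@[simp] lemma co_false (v : ℤ × ℤ) : co false v = v.2 := rfl

/-- A boundary is a pair `(o, i)`, which stands for the line between the values `i` and `i + 1` of
the coordinate `o`. It is crossed by a set which has points on both sides. -/
def Crosses (b : Bool × ℤ) (W : Finset (ℤ × ℤ)) : Prop :=
  (∃ u ∈ W, co b.1 u ≤ b.2) ∧ ∃ u ∈ W, b.2 + 1 ≤ co b.1 u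

open Classical in
/-- The edges in `S` witness that the boundary `b` can be crossed inside `W`: either some vertex next
to the boundary has `σ` people neighbors on the other side, or some lattice edge across the boundary
is also a people edge. -/
def CrossWit (σ : ℕ) (b : Bool × ℤ) (W : Finset (ℤ × ℤ)) (S : Finset (Sym2 (ℤ × ℤ))) : Prop :=
  (∃ v ∈ W, co b.1 v = b.2 ∧ σ ≤ (W.filter fun w => b.2 + 1 ≤ co b.1 w ∧ s(v, w) ∈ S).card) ∨
  (∃ v ∈ W, co b.1 v = b.2 + 1 ∧ σ ≤ (W.filter fun w => co b.1 w ≤ b.2 ∧ s(v, w) ∈ S).card) ∨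
  (∃ v ∈ W, ∃ w ∈ W, co b.1 v = b.2 ∧ co b.1 w = b.2 + 1 ∧ GAdj v w ∧ s(v, w) ∈ S)

lemma CrossWit.mono {σ : ℕ} {b : Bool × ℤ} {W W' : Finset (ℤ × ℤ)} {S S' : Finset (Sym2 (ℤ × ℤ))}
    (h : CrossWit σ b W S) (hW : W ⊆ W') (hS : S ⊆ S') : CrossWit σ b W' S' := by
  obtain ⟨v, hv, hv', hc⟩ | ⟨v, hv, hv', hc⟩ | ⟨v, hv, w, hw, hvi, hwi, ha, hs⟩ := h
  · refine Or.inl ⟨v, hW hv, hv', hc.trans (Finset.card_le_card fun w hw => ?_)⟩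
    simp only [Finset.mem_filter] at hw ⊢
    exact ⟨hW hw.1, hw.2.1, hS hw.2.2⟩
  · refine Or.inr (Or.inl ⟨v, hW hv, hv', hc.trans (Finset.card_le_card fun w hw => ?_)⟩)
    simp only [Finset.mem_filter] at hw ⊢
    exact ⟨hW hw.1, hw.2.1, hS hw.2.2⟩
  · exact Or.inr (Or.inr ⟨v, hW hv, w, hW hw, hvi, hwi, ha, hS hs⟩)

/-- The edge `e` joins the two sides of the boundary `b`. -/
def EdgeAcross (b : Bool × ℤ) (e : Sym2 (ℤ × ℤ)) : Prop :=
  ∃ u w, e = s(u, w) ∧ co b.1 u ≤ b.2 ∧ b.2 + 1 ≤ co b.1 w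

/-- The set `A` lies on one side of the boundary `b`, and `B` on the other side. -/
def Separates (b : Bool × ℤ) (A B : Finset (ℤ × ℤ)) : Prop :=
  ((∀ u ∈ A, co b.1 u ≤ b.2) ∧ ∀ u ∈ B, b.2 + 1 ≤ co b.1 u) ∨
  ((∀ u ∈ B, co b.1 u ≤ b.2) ∧ ∀ u ∈ A, b.2 + 1 ≤ co b.1 u)

lemma Crosses.union {b : Bool × ℤ} {A B : Finset (ℤ × ℤ)} (h : Crosses b (A ∪ B)) :
    Crosses b A ∨ Crosses b B ∨ Separates b A B := by
  obtain ⟨⟨u, hu, hub⟩, ⟨w, hw, hwb⟩⟩ := h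
  by_contra! hcon
  obtain ⟨hA, hB, hs⟩ := hcon
  simp only [Crosses, not_and, not_exists, not_le] at hA hB
  refine hs ?_
  rcases Finset.mem_union.1 hu with hu | hu <;> rcases Finset.mem_union.1 hw with hw | hw
  · exact absurd (hA ⟨u, hu, hub⟩ w hw) (by omega)
  · refine Or.inl ⟨fun x hx => ?_, fun x hx => ?_⟩
    · have := hA ⟨u, hu, hub⟩ x hx; omega
    · by_contra hxb
      exact absurd (hB ⟨x, hx, by omega⟩ w hw) (by omega)
  · refine Or.inr ⟨fun x hx => ?_, fun x hx => ?_⟩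
    · have := hB ⟨u, hu, hub⟩ x hx; omega
    · by_contra hxb
      exact absurd (hA ⟨x, hx, by omega⟩ w hw) (by omega)
  · exact absurd (hB ⟨u, hu, hub⟩ w hw) (by omega)

/-- Two touching sets are separated by at most one boundary. -/
lemma Separates.unique {b b' : Bool × ℤ} {A B : Finset (ℤ × ℤ)} (h : Separates b A B)
    (h' : Separates b' A B) {v w : ℤ × ℤ} (hv : v ∈ A) (hw : w ∈ B) (hvw : GAdj v w) : b = b' := by
  obtain ⟨o, i⟩ := b
  obtain ⟨o', i'⟩ := b'
  have e1 : (co o v ≤ i ∧ i + 1 ≤ co o w) ∨ (co o w ≤ i ∧ i + 1 ≤ co o v) :=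
    h.imp (fun h => ⟨h.1 v hv, h.2 w hw⟩) (fun h => ⟨h.1 w hw, h.2 v hv⟩)
  have e2 : (co o' v ≤ i' ∧ i' + 1 ≤ co o' w) ∨ (co o' w ≤ i' ∧ i' + 1 ≤ co o' v) :=
    h'.imp (fun h => ⟨h.1 v hv, h.2 w hw⟩) (fun h => ⟨h.1 w hw, h.2 v hv⟩)
  unfold GAdj at hvw
  cases o <;> cases o' <;> simp only [co_true, co_false, Prod.mk.injEq] at * <;>
    first | (refine ⟨trivial, ?_⟩; omega) | (exfalso; omega)

open Classical in
/-- The edges in `S` between `A` and `B`. -/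
def between (S : Finset (Sym2 (ℤ × ℤ))) (A B : Finset (ℤ × ℤ)) : Finset (Sym2 (ℤ × ℤ)) :=
  S.filter fun e => ∃ a ∈ A, ∃ c ∈ B, e = s(a, c)

lemma mem_between {S : Finset (Sym2 (ℤ × ℤ))} {A B : Finset (ℤ × ℤ)} {e : Sym2 (ℤ × ℤ)} :
    e ∈ between S A B ↔ e ∈ S ∧ ∃ a ∈ A, ∃ c ∈ B, e = s(a, c) := by
  classical
  simp [between]

lemma GFits.crossWit {S : Finset (Sym2 (ℤ × ℤ))} {σ : ℕ} {A B : Finset (ℤ × ℤ)}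
    (h : GFits (edgeRel S) σ A B) {b : Bool × ℤ} (hs : Separates b A B) :
    CrossWit σ b (A ∪ B) (between S A B) := by
  classical
  obtain ⟨o, i⟩ := b
  have hl : ∀ u ∈ A, u ∈ A ∪ B := fun u => Finset.mem_union_left B
  have hr : ∀ u ∈ B, u ∈ A ∪ B := fun u => Finset.mem_union_right A
  -- a lattice edge across the boundary joins the two lines next to it
  have key : ∀ v ∈ A, ∀ w ∈ B, GAdj v w →
      (co o v = i ∧ co o w = i + 1) ∨ (co o w = i ∧ co o v = i + 1) := by
    intro v hv w hw hvw
    have e1 : (co o v ≤ i ∧ i + 1 ≤ co o w) ∨ (co o w ≤ i ∧ i + 1 ≤ co o v) :=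
      hs.imp (fun h => ⟨h.1 v hv, h.2 w hw⟩) (fun h => ⟨h.1 w hw, h.2 v hv⟩)
    unfold GAdj at hvw
    cases o <;> simp only [co_true, co_false] at * <;> omega
  obtain ⟨v, hv, w, hw, h, h'⟩ | ⟨v, hv, w, hw, w', hw', hne, h, h'⟩ | ⟨v, hv, hc, w, hw, h⟩ := h
  · have hb : s(v, w) ∈ between S A B := mem_between.2 ⟨h', v, hv, w, hw, rfl⟩
    rcases key v hv w hw h with ⟨h1, h2⟩ | ⟨h1, h2⟩
    · exact Or.inr (Or.inr ⟨v, hl v hv, w, hr w hw, h1, h2, h, hb⟩)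
    · exact Or.inr (Or.inr ⟨w, hr w hw, v, hl v hv, h1, h2, h.symm, by rwa [Sym2.eq_swap]⟩)
  · exfalso
    apply hne
    have k1 := key v hv w hw h
    have k2 := key v hv w' hw' h'
    unfold GAdj at h h'
    ext <;> cases o <;> simp only [co_true, co_false] at * <;> omega
  · have hcard : ∀ p : ℤ × ℤ → Prop, (∀ x ∈ B, p x) →
        σ ≤ ((A ∪ B).filter fun x => p x ∧ s(v, x) ∈ between S A B).card := by
      intro p hp
      refine hc.trans (Finset.card_le_card fun x hx => ?_)
      obtain ⟨hxB, hx⟩ := mem_nbrs.1 hx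
      exact Finset.mem_filter.2 ⟨hr x hxB, hp x hxB, mem_between.2 ⟨hx, v, hv, x, hxB, rfl⟩⟩
    rcases hs with ⟨h1, h2⟩ | ⟨h1, h2⟩
    · refine Or.inl ⟨v, hl v hv, ?_, by convert hcard _ h2⟩
      have := h1 v hv; have := h2 w hw; have := key v hv w hw h
      simp only at *
      omega
    · refine Or.inr (Or.inl ⟨v, hl v hv, ?_, by convert hcard _ h1⟩)
      have := h1 w hw; have := h2 v hv; have := key v hv w hw h
      simp only at *
      omega

/-- In an internally solved set, the boundaries it crosses have witnesses which use pairwise disjoint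
sets of people edges, each edge joining the two sides of its boundary. Indeed, when two touching sets
merge then at most one new boundary is crossed, and its witness consists of edges between the two
sets. -/
lemma IS.exists_disjoint_witnesses {S : Finset (Sym2 (ℤ × ℤ))} {σ : ℕ} {W : Finset (ℤ × ℤ)}
    (h : IS (edgeRel S) σ W) :
    ∃ T : Bool × ℤ → Finset (Sym2 (ℤ × ℤ)), (∀ b b', b ≠ b' → Disjoint (T b) (T b')) ∧
      ∀ b, (T b ⊆ S ∧ T b ⊆ W.sym2 ∧ ∀ e ∈ T b, EdgeAcross b e) ∧
        (Crosses b W → CrossWit σ b W (T b)) := by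
  classical
  induction h with
  | single v =>
    refine ⟨fun _ => ∅, fun _ _ _ => Finset.disjoint_empty_left _, fun b => ⟨by simp, fun hb => ?_⟩⟩
    obtain ⟨⟨u, hu, hub⟩, ⟨w, hw, hwb⟩⟩ := hb
    rw [Finset.mem_singleton] at hu hw
    subst hu; subst hw
    omega
  | merge A B hA hB hd hf ihA ihB =>
    obtain ⟨TA, dA, hTA⟩ := ihA
    obtain ⟨TB, dB, hTB⟩ := ihB
    have hl : A ⊆ A ∪ B := Finset.subset_union_left
    have hr : B ⊆ A ∪ B := Finset.subset_union_right
    have dAB : ∀ b b', Disjoint (TA b) (TB b') := by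
      intro b b'
      rw [Finset.disjoint_left]
      intro e h1 h2
      have h1 := (hTA b).1.2.1 h1
      have h2 := (hTB b').1.2.1 h2
      induction e with
      | _ x y =>
        rw [Finset.mk_mem_sym2_iff] at h1 h2
        exact Finset.disjoint_left.1 hd h1.1 h2.1
    have dC : ∀ X, (X = A ∨ X = B) → Disjoint X.sym2 (between S A B) := by
      intro X hX
      rw [Finset.disjoint_left]
      intro e h1 h2
      obtain ⟨-, a, ha, c, hc, rfl⟩ := mem_between.1 h2
      rw [Finset.mk_mem_sym2_iff] at h1
      rcases hX with rfl | rfl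
      · exact Finset.disjoint_left.1 hd h1.2 hc
      · exact Finset.disjoint_left.1 hd ha h1.1
    have dAC : ∀ b, Disjoint (TA b) (between S A B) := fun b =>
      (dC A (Or.inl rfl)).mono_left (hTA b).1.2.1
    have dBC : ∀ b, Disjoint (TB b) (between S A B) := fun b =>
      (dC B (Or.inr rfl)).mono_left (hTB b).1.2.1
    obtain ⟨v, hv, w, hw, hvw⟩ := hf.exists_adj
    refine ⟨fun b => if Crosses b A then TA b else if Crosses b B then TB b else
      if Separates b A B then between S A B else ∅, fun b b' hbb => ?_, fun b => ⟨?_, fun hb => ?_⟩⟩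
    · have hu : ¬ (Separates b A B ∧ Separates b' A B) := fun h => hbb (h.1.unique h.2 hv hw hvw)
      have := dA b b' hbb
      have := dB b b' hbb
      have := dAB b b'
      have := (dAB b' b).symm
      have := dAC b
      have := (dAC b').symm
      have := dBC b
      have := (dBC b').symm
      dsimp only
      split_ifs <;> first | assumption | exact Finset.disjoint_empty_left _ |
        exact Finset.disjoint_empty_right _ | (exfalso; tauto)
    · dsimp only
      split_ifs with h1 h2 h3
      · obtain ⟨a, a', a''⟩ := (hTA b).1
        exact ⟨a, a'.trans (Finset.sym2_mono hl), a''⟩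
      · obtain ⟨a, a', a''⟩ := (hTB b).1
        exact ⟨a, a'.trans (Finset.sym2_mono hr), a''⟩
      · refine ⟨fun e he => (mem_between.1 he).1, fun e he => ?_, fun e he => ?_⟩
        · obtain ⟨-, a, ha, c, hc, rfl⟩ := mem_between.1 he
          exact Finset.mk_mem_sym2_iff.2 ⟨hl ha, hr hc⟩
        · obtain ⟨-, a, ha, c, hc, rfl⟩ := mem_between.1 he
          rcases h3 with h3 | h3
          · exact ⟨a, c, rfl, h3.1 a ha, h3.2 c hc⟩
          · exact ⟨c, a, Sym2.eq_swap, h3.1 c hc, h3.2 a ha⟩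
      · simp
    · dsimp only
      split_ifs with h1 h2 h3
      · exact ((hTA b).2 h1).mono hl le_rfl
      · exact ((hTB b).2 h2).mono hr le_rfl
      · exact hf.crossWit h3
      · exact absurd hb.union (by tauto)

/-- The set `W` has the bounding box with corners `l` and `u`. -/
def Spans (l u : ℤ × ℤ) (W : Finset (ℤ × ℤ)) : Prop :=
  (∀ v ∈ W, ∀ o, co o l ≤ co o v ∧ co o v ≤ co o u) ∧
  ∀ o, (∃ v ∈ W, co o v = co o l) ∧ ∃ v ∈ W, co o v = co o u

lemma exists_spans {W : Finset (ℤ × ℤ)} (hW : W.Nonempty) : ∃ l u, Spans l u W := by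
  have h1 : ∀ o, ∃ v ∈ W, ∀ w ∈ W, co o v ≤ co o w := fun o => Finset.exists_min_image W (co o) hW
  have h2 : ∀ o, ∃ v ∈ W, ∀ w ∈ W, co o w ≤ co o v := fun o => Finset.exists_max_image W (co o) hW
  choose f hf hf' using h1
  choose g hg hg' using h2
  refine ⟨(co true (f true), co false (f false)), (co true (g true), co false (g false)),
    fun v hv o => ?_, fun o => ⟨⟨f o, hf o, ?_⟩, g o, hg o, ?_⟩⟩
  · have := hf' o v hv
    have := hg' o v hv
    cases o <;> exact ⟨by assumption, by assumption⟩
  · cases o <;> rfl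
  · cases o <;> rfl

lemma Spans.mem_Icc {l u : ℤ × ℤ} {W : Finset (ℤ × ℤ)} (h : Spans l u W) : W ⊆ Finset.Icc l u := by
  intro v hv
  have h1 := h.1 v hv true
  have h2 := h.1 v hv false
  simp only [co_true, co_false] at h1 h2
  rw [Finset.mem_Icc, Prod.le_def, Prod.le_def]
  exact ⟨⟨h1.1, h2.1⟩, h1.2, h2.2⟩

lemma Spans.le_of_subset {l u l' u' : ℤ × ℤ} {W W' : Finset (ℤ × ℤ)} (h : Spans l u W)
    (h' : Spans l' u' W') (hW : W' ⊆ W) (o : Bool) :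
    co o l ≤ co o l' ∧ co o l' ≤ co o u' ∧ co o u' ≤ co o u := by
  obtain ⟨⟨v, hv, hvl⟩, w, hw, hwu⟩ := h'.2 o
  have h1 := h.1 v (hW hv) o
  have h2 := h.1 w (hW hw) o
  have h3 := h'.1 v hv o
  omega

/-- The number of lines of the box with corners `l` and `u` in the direction `o`. -/
def side (o : Bool) (l u : ℤ × ℤ) : ℕ := (co o u - co o l + 1).toNat

/-- The half-perimeter of a box. -/
def hper (l u : ℤ × ℤ) : ℕ := side true l u + side false l u

lemma Spans.side_union_le {l u l₁ u₁ l₂ u₂ : ℤ × ℤ} {A B : Finset (ℤ × ℤ)}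
    (h : Spans l u (A ∪ B)) (h₁ : Spans l₁ u₁ A) (h₂ : Spans l₂ u₂ B) {v w : ℤ × ℤ} (hv : v ∈ A)
    (hw : w ∈ B) (hvw : GAdj v w) (o : Bool) :
    side o l₁ u₁ ≤ side o l u ∧ side o l₂ u₂ ≤ side o l u ∧
      side o l u ≤ side o l₁ u₁ + side o l₂ u₂ := by
  have e1 := h.le_of_subset h₁ Finset.subset_union_left o
  have e2 := h.le_of_subset h₂ Finset.subset_union_right o
  have e3 := h₁.1 v hv o
  have e4 := h₂.1 w hw o
  have e5 : co o v ≤ co o w + 1 ∧ co o w ≤ co o v + 1 := by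
    unfold GAdj at hvw
    cases o <;> simp only [co_true, co_false] <;> omega
  obtain ⟨⟨x, hx, hxl⟩, y, hy, hyu⟩ := h.2 o
  have e6 : co o l₁ ≤ co o x ∨ co o l₂ ≤ co o x :=
    (Finset.mem_union.1 hx).imp (fun hx => (h₁.1 x hx o).1) (fun hx => (h₂.1 x hx o).1)
  have e7 : co o y ≤ co o u₁ ∨ co o y ≤ co o u₂ :=
    (Finset.mem_union.1 hy).imp (fun hy => (h₁.1 y hy o).2) (fun hy => (h₂.1 y hy o).2)
  unfold side
  omega

/-- Going down the merging history of an internally solved set `W`, along the larger half, one meets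
either an internally solved set whose half-perimeter is smaller by between `d` and `2 * d`, or two
disjoint internally solved sets, not too small, whose union almost spans the bounding box of `W`. -/
lemma IS.descent {P : ℤ × ℤ → ℤ × ℤ → Prop} {σ : ℕ} {W : Finset (ℤ × ℤ)} {l u : ℤ × ℤ}
    {d : ℕ} (hd : d + 2 ≤ hper l u) {U : Finset (ℤ × ℤ)} (hU : IS P σ U)
    (hUW : U ⊆ W) {l' u' : ℤ × ℤ} (hlu' : Spans l' u' U) (hUd : hper l u < hper l' u' + d) :
    (∃ W' l₁ u₁, IS P σ W' ∧ W' ⊆ W ∧ Spans l₁ u₁ W' ∧ hper l₁ u₁ + d ≤ hper l u ∧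
      hper l u ≤ hper l₁ u₁ + 2 * d) ∨
    ∃ A B l₁ u₁ l₂ u₂ l₃ u₃, IS P σ A ∧ IS P σ B ∧ Disjoint A B ∧ A ⊆ W ∧ B ⊆ W ∧ Spans l₁ u₁ A ∧
      Spans l₂ u₂ B ∧ Spans l₃ u₃ (A ∪ B) ∧ d ≤ hper l₁ u₁ ∧ d ≤ hper l₂ u₂ ∧
      hper l₁ u₁ + d ≤ hper l u ∧ hper l₂ u₂ + d ≤ hper l u ∧
      hper l u < hper l₃ u₃ + d ∧ ∀ o, side o l₁ u₁ ≤ side o l₃ u₃ ∧ side o l₂ u₂ ≤ side o l₃ u₃ ∧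
      side o l₃ u₃ ≤ side o l₁ u₁ + side o l₂ u₂ := by
  induction hU generalizing l' u' with
  | single v =>
    exfalso
    have hs : ∀ o, side o l' u' = 1 := by
      intro o
      obtain ⟨⟨x, hx, hxl⟩, y, hy, hyu⟩ := hlu'.2 o
      rw [Finset.mem_singleton] at hx hy
      subst hx; subst hy
      unfold side
      omega
    unfold hper at hUd hd
    rw [hs, hs] at hUd
    omega
  | merge A B hA hB hdis hf ihA ihB =>
    obtain ⟨l₁, u₁, h₁⟩ := exists_spans hA.nonempty
    obtain ⟨l₂, u₂, h₂⟩ := exists_spans hB.nonempty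
    have hAW := Finset.subset_union_left.trans hUW
    have hBW := Finset.subset_union_right.trans hUW
    by_cases cA : hper l u < hper l₁ u₁ + d
    · exact ihA hAW h₁ cA
    by_cases cB : hper l u < hper l₂ u₂ + d
    · exact ihB hBW h₂ cB
    obtain ⟨v, hv, w, hw, hvw⟩ := hf.exists_adj
    have hside := hlu'.side_union_le h₁ h₂ hv hw hvw
    have hle : hper l' u' ≤ hper l₁ u₁ + hper l₂ u₂ := by
      have := hside true; have := hside false
      unfold hper; omega
    by_cases dA : d ≤ hper l₁ u₁
    · by_cases dB : d ≤ hper l₂ u₂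
      · exact Or.inr ⟨A, B, l₁, u₁, l₂, u₂, l', u', hA, hB, hdis, hAW, hBW, h₁, h₂, hlu', dA, dB, by omega,
          by omega, hUd, hside⟩
      · exact Or.inl ⟨A, l₁, u₁, hA, hAW, h₁, by omega, by omega⟩
    · exact Or.inl ⟨B, l₂, u₂, hB, hBW, h₂, by omega, by omega⟩

end Grid

/-! ### The cost of a growth path -/

section Potential

/-- The function `-log (1 - exp (-t))`: the cost of an event of probability `1 - exp (-t)`. -/
def hcost (t : ℝ) : ℝ := -Real.log (1 - Real.exp (-t))

lemma one_sub_exp_pos {t : ℝ} (ht : 0 < t) : 0 < 1 - Real.exp (-t) := by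
  have : Real.exp (-t) < Real.exp 0 := Real.exp_lt_exp.2 (by linarith)
  rw [Real.exp_zero] at this
  linarith

lemma exp_neg_hcost {t : ℝ} (ht : 0 < t) : Real.exp (-hcost t) = 1 - Real.exp (-t) := by
  rw [hcost, neg_neg, Real.exp_log (one_sub_exp_pos ht)]

lemma hcost_pos {t : ℝ} (ht : 0 < t) : 0 < hcost t := by
  rw [hcost, neg_pos]
  exact Real.log_neg (one_sub_exp_pos ht) (by linarith [Real.exp_pos (-t)])

lemma hcost_anti {s t : ℝ} (hs : 0 < s) (hst : s ≤ t) : hcost t ≤ hcost s := by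
  refine neg_le_neg (Real.log_le_log (one_sub_exp_pos hs) ?_)
  have := Real.exp_le_exp.2 (neg_le_neg hst)
  linarith

/-- The increments of the cost function are increasing: this is its convexity. -/
lemma hcost_exchange {x y t : ℝ} (hx : 0 < x) (hxy : x ≤ y) (ht : 0 ≤ t) :
    hcost y + hcost (x + t) ≤ hcost x + hcost (y + t) := by
  unfold hcost
  have h1 := one_sub_exp_pos hx
  have h2 := one_sub_exp_pos (hx.trans_le hxy)
  have h3 := one_sub_exp_pos (show 0 < x + t by linarith)
  have h4 := one_sub_exp_pos (show 0 < y + t by linarith)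
  rw [← neg_add, ← neg_add, neg_le_neg_iff, ← Real.log_mul h1.ne' h4.ne',
    ← Real.log_mul h2.ne' h3.ne']
  refine Real.log_le_log (mul_pos h1 h4) ?_
  rw [neg_add, neg_add, Real.exp_add, Real.exp_add]
  have e1 := Real.exp_le_exp.2 (neg_le_neg hxy)
  have e2 := Real.exp_le_one_iff.2 (neg_nonpos.2 ht)
  nlinarith [mul_nonneg (sub_nonneg.2 e1) (sub_nonneg.2 e2)]

/-- The minimal cost of a lattice path from the origin to `(a, b)`, where the step from `(a, b)` to
`(a + 1, b)` costs `X a b` and the step to `(a, b + 1)` costs `X b a`. On the axes all steps cost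
`X 0 0`. -/
def pot (X : ℕ → ℕ → ℝ) : ℕ → ℕ → ℝ
  | 0, b => b * X 0 0
  | a + 1, 0 => (a + 1) * X 0 0
  | a + 1, b + 1 => min (pot X a (b + 1) + X a (b + 1)) (pot X (a + 1) b + X b (a + 1))
termination_by a b => a + b

/-- The properties of the step costs that are used to bound the cost of a path from below. The last
property says that the cost of a path decreases when it is moved towards the diagonal. -/
structure IsStepCost (X : ℕ → ℕ → ℝ) : Prop where
  nonneg : ∀ a b, 0 ≤ X a b
  anti : ∀ a b a' b', a ≤ a' → b ≤ b' → X a' b' ≤ X a b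
  zero_right : ∀ a, X a 0 = X 0 0
  exchange : ∀ b k, b ≤ k → X k (b + 1) + X b k ≤ X k b + X b (k + 1)

variable {X : ℕ → ℕ → ℝ}

lemma pot_zero_left (X : ℕ → ℕ → ℝ) (b : ℕ) : pot X 0 b = b * X 0 0 := by rw [pot]

lemma pot_zero_right (X : ℕ → ℕ → ℝ) (a : ℕ) : pot X a 0 = a * X 0 0 := by
  cases a with
  | zero => rw [pot]
  | succ a => rw [pot]; push_cast; ring

lemma pot_succ (X : ℕ → ℕ → ℝ) (a b : ℕ) : pot X (a + 1) (b + 1) =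
    min (pot X a (b + 1) + X a (b + 1)) (pot X (a + 1) b + X b (a + 1)) := by rw [pot]

lemma pot_comm (X : ℕ → ℕ → ℝ) (a b : ℕ) : pot X a b = pot X b a := by
  induction h : a + b using Nat.strong_induction_on generalizing a b with
  | _ m ih =>
    cases a with
    | zero => rw [pot_zero_left, pot_zero_right]
    | succ a =>
      cases b with
      | zero => rw [pot_zero_left, pot_zero_right]
      | succ b =>
        rw [pot_succ, pot_succ, min_comm, ih (a + (b + 1)) (by omega) a (b + 1) rfl,
          ih (a + 1 + b) (by omega) (a + 1) b rfl]

lemma IsStepCost.pot_succ_left_le (hX : IsStepCost X) (a b : ℕ) :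
    pot X (a + 1) b ≤ pot X a b + X a b := by
  cases b with
  | zero => rw [pot_zero_right, pot_zero_right, hX.zero_right a]; push_cast; linarith
  | succ b => rw [pot_succ]; exact min_le_left _ _

lemma IsStepCost.pot_succ_right_le (hX : IsStepCost X) (a b : ℕ) :
    pot X a (b + 1) ≤ pot X a b + X b a := by
  rw [pot_comm X a, pot_comm X a]
  exact hX.pot_succ_left_le b a

/-- Going from one box to a larger one. -/
lemma IsStepCost.pot_add_le (hX : IsStepCost X) (a b m k : ℕ) :
    pot X (a + m) (b + k) ≤ pot X a b + m * X a b + k * X b a := by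
  have h1 : pot X (a + m) b ≤ pot X a b + m * X a b := by
    induction m with
    | zero => simp
    | succ m ih =>
      have := hX.pot_succ_left_le (a + m) b
      have := hX.anti a b (a + m) b (by omega) le_rfl
      push_cast
      rw [← add_assoc a m 1]
      linarith
  induction k with
  | zero => simpa using h1
  | succ k ih =>
    have := hX.pot_succ_right_le (a + m) (b + k)
    have := hX.anti b a (b + k) (a + m) (by omega) (by omega)
    push_cast
    rw [← add_assoc b k 1]
    linarith

lemma IsStepCost.pot_le (hX : IsStepCost X) (a b : ℕ) : pot X a b ≤ (a + b : ℕ) * X 0 0 := by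
  have := hX.pot_add_le 0 0 a b
  rw [pot_zero_left] at this
  simp only [zero_add, Nat.cast_zero, zero_mul] at this
  push_cast
  linarith

lemma IsStepCost.pot_nonneg (hX : IsStepCost X) (a b : ℕ) : 0 ≤ pot X a b := by
  induction h : a + b using Nat.strong_induction_on generalizing a b with
  | _ m ih =>
    cases a with
    | zero => rw [pot_zero_left]; exact mul_nonneg (by positivity) (hX.nonneg _ _)
    | succ a =>
      cases b with
      | zero => rw [pot_zero_right]; exact mul_nonneg (by positivity) (hX.nonneg _ _)
      | succ b =>
        rw [pot_succ]
        exact le_min (add_nonneg (ih _ (by omega) a (b + 1) rfl) (hX.nonneg _ _))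
          (add_nonneg (ih _ (by omega) (a + 1) b rfl) (hX.nonneg _ _))

/-- Every path to `(a, b)` has `a` steps in the first direction. -/
lemma IsStepCost.le_pot (hX : IsStepCost X) (a b : ℕ) : a * X a b ≤ pot X a b := by
  induction h : a + b using Nat.strong_induction_on generalizing a b with
  | _ m ih =>
    cases a with
    | zero => simpa using hX.pot_nonneg 0 b
    | succ a =>
      cases b with
      | zero => rw [pot_zero_right, hX.zero_right]
      | succ b =>
        rw [pot_succ]
        have h1 := ih _ (by omega) a (b + 1) rfl
        have h2 := ih _ (by omega) (a + 1) b rfl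
        have h3 := hX.anti a (b + 1) (a + 1) (b + 1) (by omega) le_rfl
        have h4 := hX.anti (a + 1) b (a + 1) (b + 1) le_rfl (by omega)
        have h5 := hX.nonneg b (a + 1)
        push_cast at *
        refine le_min ?_ ?_
        · nlinarith [mul_le_mul_of_nonneg_left h3 (Nat.cast_nonneg (α := ℝ) a)]
        · nlinarith [mul_le_mul_of_nonneg_left h4 (Nat.cast_nonneg (α := ℝ) a)]

/-- The potential is subadditive, because a path translated away from the origin costs less. The box
of a union may be smaller than the sum of the two boxes, in which case the translated path is
clipped. -/
lemma IsStepCost.pot_min_le (hX : IsStepCost X) {a b a₁ b₁ : ℕ} (ha : a₁ ≤ a) (hb : b₁ ≤ b)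
    {x y : ℕ} (hx : x ≤ a) (hy : y ≤ b) :
    pot X (min (a₁ + x) a) (min (b₁ + y) b) ≤ pot X a₁ b₁ + pot X x y := by
  have step1 : ∀ A B x y, x ≤ min A a → y ≤ B →
      pot X (min (A + 1) a) B ≤ pot X (min A a) B + X x y := by
    intro A B x y h1 h2
    rcases le_or_gt a A with h | h
    · rw [min_eq_right h, min_eq_right (by omega)]
      linarith [hX.nonneg x y]
    · rw [min_eq_left h.le, min_eq_left (by omega)] at *
      linarith [hX.pot_succ_left_le A B, hX.anti x y A B h1 h2]
  have step2 : ∀ A B x y, x ≤ A → y ≤ min B b →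
      pot X A (min (B + 1) b) ≤ pot X A (min B b) + X y x := by
    intro A B x y h1 h2
    rcases le_or_gt b B with h | h
    · rw [min_eq_right h, min_eq_right (by omega)]
      linarith [hX.nonneg y x]
    · rw [min_eq_left h.le, min_eq_left (by omega)] at *
      linarith [hX.pot_succ_right_le A B, hX.anti y x B A h2 h1]
  induction h : x + y using Nat.strong_induction_on generalizing x y with
  | _ m ih =>
    cases x with
    | zero =>
      cases y with
      | zero =>
        rw [pot_zero_left X 0]
        simp [ha, hb]
      | succ y =>
        have := ih _ (by omega) (x := 0) (y := y) hx (by omega) rfl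
        have := step2 (min (a₁ + 0) a) (b₁ + y) 0 y (by omega) (by omega)
        rw [hX.zero_right] at this
        rw [pot_zero_left] at *
        rw [← add_assoc b₁]
        push_cast
        linarith
    | succ x =>
      cases y with
      | zero =>
        have := ih _ (by omega) (x := x) (y := 0) (by omega) hy rfl
        have := step1 (a₁ + x) (min (b₁ + 0) b) x 0 (by omega) (by omega)
        rw [hX.zero_right] at this
        rw [pot_zero_right] at *
        rw [← add_assoc a₁]
        push_cast
        linarith
      | succ y =>
        rw [pot_succ, ← min_add_add_left]
        refine le_min ?_ ?_
        · have := ih _ (by omega) (x := x) (y := y + 1) (by omega) hy rfl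
          have := step1 (a₁ + x) (min (b₁ + (y + 1)) b) x (y + 1) (by omega) (by omega)
          rw [← add_assoc a₁]
          linarith
        · have := ih _ (by omega) (x := x + 1) (y := y) hx (by omega) rfl
          have := step2 (min (a₁ + (x + 1)) a) (b₁ + y) (x + 1) y (by omega) (by omega)
          rw [← add_assoc b₁]
          linarith

lemma IsStepCost.pot_subadd (hX : IsStepCost X) {a b a₁ b₁ a₂ b₂ : ℕ} (h1 : a₁ ≤ a) (h2 : b₁ ≤ b)
    (h3 : a₂ ≤ a) (h4 : b₂ ≤ b) (h5 : a ≤ a₁ + a₂) (h6 : b ≤ b₁ + b₂) :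
    pot X a b ≤ pot X a₁ b₁ + pot X a₂ b₂ := by
  simpa [h5, h6] using hX.pot_min_le h1 h2 h3 h4

/-- The optimal path first goes along the diagonal, then straight. -/
lemma IsStepCost.diag_le_pot (hX : IsStepCost X) {a b : ℕ} (hab : b ≤ a) :
    (∑ k ∈ Finset.range b, (X k k + X k (k + 1))) + ∑ k ∈ Finset.Ico b a, X k b ≤ pot X a b := by
  induction h : a + b using Nat.strong_induction_on generalizing a b with
  | _ m ih =>
    cases b with
    | zero =>
      rw [pot_zero_right]
      simp [hX.zero_right]
    | succ b =>
      obtain ⟨a, rfl⟩ : ∃ a', a = a' + 1 := ⟨a - 1, by omega⟩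
      rw [pot_succ]
      rcases Nat.eq_or_lt_of_le hab with hab' | hab'
      · obtain rfl : b = a := by omega
        rw [pot_comm X b (b + 1), min_self]
        have := ih _ (by omega) (a := b + 1) (b := b) (by omega) rfl
        rw [Nat.Ico_succ_singleton, Finset.sum_singleton] at this
        rw [Finset.sum_range_succ, Finset.Ico_self, Finset.sum_empty]
        linarith
      · refine le_min ?_ ?_
        · have := ih _ (by omega) (a := a) (b := b + 1) (by omega) rfl
          rw [Finset.sum_Ico_succ_top (by omega)]
          linarith
        · have := ih _ (by omega) (a := a + 1) (b := b) (by omega) rfl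
          rw [Finset.sum_eq_sum_Ico_succ_bot (by omega)] at this
          rw [Finset.sum_range_succ]
          have h1 : ∑ k ∈ Finset.Ico (b + 1) (a + 1), (X k (b + 1) - X k b) ≤
              ∑ k ∈ Finset.Ico (b + 1) (a + 1), (X b (k + 1) - X b k) := by
            refine Finset.sum_le_sum fun k hk => ?_
            have := hX.exchange b k (by have := Finset.mem_Ico.1 hk; omega)
            linarith
          rw [Finset.sum_Ico_sub (fun k => X b k) (by omega), Finset.sum_sub_distrib] at h1
          linarith

/-- The step costs of the growth of a rectangle: adding a line of length `b` to a rectangle with sides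
`a` and `b`. The parameter `u₀` keeps the cost bounded. -/
def stepCost (σ : ℕ) (c u₀ : ℝ) (a b : ℕ) : ℝ := hcost (c * (b ^ (σ + 1) * a ^ σ) + u₀)

lemma pow_succ_increment_le (σ : ℕ) {b k : ℝ} (hb : 0 ≤ b) (hbk : b ≤ k) :
    b ^ σ * ((k + 1) ^ (σ + 1) - k ^ (σ + 1)) ≤ k ^ σ * ((b + 1) ^ (σ + 1) - b ^ (σ + 1)) := by
  have hk : 0 ≤ k := hb.trans hbk
  have h : ∀ x : ℝ, (x + 1) ^ (σ + 1) - x ^ (σ + 1) =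
      ∑ j ∈ Finset.range (σ + 1), x ^ j * ((σ + 1).choose j : ℝ) := by
    intro x
    rw [add_pow, Finset.sum_range_succ]
    simp
  rw [h, h, Finset.mul_sum, Finset.mul_sum]
  refine Finset.sum_le_sum fun j hj => ?_
  obtain ⟨i, rfl⟩ : ∃ i, σ = j + i := ⟨σ - j, by have := Finset.mem_range.1 hj; omega⟩
  rw [← mul_assoc, ← mul_assoc]
  refine mul_le_mul_of_nonneg_right ?_ (by positivity)
  rw [pow_add, pow_add]
  have := pow_le_pow_left₀ hb hbk i
  nlinarith [mul_le_mul_of_nonneg_left this (show 0 ≤ b ^ j * k ^ j by positivity)]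

lemma isStepCost_stepCost {σ : ℕ} {c u₀ : ℝ} (hc : 0 ≤ c) (hu : 0 < u₀) :
    IsStepCost (stepCost σ c u₀) where
  nonneg a b := (hcost_pos (by positivity)).le
  anti a b a' b' ha hb := hcost_anti (by positivity) (by gcongr)
  zero_right a := by simp [stepCost]
  exchange b k hbk := by
    have hbk' : (b : ℝ) ≤ k := by exact_mod_cast hbk
    unfold stepCost
    push_cast
    set t := c * ((b + 1 : ℝ) ^ (σ + 1) * k ^ σ) - c * ((b : ℝ) ^ (σ + 1) * k ^ σ) with ht
    have ht0 : 0 ≤ t := by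
      rw [ht, sub_nonneg]
      gcongr
      linarith
    have h1 : c * ((k + 1 : ℝ) ^ (σ + 1) * b ^ σ) + u₀ ≤ c * ((k : ℝ) ^ (σ + 1) * b ^ σ) + u₀ + t := by
      have := mul_le_mul_of_nonneg_left (pow_succ_increment_le σ (Nat.cast_nonneg b) hbk') hc
      rw [ht]
      linarith
    have h2 : c * ((b : ℝ) ^ (σ + 1) * k ^ σ) + u₀ ≤ c * ((k : ℝ) ^ (σ + 1) * b ^ σ) + u₀ := by
      have : (b : ℝ) ^ (σ + 1) * k ^ σ ≤ (k : ℝ) ^ (σ + 1) * b ^ σ := by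
        rw [pow_succ, pow_succ]
        nlinarith [mul_le_mul_of_nonneg_left hbk' (show 0 ≤ (b : ℝ) ^ σ * k ^ σ by positivity)]
      have := mul_le_mul_of_nonneg_left this hc
      linarith
    have h3 := hcost_exchange (x := c * ((b : ℝ) ^ (σ + 1) * k ^ σ) + u₀) (by positivity) h2 ht0
    have h4 := hcost_anti (show 0 < c * ((k + 1 : ℝ) ^ (σ + 1) * b ^ σ) + u₀ by positivity) h1
    have h5 : c * ((b : ℝ) ^ (σ + 1) * k ^ σ) + u₀ + t = c * ((b + 1 : ℝ) ^ (σ + 1) * k ^ σ) + u₀ := by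
      rw [ht]; ring
    rw [h5] at h3
    linarith

end Potential

/-! ### Probability that a box is spanned by an internally solved set -/

section Spanning

lemma card_strip_le (l u : ℤ × ℤ) (o : Bool) (j₁ j₂ : ℤ) :
    ((Finset.Icc l u).filter fun v => j₁ ≤ co o v ∧ co o v ≤ j₂).card ≤
      (j₂ + 1 - j₁).toNat * side (!o) l u := by
  cases o
  · have h : ((Finset.Icc l u).filter fun v => j₁ ≤ co false v ∧ co false v ≤ j₂) ⊆
        Finset.Icc l.1 u.1 ×ˢ Finset.Icc j₁ j₂ := by
      intro v hv
      obtain ⟨hv, hvj⟩ := Finset.mem_filter.1 hv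
      simp only [Finset.mem_Icc, Prod.le_def, Finset.mem_product] at hv ⊢
      exact ⟨⟨hv.1.1, hv.2.1⟩, hvj⟩
    refine (Finset.card_le_card h).trans ?_
    rw [Finset.card_product, Int.card_Icc, Int.card_Icc, mul_comm]
    simp only [Bool.not_false, side, co_true]
    refine Nat.mul_le_mul le_rfl (by omega)
  · have h : ((Finset.Icc l u).filter fun v => j₁ ≤ co true v ∧ co true v ≤ j₂) ⊆
        Finset.Icc j₁ j₂ ×ˢ Finset.Icc l.2 u.2 := by
      intro v hv
      obtain ⟨hv, hvj⟩ := Finset.mem_filter.1 hv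
      simp only [Finset.mem_Icc, Prod.le_def, Finset.mem_product] at hv ⊢
      exact ⟨hvj, hv.1.2, hv.2.2⟩
    refine (Finset.card_le_card h).trans ?_
    rw [Finset.card_product, Int.card_Icc, Int.card_Icc]
    simp only [Bool.not_true, side, co_false]
    refine Nat.mul_le_mul le_rfl (by omega)

lemma co_mem_Icc {l u v : ℤ × ℤ} (hv : v ∈ Finset.Icc l u) (o : Bool) :
    co o l ≤ co o v ∧ co o v ≤ co o u := by
  rw [Finset.mem_Icc, Prod.le_def, Prod.le_def] at hv
  cases o
  · exact ⟨hv.1.2, hv.2.2⟩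
  · exact ⟨hv.1.1, hv.2.1⟩

variable {σ : ℕ} {p : ℝ} {E : Finset (Sym2 (ℤ × ℤ))}

open Classical in
/-- Some vertex on a line has many neighbors in a set of size at most `m` that is disjoint from the
line. -/
lemma bprob_line_le (h0 : 0 ≤ p) (h1 : p ≤ 1) {V A : Finset (ℤ × ℤ)} (hd : Disjoint V A) {b m : ℕ}
    (hV : V.card ≤ b) (hA : A.card ≤ m) (hm : (m * p) ^ σ / (σ.factorial : ℝ) ≤ 1) :
    bprob E p (fun S => ∃ v ∈ V, σ ≤ (A.filter fun w => s(v, w) ∈ S).card) ≤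
      1 - (1 - (m * p) ^ σ / (σ.factorial : ℝ)) ^ b := by
  have := bprob_exists_star (E := E) p hd σ
  have h2 : ∀ v ∈ V, 1 - (m * p) ^ σ / (σ.factorial : ℝ) ≤
      1 - bprob E p (fun S => σ ≤ (S ∩ star v A).card) := fun v _ => by
    have := bprob_star_le (E := E) h0 h1 v hA σ
    linarith
  have h3 : 0 ≤ 1 - (m * p) ^ σ / (σ.factorial : ℝ) := by linarith
  have h4 := Finset.prod_le_prod (fun _ _ => h3) h2
  rw [Finset.prod_const] at h4
  have h5 : (1 - (m * p) ^ σ / (σ.factorial : ℝ)) ^ b ≤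
      (1 - (m * p) ^ σ / (σ.factorial : ℝ)) ^ V.card :=
    pow_le_pow_of_le_one h3 (sub_le_self _ (by positivity)) hV
  convert (this.le.trans (sub_le_sub_left (h5.trans h4) 1)) using 1

open Classical in
lemma bprob_line_le_mul (h0 : 0 ≤ p) (h1 : p ≤ 1) {V A : Finset (ℤ × ℤ)} {b m : ℕ}
    (hV : V.card ≤ b) (hA : A.card ≤ m) :
    bprob E p (fun S => ∃ v ∈ V, σ ≤ (A.filter fun w => s(v, w) ∈ S).card) ≤
      b * ((m * p) ^ σ / (σ.factorial : ℝ)) := by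
  refine (bprob_exists_le h0 h1 V _).trans ?_
  refine le_trans (Finset.sum_le_sum (g := fun _ => (m * p) ^ σ / (σ.factorial : ℝ))
    fun v _ => ?_) ?_
  · refine le_trans (le_of_eq ?_) (bprob_star_le (E := E) h0 h1 v hA σ)
    refine bprob_congr fun S _ => ?_
    rw [card_inter_star]
  · rw [Finset.sum_const, nsmul_eq_mul]
    exact mul_le_mul_of_nonneg_right (by exact_mod_cast hV) (by positivity)

lemma bprob_edge_le (h0 : 0 ≤ p) (e : Sym2 (ℤ × ℤ)) :
    bprob E p (fun S => e ∈ S) ≤ p := by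
  by_cases he : e ∈ E
  · have := bprob_subset (E := E) p (T := {e}) (by simpa using he)
    simp only [Finset.singleton_subset_iff, Finset.card_singleton, pow_one] at this
    exact this.le
  · refine le_trans (le_of_eq ?_) h0
    rw [← bprob_false E p]
    exact bprob_congr fun S hS => ⟨fun h => he (hS h), False.elim⟩

open Classical in
/-- The probability that a boundary of a box can be crossed. The number of vertices on one side of the
boundary is at most `M`, and at most `m` on the other side. -/
lemma bprob_crossWit_le (h0 : 0 ≤ p) (h1 : p ≤ 1) (l u : ℤ × ℤ) (o : Bool) (i : ℤ) {M m : ℕ}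
    (hM : (M * p) ^ σ / (σ.factorial : ℝ) ≤ 1)
    (hside : (((Finset.Icc l u).filter fun v => co o v ≤ i).card ≤ M ∧
        ((Finset.Icc l u).filter fun v => i + 1 ≤ co o v).card ≤ m) ∨
      (((Finset.Icc l u).filter fun v => co o v ≤ i).card ≤ m ∧
        ((Finset.Icc l u).filter fun v => i + 1 ≤ co o v).card ≤ M)) :
    bprob E p (CrossWit σ (o, i) (Finset.Icc l u)) ≤
      1 - (1 - (M * p) ^ σ / (σ.factorial : ℝ)) ^ side (!o) l u +
      side (!o) l u * ((m * p) ^ σ / (σ.factorial : ℝ)) + side (!o) l u * p := by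
  set B := Finset.Icc l u
  set b := side (!o) l u
  have hcol : ∀ j, (B.filter fun v => co o v = j).card ≤ b := by
    intro j
    refine le_trans (Finset.card_le_card ?_) ((card_strip_le l u o j j).trans ?_)
    · intro v hv
      simp only [Finset.mem_filter] at *
      exact ⟨hv.1, hv.2.ge, hv.2.le⟩
    · have : (j + 1 - j).toNat = 1 := by omega
      rw [this, one_mul]
  have hdl : Disjoint (B.filter fun v => co o v = i + 1) (B.filter fun v => co o v ≤ i) := by
    rw [Finset.disjoint_left]
    intro v h h'
    have := (Finset.mem_filter.1 h).2; have := (Finset.mem_filter.1 h').2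
    omega
  have hdr : Disjoint (B.filter fun v => co o v = i) (B.filter fun v => i + 1 ≤ co o v) := by
    rw [Finset.disjoint_left]
    intro v h h'
    have := (Finset.mem_filter.1 h).2; have := (Finset.mem_filter.1 h').2
    omega
  -- the neighbor across the boundary
  set f : ℤ × ℤ → ℤ × ℤ := fun v => cond o (v.1 + 1, v.2) (v.1, v.2 + 1) with hf
  have hstep : ∀ S ⊆ E, CrossWit σ (o, i) B S →
      ((∃ v ∈ B.filter fun v => co o v = i,
        σ ≤ ((B.filter fun v => i + 1 ≤ co o v).filter fun w => s(v, w) ∈ S).card) ∨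
      (∃ v ∈ B.filter fun v => co o v = i + 1,
        σ ≤ ((B.filter fun v => co o v ≤ i).filter fun w => s(v, w) ∈ S).card)) ∨
      ∃ v ∈ B.filter fun v => co o v = i, s(v, f v) ∈ S := by
    rintro S - (⟨v, hv, hvi, hc⟩ | ⟨v, hv, hvi, hc⟩ | ⟨v, hv, w, hw, hvi, hwi, ha, hs⟩)
    · refine Or.inl (Or.inl ⟨v, Finset.mem_filter.2 ⟨hv, hvi⟩, ?_⟩)
      rwa [Finset.filter_filter]
    · refine Or.inl (Or.inr ⟨v, Finset.mem_filter.2 ⟨hv, hvi⟩, ?_⟩)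
      rwa [Finset.filter_filter]
    · refine Or.inr ⟨v, Finset.mem_filter.2 ⟨hv, hvi⟩, ?_⟩
      have : f v = w := by
        unfold GAdj at ha
        simp only at hvi hwi
        cases o <;> simp only [hf, co_true, co_false, cond_true, cond_false] at * <;> ext <;>
          simp only <;> omega
      rwa [this]
  refine (bprob_mono h0 h1 hstep).trans ((bprob_or_le h0 h1 _ _).trans (add_le_add
    ((bprob_or_le h0 h1 _ _).trans ?_) ?_))
  · rcases hside with ⟨hl, hr⟩ | ⟨hl, hr⟩
    · rw [add_comm]
      exact add_le_add (bprob_line_le h0 h1 hdl (hcol _) hl hM)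
        (bprob_line_le_mul h0 h1 (hcol _) hr)
    · exact add_le_add (bprob_line_le h0 h1 hdr (hcol _) hr hM)
        (bprob_line_le_mul h0 h1 (hcol _) hl)
  · refine (bprob_exists_le h0 h1 _ _).trans ((Finset.sum_le_sum (g := fun _ => p)
      fun v _ => bprob_edge_le h0 _).trans ?_)
    rw [Finset.sum_const, nsmul_eq_mul]
    exact mul_le_mul_of_nonneg_right (by exact_mod_cast hcol i) h0

/-- The event that some internally solved set has the bounding box with corners `l` and `u`. -/
def SpEvent (σ : ℕ) (l u : ℤ × ℤ) (S : Finset (Sym2 (ℤ × ℤ))) : Prop :=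
  ∃ W, IS (edgeRel S) σ W ∧ Spans l u W

lemma monotone_spEvent (σ : ℕ) (l u : ℤ × ℤ) : Monotone (SpEvent σ l u) := by
  rintro S S' hS ⟨W, hW, hs⟩
  exact ⟨W, hW.congr fun _ _ _ _ h => hS h, hs⟩

lemma monotone_crossWit (σ : ℕ) (b : Bool × ℤ) (W : Finset (ℤ × ℤ)) :
    Monotone (CrossWit σ b W) := fun _ _ hS h => h.mono le_rfl hS

lemma IS.restrict {S : Finset (Sym2 (ℤ × ℤ))} {W : Finset (ℤ × ℤ)} (h : IS (edgeRel S) σ W) :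
    IS (edgeRel (S ∩ W.sym2)) σ W :=
  h.congr fun _ hu _ hw h => Finset.mem_inter.2 ⟨h, Finset.mk_mem_sym2_iff.2 ⟨hu, hw⟩⟩

/-- The boundaries that cross the box with corners `l` and `u`, but not the one with corners `l₁` and
`u₁`. -/
def newLines (l u l₁ u₁ : ℤ × ℤ) : Finset (Σ _ : Bool, ℤ) :=
  Finset.univ.sigma fun o => Finset.Ico (co o l) (co o u) \ Finset.Ico (co o l₁) (co o u₁)

lemma IS.disjFam {S : Finset (Sym2 (ℤ × ℤ))} {W : Finset (ℤ × ℤ)} {l u : ℤ × ℤ}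
    (h : IS (edgeRel S) σ W) (hs : Spans l u W) :
    DisjFam (newLines l u l l) (fun i => CrossWit σ (i.1, i.2) (Finset.Icc l u)) S := by
  obtain ⟨T, hd, hT⟩ := h.exists_disjoint_witnesses
  refine ⟨fun i => T (i.1, i.2), fun i _ j _ hij => hd _ _ fun h => hij ?_, fun i hi => ?_⟩
  · obtain ⟨a, b⟩ := i
    obtain ⟨a', b'⟩ := j
    simp only [Prod.mk.injEq] at h
    obtain ⟨rfl, rfl⟩ := h
    rfl
  · refine ⟨(hT _).1.1, ((hT _).2 ?_).mono hs.mem_Icc le_rfl⟩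
    simp only [newLines, Finset.Ico_self, Finset.sdiff_empty, Finset.mem_sigma, Finset.mem_univ,
      true_and, Finset.mem_Ico] at hi
    obtain ⟨⟨v, hv, hvl⟩, w, hw, hwu⟩ := hs.2 i.1
    exact ⟨⟨v, hv, by simp only; omega⟩, w, hw, by simp only; omega⟩

/-- The growth from the bounding box of `W'` to the one of `W` uses people edges that are not inside
the former. -/
lemma IS.disjOcc_of_subset {S : Finset (Sym2 (ℤ × ℤ))} {W W' : Finset (ℤ × ℤ)} {l u l₁ u₁ : ℤ × ℤ}
    (h : IS (edgeRel S) σ W) (hs : Spans l u W) (h' : IS (edgeRel S) σ W') (hs' : Spans l₁ u₁ W') :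
    DisjOcc (SpEvent σ l₁ u₁)
      (DisjFam (newLines l u l₁ u₁) (fun i => CrossWit σ (i.1, i.2) (Finset.Icc l u))) S := by
  classical
  obtain ⟨T, hd, hT⟩ := h.exists_disjoint_witnesses
  refine ⟨S ∩ W'.sym2, (newLines l u l₁ u₁).biUnion fun i => T (i.1, i.2), ?_,
    Finset.inter_subset_left, Finset.biUnion_subset.2 fun i _ => (hT _).1.1, ⟨W', h'.restrict, hs'⟩,
    fun i => T (i.1, i.2), fun i _ j _ hij => hd _ _ fun h => hij ?_,
    fun i hi => ⟨Finset.subset_biUnion_of_mem (fun i : (_ : Bool) × ℤ => T (i.1, i.2)) hi,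
      ((hT _).2 ?_).mono hs.mem_Icc le_rfl⟩⟩
  · rw [Finset.disjoint_biUnion_right]
    intro i hi
    rw [Finset.disjoint_right]
    intro e he he'
    obtain ⟨x, y, rfl, hx, hy⟩ := (hT _).1.2.2 e he
    obtain ⟨hx', hy'⟩ := Finset.mk_mem_sym2_iff.1 (Finset.mem_inter.1 he').2
    have h1 := hs'.1 x hx' i.1
    have h2 := hs'.1 y hy' i.1
    simp only [newLines, Finset.mem_sigma, Finset.mem_univ, true_and, Finset.mem_sdiff,
      Finset.mem_Ico] at hi
    simp only at hx hy
    omega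
  · obtain ⟨a, b⟩ := i
    obtain ⟨a', b'⟩ := j
    simp only [Prod.mk.injEq] at h
    obtain ⟨rfl, rfl⟩ := h
    rfl
  · simp only [newLines, Finset.mem_sigma, Finset.mem_univ, true_and, Finset.mem_sdiff,
      Finset.mem_Ico] at hi
    obtain ⟨⟨v, hv, hvl⟩, w, hw, hwu⟩ := hs.2 i.1
    exact ⟨⟨v, hv, by simp only; omega⟩, w, hw, by simp only; omega⟩

/-- The bound for the probability that all the new lines are crossed, when a line in the direction `o`
costs `r o`. -/
lemma bprob_newLines_le (h0 : 0 ≤ p) (h1 : p ≤ 1) {l u l₁ u₁ : ℤ × ℤ} (r : Bool → ℝ)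
    (hbox : ∀ o, co o l ≤ co o l₁ ∧ co o l₁ ≤ co o u₁ ∧ co o u₁ ≤ co o u)
    (hr : ∀ o, ∀ i ∈ Finset.Ico (co o l) (co o u) \ Finset.Ico (co o l₁) (co o u₁),
      bprob E p (CrossWit σ (o, i) (Finset.Icc l u)) ≤ Real.exp (-r o)) :
    bprob E p (DisjFam (newLines l u l₁ u₁) fun i => CrossWit σ (i.1, i.2) (Finset.Icc l u)) ≤
      Real.exp (-(((side true l u : ℝ) - side true l₁ u₁) * r true +
        ((side false l u : ℝ) - side false l₁ u₁) * r false)) := by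
  refine (bprob_disjFam_le h0 h1 _ _ fun i => monotone_crossWit _ _ _).trans ?_
  have hcard : ∀ o, ((Finset.Ico (co o l) (co o u) \ Finset.Ico (co o l₁) (co o u₁)).card : ℝ) =
      (side o l u : ℝ) - side o l₁ u₁ := by
    intro o
    obtain ⟨a, b, c⟩ := hbox o
    have h2 : Finset.Ico (co o l₁) (co o u₁) ⊆ Finset.Ico (co o l) (co o u) :=
      Finset.Ico_subset_Ico a c
    have h3 := Finset.card_sdiff_add_card_eq_card h2
    rw [Int.card_Ico, Int.card_Ico] at h3
    rw [eq_sub_iff_add_eq]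
    unfold side
    norm_cast
    omega
  have hprod : ∀ o, ∏ i ∈ Finset.Ico (co o l) (co o u) \ Finset.Ico (co o l₁) (co o u₁),
      bprob E p (CrossWit σ (o, i) (Finset.Icc l u)) ≤
        Real.exp (-(((side o l u : ℝ) - side o l₁ u₁) * r o)) := by
    intro o
    refine (Finset.prod_le_prod (fun i _ => bprob_nonneg h0 h1 _) (hr o)).trans ?_
    rw [Finset.prod_const, ← Real.exp_nat_mul, hcard]
    exact le_of_eq (by ring_nf)
  rw [newLines, Finset.prod_sigma, Fintype.prod_bool, neg_add, Real.exp_add]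
  exact mul_le_mul (hprod true) (hprod false)
    (Finset.prod_nonneg fun i _ => bprob_nonneg h0 h1 _) (Real.exp_pos _).le

/-- The potential of a box. -/
def boxPot (X : ℕ → ℕ → ℝ) (l u : ℤ × ℤ) : ℝ := pot X (side true l u) (side false l u)

/-- The main estimate: a box of moderate size is spanned with probability at most the exponential of
minus its potential. By induction on the size of the box: the constant `2 * d * X 0 0` that is gained
on small boxes, where the cost per line is larger than `X 0 0`, pays for the merging of two large
boxes. -/
lemma bprob_spEvent_le {X : ℕ → ℕ → ℝ} (hX : IsStepCost X) (h0 : 0 ≤ p) (h1 : p ≤ 1) {K d : ℕ}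
    {s₀ : ℝ} (hs₀ : 0 ≤ s₀) (hd : 3 ≤ d)
    (hcross : ∀ l u l₁ u₁ : ℤ × ℤ, (∀ o, side o l u ≤ K) →
      (∀ o, co o l ≤ co o l₁ ∧ co o l₁ ≤ co o u₁ ∧ co o u₁ ≤ co o u) →
      hper l u ≤ hper l₁ u₁ + 2 * d → ∀ o,
      ∀ i ∈ Finset.Ico (co o l) (co o u) \ Finset.Ico (co o l₁) (co o u₁),
      bprob E p (CrossWit σ (o, i) (Finset.Icc l u)) ≤
        Real.exp (-(X (side o l₁ u₁) (side (!o) l₁ u₁) + s₀)))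
    (hseed : ∀ l u : ℤ × ℤ, hper l u ≤ 8 * d → ∀ o, ∀ i ∈ Finset.Ico (co o l) (co o u),
      bprob E p (CrossWit σ (o, i) (Finset.Icc l u)) ≤ Real.exp (-(3 * X 0 0)))
    (hcount : ((K * K : ℕ) : ℝ) ^ 2 * Real.exp (-(s₀ * d)) +
      ((K * K : ℕ) : ℝ) ^ 4 * Real.exp (-(X 0 0 * (d - 6))) ≤ 1)
    (l u : ℤ × ℤ) (hlu : ∀ o, co o l ≤ co o u) (hK : ∀ o, side o l u ≤ K)
    (hper_ge : 2 * d ≤ hper l u) :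
    bprob E p (SpEvent σ l u) ≤ Real.exp (-(boxPot X l u + 2 * d * X 0 0)) := by
  classical
  set H := X 0 0 with hH
  have hH0 : 0 ≤ H := hX.nonneg 0 0
  have hdR : (3 : ℝ) ≤ d := by exact_mod_cast hd
  have hpotle : ∀ l u : ℤ × ℤ, boxPot X l u ≤ hper l u * H := fun l u => hX.pot_le _ _
  -- small boxes
  have small : ∀ l u : ℤ × ℤ, (∀ o, co o l ≤ co o u) → hper l u ≤ 8 * d →
      bprob E p (SpEvent σ l u) ≤ Real.exp (-(3 * H * (hper l u - 2))) := by
    intro l u hlu h8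
    refine le_trans (bprob_mono h0 h1 fun S _ ⟨W, hW, hs⟩ => hW.disjFam hs) ?_
    refine (bprob_newLines_le h0 h1 (fun _ => 3 * H) (fun o => ⟨le_rfl, le_rfl, hlu o⟩) ?_).trans ?_
    · intro o i hi
      exact hseed l u h8 o i (Finset.sdiff_subset hi)
    · have : ∀ o, side o l l = 1 := fun o => by unfold side; omega
      rw [this, this]
      refine Real.exp_le_exp.2 (le_of_eq ?_)
      unfold hper
      push_cast
      ring
  induction hn : hper l u using Nat.strong_induction_on generalizing l u with
  | _ m ih =>
  subst hn
  by_cases h8 : hper l u ≤ 8 * d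
  · refine (small l u hlu h8).trans (Real.exp_le_exp.2 ?_)
    have := hpotle l u
    have h2 : (2 * d : ℝ) ≤ hper l u := by exact_mod_cast hper_ge
    nlinarith [mul_le_mul_of_nonneg_left h2 hH0, mul_le_mul_of_nonneg_left hdR hH0]
  push Not at h8
  -- the boxes inside the given one
  set B := Finset.Icc l u with hB
  have hBcard : B.card ≤ K * K := by
    have hc := card_strip_le l u true l.1 u.1
    have : B.filter (fun v => l.1 ≤ co true v ∧ co true v ≤ u.1) = B :=
      Finset.filter_true_of_mem fun v hv => co_mem_Icc hv true
    rw [← hB, this] at hc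
    refine hc.trans (Nat.mul_le_mul ?_ (hK _))
    have := hK true
    simp only [side, co_true] at this
    omega
  have hsub : ∀ {l₁ u₁ : ℤ × ℤ}, (∀ o, co o l ≤ co o l₁ ∧ co o l₁ ≤ co o u₁ ∧ co o u₁ ≤ co o u) →
      l₁ ∈ B ∧ u₁ ∈ B := by
    intro l₁ u₁ h
    have ht := h true; have hf := h false
    simp only [co_true, co_false] at ht hf
    simp only [hB, Finset.mem_Icc, Prod.le_def]
    omega
  have hsideK : ∀ {l₁ u₁ : ℤ × ℤ}, (∀ o, co o l ≤ co o l₁ ∧ co o l₁ ≤ co o u₁ ∧ co o u₁ ≤ co o u) →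
      ∀ o, side o l₁ u₁ ≤ side o l u := by
    intro l₁ u₁ h o
    have := h o
    unfold side
    omega
  set Φ := boxPot X l u + 2 * d * H with hΦ
  -- the two alternatives in the descent: `QN` is the growth of one smaller solved box by at least `d`
  -- lines, `QS` the merging of two solved boxes
  set QN : (ℤ × ℤ) × (ℤ × ℤ) → Finset (Sym2 (ℤ × ℤ)) → Prop := fun z S =>
    ((∀ o, co o l ≤ co o z.1 ∧ co o z.1 ≤ co o z.2 ∧ co o z.2 ≤ co o u) ∧
      hper z.1 z.2 + d ≤ hper l u ∧ hper l u ≤ hper z.1 z.2 + 2 * d) ∧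
    DisjOcc (SpEvent σ z.1 z.2)
      (DisjFam (newLines l u z.1 z.2) (fun i => CrossWit σ (i.1, i.2) (Finset.Icc l u))) S with hQN
  set QS : ((ℤ × ℤ) × (ℤ × ℤ)) × ((ℤ × ℤ) × (ℤ × ℤ)) → Finset (Sym2 (ℤ × ℤ)) → Prop := fun z S =>
    ((∀ o, co o l ≤ co o z.1.1 ∧ co o z.1.1 ≤ co o z.1.2 ∧ co o z.1.2 ≤ co o u) ∧
      (∀ o, co o l ≤ co o z.2.1 ∧ co o z.2.1 ≤ co o z.2.2 ∧ co o z.2.2 ≤ co o u) ∧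
      d ≤ hper z.1.1 z.1.2 ∧ d ≤ hper z.2.1 z.2.2 ∧ hper z.1.1 z.1.2 + d ≤ hper l u ∧
      hper z.2.1 z.2.2 + d ≤ hper l u ∧ ∃ l₃ u₃, hper l u < hper l₃ u₃ + d ∧
        (∀ o, side o l₃ u₃ ≤ side o l u) ∧ ∀ o, side o z.1.1 z.1.2 ≤ side o l₃ u₃ ∧
        side o z.2.1 z.2.2 ≤ side o l₃ u₃ ∧
        side o l₃ u₃ ≤ side o z.1.1 z.1.2 + side o z.2.1 z.2.2) ∧
    DisjOcc (SpEvent σ z.1.1 z.1.2) (SpEvent σ z.2.1 z.2.2) S with hQS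
  have hcover : ∀ S ⊆ E, SpEvent σ l u S →
      (∃ z ∈ B ×ˢ B, QN z S) ∨ ∃ z ∈ (B ×ˢ B) ×ˢ (B ×ˢ B), QS z S := by
    rintro S - ⟨W, hW, hs⟩
    rcases hW.descent (l := l) (u := u) (d := d) (by omega) le_rfl hs (by omega) with
      ⟨W', l₁, u₁, hW', hsubW, hs', hh, hh'⟩ |
      ⟨A, C, l₁, u₁, l₂, u₂, l₃, u₃, hA, hC, hdis, hAW, hCW, hsA, hsC, hs₃, g1, g2, g3, g4, g5, g6⟩
    · have hb := hs.le_of_subset hs' hsubW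
      exact Or.inl ⟨(l₁, u₁), Finset.mem_product.2 (hsub hb), ⟨hb, hh, hh'⟩,
        hW.disjOcc_of_subset hs hW' hs'⟩
    · have hb1 := hs.le_of_subset hsA hAW
      have hb2 := hs.le_of_subset hsC hCW
      have hb3 := hs.le_of_subset hs₃ (Finset.union_subset hAW hCW)
      refine Or.inr ⟨((l₁, u₁), (l₂, u₂)), Finset.mem_product.2
        ⟨Finset.mem_product.2 (hsub hb1), Finset.mem_product.2 (hsub hb2)⟩,
        ⟨hb1, hb2, g1, g2, g3, g4, l₃, u₃, g5, hsideK hb3, g6⟩, S ∩ A.sym2, S ∩ C.sym2, ?_,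
        Finset.inter_subset_left, Finset.inter_subset_left, ⟨A, hA.restrict, hsA⟩,
        ⟨C, hC.restrict, hsC⟩⟩
      rw [Finset.disjoint_left]
      intro e he he'
      replace he := (Finset.mem_inter.1 he).2
      replace he' := (Finset.mem_inter.1 he').2
      induction e with
      | _ x y =>
        rw [Finset.mk_mem_sym2_iff] at he he'
        exact Finset.disjoint_left.1 hdis he.1 he'.1
  -- the new lines pay for the increase of the potential, and the surplus `s₀` on each of the at least
  -- `d` lines pays for the choice of the smaller box
  have hN : ∀ z ∈ B ×ˢ B, bprob E p (QN z) ≤ Real.exp (-Φ) * Real.exp (-(s₀ * d)) := by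
    rintro ⟨l₁, u₁⟩ -
    by_cases hz : (∀ o, co o l ≤ co o l₁ ∧ co o l₁ ≤ co o u₁ ∧ co o u₁ ≤ co o u) ∧
      hper l₁ u₁ + d ≤ hper l u ∧ hper l u ≤ hper l₁ u₁ + 2 * d
    swap
    · rw [bprob_congr (Q' := fun _ => False) fun S _ => ⟨fun h => hz h.1, False.elim⟩, bprob_false]
      positivity
    obtain ⟨hb, hh, hh'⟩ := hz
    have e1 := ih _ (by omega) l₁ u₁ (fun o => (hb o).2.1) (fun o => (hsideK hb o).trans (hK o))
      (by omega) rfl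
    have e2 := bprob_newLines_le (E := E) h0 h1
      (fun o => X (side o l₁ u₁) (side (!o) l₁ u₁) + s₀) hb (hcross l u l₁ u₁ hK hb hh')
    refine (bprob_mono h0 h1 fun S _ h => h.2).trans ((bprob_disjOcc_le h0 h1
      (monotone_spEvent _ _ _) (monotone_disjFam _ _)).trans ((mul_le_mul e1 e2
      (bprob_nonneg h0 h1 _) (Real.exp_pos _).le).trans ?_))
    rw [← Real.exp_add, ← Real.exp_add]
    refine Real.exp_le_exp.2 ?_
    obtain ⟨m, hm⟩ := Nat.exists_eq_add_of_le (hsideK hb true)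
    obtain ⟨k, hk⟩ := Nat.exists_eq_add_of_le (hsideK hb false)
    have e3 := hX.pot_add_le (side true l₁ u₁) (side false l₁ u₁) m k
    have e4 : (d : ℝ) ≤ m + k := by
      unfold hper at hh
      norm_cast
      omega
    have e5 := mul_le_mul_of_nonneg_left e4 hs₀
    simp only [hΦ, boxPot, hm, hk, Bool.not_true, Bool.not_false] at *
    push_cast
    linarith
  -- both halves bring in the constant `2 * d * H`, up to `6 * H`; one of them is used up for the
  -- whole box, `d * H` is lost because the union spans a slightly smaller box, and the remaining
  -- `d * H` pays for the choice of the two halves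
  have hS : ∀ z ∈ (B ×ˢ B) ×ˢ (B ×ˢ B), bprob E p (QS z) ≤
      Real.exp (-Φ) * Real.exp (-(H * (d - 6))) := by
    rintro ⟨⟨l₁, u₁⟩, ⟨l₂, u₂⟩⟩ -
    by_cases hz : (∀ o, co o l ≤ co o l₁ ∧ co o l₁ ≤ co o u₁ ∧ co o u₁ ≤ co o u) ∧
      (∀ o, co o l ≤ co o l₂ ∧ co o l₂ ≤ co o u₂ ∧ co o u₂ ≤ co o u) ∧
      d ≤ hper l₁ u₁ ∧ d ≤ hper l₂ u₂ ∧ hper l₁ u₁ + d ≤ hper l u ∧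
      hper l₂ u₂ + d ≤ hper l u ∧ ∃ l₃ u₃, hper l u < hper l₃ u₃ + d ∧
        (∀ o, side o l₃ u₃ ≤ side o l u) ∧ ∀ o, side o l₁ u₁ ≤ side o l₃ u₃ ∧
        side o l₂ u₂ ≤ side o l₃ u₃ ∧ side o l₃ u₃ ≤ side o l₁ u₁ + side o l₂ u₂
    swap
    · rw [bprob_congr (Q' := fun _ => False) fun S _ => ⟨fun h => hz h.1, False.elim⟩, bprob_false]
      positivity
    obtain ⟨hb1, hb2, g1, g2, g3, g4, l₃, u₃, g5, g7, g6⟩ := hz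
    refine (bprob_mono h0 h1 fun S _ h => h.2).trans ((bprob_disjOcc_le h0 h1
      (monotone_spEvent _ _ _) (monotone_spEvent _ _ _)).trans ?_)
    have gt := g6 true
    have gf := g6 false
    have f1 := hX.pot_subadd gt.1 gf.1 gt.2.1 gf.2.1 gt.2.2 gf.2.2
    have f2 : boxPot X l u ≤ boxPot X l₃ u₃ + d * H := by
      obtain ⟨m, hm⟩ := Nat.exists_eq_add_of_le (g7 true)
      obtain ⟨k, hk⟩ := Nat.exists_eq_add_of_le (g7 false)
      have e3 := hX.pot_add_le (side true l₃ u₃) (side false l₃ u₃) m k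
      have a1 := mul_le_mul_of_nonneg_left (hX.anti 0 0 (side true l₃ u₃) (side false l₃ u₃)
        (Nat.zero_le _) (Nat.zero_le _)) (Nat.cast_nonneg (α := ℝ) m)
      have a2 := mul_le_mul_of_nonneg_left (hX.anti 0 0 (side false l₃ u₃) (side true l₃ u₃)
        (Nat.zero_le _) (Nat.zero_le _)) (Nat.cast_nonneg (α := ℝ) k)
      have a3 : (m + k : ℝ) ≤ d := by
        unfold hper at g5
        norm_cast
        omega
      have a4 := mul_le_mul_of_nonneg_right a3 hH0
      simp only [boxPot, hm, hk]
      linarith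
    have f3 : boxPot X l₃ u₃ ≤ boxPot X l₁ u₁ + boxPot X l₂ u₂ := f1
    have hsum : hper l₃ u₃ ≤ hper l₁ u₁ + hper l₂ u₂ := by
      unfold hper
      omega
    -- a box of half-perimeter between `d` and `2 * d`
    have tiny : ∀ l' u' : ℤ × ℤ, (∀ o, co o l' ≤ co o u') → d ≤ hper l' u' → hper l' u' < 2 * d →
        bprob E p (SpEvent σ l' u') ≤ Real.exp (-(boxPot X l' u' + 2 * d * H - 6 * H)) := by
      intro l' u' hle h2 h3
      refine (small l' u' hle (by omega)).trans (Real.exp_le_exp.2 ?_)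
      have := hpotle l' u'
      have h2' : (d : ℝ) ≤ hper l' u' := by exact_mod_cast h2
      nlinarith [mul_le_mul_of_nonneg_left h2' hH0]
    have large : ∀ l' u' : ℤ × ℤ, (∀ o, co o l ≤ co o l' ∧ co o l' ≤ co o u' ∧ co o u' ≤ co o u) →
        hper l' u' + d ≤ hper l u → 2 * d ≤ hper l' u' →
        bprob E p (SpEvent σ l' u') ≤ Real.exp (-(boxPot X l' u' + 2 * d * H)) := by
      intro l' u' hb h2 h3
      exact ih _ (by omega) l' u' (fun o => (hb o).2.1) (fun o => (hsideK hb o).trans (hK o)) h3 rfl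
    have hdH : 0 ≤ d * H := by positivity
    by_cases c1 : 2 * d ≤ hper l₁ u₁
    · by_cases c2 : 2 * d ≤ hper l₂ u₂
      · refine (mul_le_mul (large _ _ hb1 g3 c1) (large _ _ hb2 g4 c2) (bprob_nonneg h0 h1 _)
          (Real.exp_pos _).le).trans ?_
        rw [← Real.exp_add, ← Real.exp_add]
        exact Real.exp_le_exp.2 (by linarith)
      · refine (mul_le_mul (large _ _ hb1 g3 c1) (tiny _ _ (fun o => (hb2 o).2.1) g2 (by omega))
          (bprob_nonneg h0 h1 _) (Real.exp_pos _).le).trans ?_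
        rw [← Real.exp_add, ← Real.exp_add]
        exact Real.exp_le_exp.2 (by linarith)
    -- two boxes with half-perimeters below `2 * d` cannot cover the given box
    · refine (mul_le_mul (tiny _ _ (fun o => (hb1 o).2.1) g1 (by omega))
        (large _ _ hb2 g4 (by omega)) (bprob_nonneg h0 h1 _) (Real.exp_pos _).le).trans ?_
      rw [← Real.exp_add, ← Real.exp_add]
      exact Real.exp_le_exp.2 (by linarith)
  have hBR : (B.card : ℝ) ≤ (K * K : ℕ) := by exact_mod_cast hBcard
  refine (bprob_mono h0 h1 hcover).trans ((bprob_or_le h0 h1 _ _).trans ((add_le_add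
    ((bprob_exists_le h0 h1 _ _).trans (Finset.sum_le_sum hN))
    ((bprob_exists_le h0 h1 _ _).trans (Finset.sum_le_sum hS))).trans ?_))
  rw [Finset.sum_const, Finset.sum_const, nsmul_eq_mul, nsmul_eq_mul, Finset.card_product,
    Finset.card_product, Finset.card_product]
  push_cast
  have k1 : (B.card : ℝ) * B.card ≤ ((K * K : ℕ) : ℝ) ^ 2 := by
    rw [sq]; gcongr
  have k2 : (B.card : ℝ) * B.card * (B.card * B.card) ≤ ((K * K : ℕ) : ℝ) ^ 4 := by
    calc (B.card : ℝ) * B.card * (B.card * B.card) = (B.card : ℝ) ^ 4 := by ring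
      _ ≤ _ := by gcongr
  have hexp := (Real.exp_pos (-Φ)).le
  calc (B.card : ℝ) * B.card * (Real.exp (-Φ) * Real.exp (-(s₀ * d))) +
      B.card * B.card * (B.card * B.card) * (Real.exp (-Φ) * Real.exp (-(H * (d - 6))))
      ≤ ((K * K : ℕ) : ℝ) ^ 2 * (Real.exp (-Φ) * Real.exp (-(s₀ * d))) +
        ((K * K : ℕ) : ℝ) ^ 4 * (Real.exp (-Φ) * Real.exp (-(H * (d - 6)))) := by gcongr
    _ = (((K * K : ℕ) : ℝ) ^ 2 * Real.exp (-(s₀ * d)) +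
        ((K * K : ℕ) : ℝ) ^ 4 * Real.exp (-(H * (d - 6)))) * Real.exp (-Φ) := by ring
    _ ≤ 1 * Real.exp (-Φ) := mul_le_mul_of_nonneg_right hcount hexp
    _ = Real.exp (-Φ) := one_mul _

end Spanning

/-! ### The integral of the cost function, and its Riemann sums -/

section Integral

lemma hcost_le_two_div_sq {t : ℝ} (ht : 0 < t) : hcost t ≤ 2 / t ^ 2 := by
  have h1 := one_sub_exp_pos ht
  have h2 := Real.one_sub_inv_le_log_of_pos h1
  have h3 := Real.quadratic_le_exp_of_nonneg ht.le
  have h4 : Real.exp (-t) ≤ (1 + t ^ 2 / 2)⁻¹ := by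
    rw [Real.exp_neg]
    exact inv_anti₀ (by positivity) (by linarith)
  have h5 : t ^ 2 / (t ^ 2 + 2) ≤ 1 - Real.exp (-t) := by
    have : (1 + t ^ 2 / 2)⁻¹ = 1 - t ^ 2 / (t ^ 2 + 2) := by
      have : t ^ 2 + 2 ≠ 0 := by positivity
      field_simp
      ring
    linarith
  have h6 : (1 - Real.exp (-t))⁻¹ ≤ (t ^ 2 / (t ^ 2 + 2))⁻¹ := inv_anti₀ (by positivity) h5
  have h7 : (t ^ 2 / (t ^ 2 + 2))⁻¹ = 1 + 2 / t ^ 2 := by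
    field_simp
  unfold hcost
  linarith

lemma hcost_le_sub_log {t : ℝ} (ht : 0 < t) : hcost t ≤ t - Real.log t := by
  have h1 := one_sub_exp_pos ht
  have h3 := Real.add_one_le_exp t
  have h4 : Real.exp (-t) ≤ (1 + t)⁻¹ := by
    rw [Real.exp_neg]
    exact inv_anti₀ (by positivity) (by linarith)
  have h5 : t / (1 + t) ≤ 1 - Real.exp (-t) := by
    have : (1 + t)⁻¹ = 1 - t / (1 + t) := by
      have : 1 + t ≠ 0 := by positivity
      field_simp
      ring
    linarith
  have h6 := Real.log_le_log (by positivity) h5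
  rw [Real.log_div ht.ne' (by positivity)] at h6
  have h7 := Real.log_le_sub_one_of_pos (show 0 < 1 + t by linarith)
  unfold hcost
  linarith

lemma measurable_hcost : Measurable hcost := by
  unfold hcost
  fun_prop

lemma hcost_pow_anti {c : ℝ} (hc : 0 < c) (m : ℕ) :
    AntitoneOn (fun x : ℝ => hcost (c * x ^ m)) (Ioi 0) := by
  intro x hx y hy hxy
  have hx' : 0 < x := hx
  exact hcost_anti (by positivity) (by gcongr)

lemma integrableOn_hcost_pow {c : ℝ} (hc : 0 < c) {m : ℕ} (hm : 1 ≤ m) :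
    IntegrableOn (fun x : ℝ => hcost (c * x ^ m)) (Ioi 0) := by
  have hmeas : Measurable (fun x : ℝ => hcost (c * x ^ m)) :=
    measurable_hcost.comp (by fun_prop)
  rw [← Ioc_union_Ioi_eq_Ioi zero_le_one, integrableOn_union]
  constructor
  · have h1 : IntegrableOn (fun x : ℝ => c - Real.log c - m * Real.log x) (Ioc 0 1) := by
      have : IntegrableOn Real.log (Ioc (0 : ℝ) 1) :=
        (intervalIntegrable_iff_integrableOn_Ioc_of_le zero_le_one).1
          intervalIntegral.intervalIntegrable_log'
      exact (integrableOn_const (by simp)).sub (this.const_mul _)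
    refine Integrable.mono' h1 hmeas.aestronglyMeasurable ?_
    refine ae_restrict_of_forall_mem measurableSet_Ioc fun x hx => ?_
    have hx0 : 0 < x := hx.1
    rw [Real.norm_of_nonneg (hcost_pos (by positivity)).le]
    refine (hcost_le_sub_log (by positivity)).trans ?_
    rw [Real.log_mul hc.ne' (by positivity), Real.log_pow]
    have : x ^ m ≤ 1 := pow_le_one₀ hx0.le hx.2
    nlinarith
  · have h1 : IntegrableOn (fun x : ℝ => 2 / c ^ 2 * x ^ (-2 : ℝ)) (Ioi 1) :=
      (integrableOn_Ioi_rpow_of_lt (by norm_num) zero_lt_one).const_mul _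
    refine Integrable.mono' h1 hmeas.aestronglyMeasurable ?_
    refine ae_restrict_of_forall_mem measurableSet_Ioi fun x hx => ?_
    have hx1 : 1 < x := hx
    have hx0 : 0 < x := by linarith
    rw [Real.norm_of_nonneg (hcost_pos (by positivity)).le]
    refine (hcost_le_two_div_sq (by positivity)).trans ?_
    rw [Real.rpow_neg hx0.le, Real.rpow_two, ← div_eq_mul_inv, div_div, mul_pow]
    gcongr
    exact le_self_pow₀ hx1.le (by omega)

/-- Riemann sums of a decreasing function are at most its integral. -/
lemma sum_le_integral_of_antitone {F : ℝ → ℝ} (hF : AntitoneOn F (Ioi 0))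
    (hi : IntegrableOn F (Ioi 0)) (h0 : ∀ x, 0 < x → 0 ≤ F x) {q : ℝ} (hq : 0 < q) (K : ℕ) :
    q * ∑ k ∈ Finset.range K, F ((k + 1 : ℕ) * q) ≤ ∫ x in Ioi (0 : ℝ), F x := by
  have hint : ∀ a b : ℝ, 0 ≤ a → a ≤ b → IntervalIntegrable F volume a b := fun a b ha hab =>
    (intervalIntegrable_iff_integrableOn_Ioc_of_le hab).2
      (hi.mono_set fun x hx => ha.trans_lt hx.1)
  have h1 : q * ∑ k ∈ Finset.range K, F ((k + 1 : ℕ) * q) ≤ ∫ x in (0 : ℝ)..(K * q), F x := by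
    induction K with
    | zero => simp
    | succ K ih =>
      have hK : (0 : ℝ) ≤ K * q := by positivity
      have hK' : (K : ℝ) * q ≤ (K + 1 : ℕ) * q := by push_cast; nlinarith
      rw [Finset.sum_range_succ, mul_add,
        ← intervalIntegral.integral_add_adjacent_intervals (hint 0 (K * q) le_rfl hK)
          (hint _ _ hK hK')]
      refine add_le_add ih ?_
      have h2 : ∫ _ in (K * q : ℝ)..((K + 1 : ℕ) * q), F ((K + 1 : ℕ) * q) =
          q * F ((K + 1 : ℕ) * q) := by
        rw [intervalIntegral.integral_const, smul_eq_mul]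
        push_cast
        ring
      rw [← h2]
      refine intervalIntegral.integral_mono_on_of_le_Ioo hK' (by simp) (hint _ _ hK hK') ?_
      intro x hx
      exact hF (mem_Ioi.2 (hK.trans_lt hx.1)) (mem_Ioi.2 (by positivity)) hx.2.le
  refine h1.trans ?_
  rw [intervalIntegral.integral_of_le (by positivity)]
  refine setIntegral_mono_set hi ?_ (Eventually.of_forall fun x hx => hx.1)
  exact ae_restrict_of_forall_mem measurableSet_Ioi fun x hx => h0 x hx

/-- Riemann sums of a decreasing function are at least its integral. -/
lemma integral_le_sum_of_antitone {F : ℝ → ℝ} (hF : AntitoneOn F (Ioi 0))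
    (hi : IntegrableOn F (Ioi 0)) {q v : ℝ} (hq : 0 < q) (hv : 0 ≤ v) (K : ℕ) :
    ∫ x in (q + v)..((K + 1 : ℕ) * q + v), F x ≤
      q * ∑ k ∈ Finset.range K, F ((k + 1 : ℕ) * q + v) := by
  have hint : ∀ a b : ℝ, 0 ≤ a → a ≤ b → IntervalIntegrable F volume a b := fun a b ha hab =>
    (intervalIntegrable_iff_integrableOn_Ioc_of_le hab).2
      (hi.mono_set fun x hx => ha.trans_lt hx.1)
  induction K with
  | zero => simp
  | succ K ih =>
    have hK0 : (0 : ℝ) < (K + 1 : ℕ) * q + v := by positivity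
    have hK : q + v ≤ (K + 1 : ℕ) * q + v := by
      push_cast
      nlinarith [mul_nonneg (Nat.cast_nonneg (α := ℝ) K) hq.le]
    have hK' : (K + 1 : ℕ) * q + v ≤ (K + 1 + 1 : ℕ) * q + v := by push_cast; nlinarith
    rw [Finset.sum_range_succ, mul_add,
      ← intervalIntegral.integral_add_adjacent_intervals (hint _ _ (by positivity) hK)
        (hint _ _ hK0.le hK')]
    refine add_le_add ih ?_
    have h2 : ∫ _ in ((K + 1 : ℕ) * q + v : ℝ)..((K + 1 + 1 : ℕ) * q + v), F ((K + 1 : ℕ) * q + v) =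
        q * F ((K + 1 : ℕ) * q + v) := by
      rw [intervalIntegral.integral_const, smul_eq_mul]
      push_cast
      ring
    rw [← h2]
    refine intervalIntegral.integral_mono_on_of_le_Ioo hK' (hint _ _ hK0.le hK') (by simp) ?_
    intro x hx
    exact hF (mem_Ioi.2 hK0) (mem_Ioi.2 (hK0.trans hx.1)) hx.1.le

/-- The integral over the half-line is approximated by integrals over compact intervals. -/
lemma exists_integral_ge {F : ℝ → ℝ} (hi : IntegrableOn F (Ioi 0)) {ε : ℝ} (hε : 0 < ε) :
    ∃ N : ℕ, 1 ≤ N ∧ ∀ n : ℕ, N ≤ n →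
      (∫ x in Ioi (0 : ℝ), F x) - ε ≤ ∫ x in ((1 : ℝ) / n)..n, F x := by
  set s : ℕ → Set ℝ := fun n => Ioc (1 / n : ℝ) n with hs
  have hmono : Monotone fun n : ℕ => s (n + 1) := by
    intro n m hnm
    refine Ioc_subset_Ioc ?_ ?_
    · gcongr
    · exact_mod_cast Nat.succ_le_succ hnm
  have hU : ⋃ n, s (n + 1) = Ioi (0 : ℝ) := by
    ext x
    simp only [mem_iUnion, hs, mem_Ioc, mem_Ioi]
    constructor
    · rintro ⟨n, h1, -⟩
      exact lt_trans (by positivity) h1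
    · intro hx
      obtain ⟨n, hn⟩ := exists_nat_gt (max x (1 / x))
      have h1 := (le_max_left x (1 / x)).trans_lt hn
      have h2 := (le_max_right x (1 / x)).trans_lt hn
      refine ⟨n, ?_, ?_⟩
      · push_cast
        rw [div_lt_iff₀ (by positivity)]
        rw [div_lt_iff₀ hx] at h2
        nlinarith
      · push_cast
        linarith
  have ht := tendsto_setIntegral_of_monotone (μ := volume) (f := F)
    (fun n => (measurableSet_Ioc : MeasurableSet (s (n + 1)))) hmono (by rwa [hU])
  rw [hU] at ht
  obtain ⟨N, hN⟩ := (ht.eventually (lt_mem_nhds (show (∫ x in Ioi (0 : ℝ), F x) - ε <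
    ∫ x in Ioi (0 : ℝ), F x by linarith))).exists_forall_of_atTop
  refine ⟨N + 1, by omega, fun n hn => ?_⟩
  obtain ⟨m, rfl⟩ : ∃ m, n = m + 1 := ⟨n - 1, by omega⟩
  have := (hN m (by omega)).le
  rw [intervalIntegral.integral_of_le]
  · exact this
  · have : (1 : ℝ) ≤ (m + 1 : ℕ) := by exact_mod_cast Nat.succ_le_succ (Nat.zero_le m)
    calc (1 : ℝ) / (m + 1 : ℕ) ≤ 1 := by rw [div_le_one (by positivity)]; exact this
      _ ≤ _ := this

lemma nuIntegrand_eq (σ : ℕ) :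
    nuIntegrand σ = fun x : ℝ => hcost (((σ.factorial : ℝ))⁻¹ * x ^ (2 * σ + 1)) := by
  funext x
  rw [nuIntegrand, hcost, div_eq_inv_mul]

lemma integrableOn_nuIntegrand (σ : ℕ) : IntegrableOn (nuIntegrand σ) (Ioi (0 : ℝ)) := by
  rw [nuIntegrand_eq]
  exact integrableOn_hcost_pow (by positivity) (by omega)

lemma antitoneOn_nuIntegrand (σ : ℕ) : AntitoneOn (nuIntegrand σ) (Ioi (0 : ℝ)) := by
  rw [nuIntegrand_eq]
  exact hcost_pow_anti (by positivity) _

lemma nuIntegrand_pos (σ : ℕ) {x : ℝ} (hx : 0 < x) : 0 < nuIntegrand σ x := by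
  rw [nuIntegrand_eq]
  exact hcost_pos (by positivity)

lemma nu_pos (σ : ℕ) : 0 < nu σ := by
  have h := sum_le_integral_of_antitone (antitoneOn_nuIntegrand σ) (integrableOn_nuIntegrand σ)
    (fun x hx => (nuIntegrand_pos σ hx).le) zero_lt_one 1
  have h2 := nuIntegrand_pos σ zero_lt_one
  simp only [Finset.sum_range_one, one_mul, zero_add, Nat.cast_one] at h
  exact h2.trans_le h

end Integral

/-! ### Spanned boxes near the critical size -/

section BoxBound

lemma tendsto_div_pow_mul_exp (n : ℕ) (C : ℝ) {k : ℝ} (hk : 0 < k) :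
    Tendsto (fun q : ℝ => (C / q) ^ n * Real.exp (-(k / q))) (𝓝[>] 0) (𝓝 0) := by
  have h1 : Tendsto (fun q : ℝ => k / q) (𝓝[>] 0) atTop := by
    simp only [div_eq_mul_inv]
    exact tendsto_inv_nhdsGT_zero.const_mul_atTop hk
  have h2 := ((Real.tendsto_pow_mul_exp_neg_atTop_nhds_zero n).comp h1).const_mul ((C / k) ^ n)
  rw [mul_zero] at h2
  refine h2.congr fun q => ?_
  simp only [Function.comp]
  rw [← mul_assoc, ← mul_pow]
  congr 2
  field_simp

lemma eventually_lt_of_pos {r : ℝ} (hr : 0 < r) : ∀ᶠ q : ℝ in 𝓝[>] 0, q < r :=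
  mem_nhdsWithin_of_mem_nhds (Iio_mem_nhds hr)

lemma eventually_pos : ∀ᶠ q : ℝ in 𝓝[>] 0, 0 < q := self_mem_nhdsWithin

/-- The potential of a box of the critical size: it is at least `2 ν / q`, up to a small error. If the
box is not too narrow, then it can be completed to a square at a small cost, and the cost of a
square is a Riemann sum of the integral `2 ν`. -/
lemma eventually_le_pot {σ : ℕ} (hσ : 1 ≤ σ) {η : ℝ} (hη : 0 < η) :
    ∃ M u₀ : ℝ, 0 < M ∧ 0 < u₀ ∧ ∀ᶠ q : ℝ in 𝓝[>] 0, ∀ a b : ℕ, a ≤ 2 * ⌈M / q⌉₊ →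
      b ≤ 2 * ⌈M / q⌉₊ → ⌈M / q⌉₊ ≤ a → b ≤ a →
      (2 * nu σ - η) / q ≤ pot (stepCost σ ((σ.factorial : ℝ)⁻¹ * q ^ (2 * σ + 1)) u₀) a b := by
  obtain ⟨N, hN1, hN⟩ := exists_integral_ge (integrableOn_nuIntegrand σ) (show 0 < η / 8 by linarith)
  have hh2 := hcost_pos (show (0 : ℝ) < 2 by norm_num)
  have hfac : (0 : ℝ) < σ.factorial := by positivity
  have hfac1 : (1 : ℝ) ≤ σ.factorial := by exact_mod_cast σ.factorial_pos
  obtain ⟨n, hn⟩ := exists_nat_ge (max (N : ℝ) (max (3 ^ σ) (max (2 * nu σ / hcost 2)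
    (24 * (σ.factorial : ℝ) ^ 2 / η))))
  have hn1 : N ≤ n := by exact_mod_cast (le_max_left _ _).trans hn
  have hn2 : (3 : ℝ) ^ σ ≤ n := (le_max_left _ _).trans ((le_max_right _ _).trans hn)
  have hn3 : 2 * nu σ / hcost 2 ≤ n :=
    (le_max_left _ _).trans ((le_max_right _ _).trans ((le_max_right _ _).trans hn))
  have hn4 : 24 * (σ.factorial : ℝ) ^ 2 / η ≤ n :=
    (le_max_right _ _).trans ((le_max_right _ _).trans ((le_max_right _ _).trans hn))
  have hnn : 1 ≤ n := hN1.trans hn1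
  set M : ℝ := (n : ℝ) with hM
  have hM1 : 1 ≤ M := by rw [hM]; exact_mod_cast hnn
  have hM0 : 0 < M := by linarith
  have hint := hN n hn1
  rw [← nu, ← hM] at hint
  set v : ℝ := 1 / (2 * M) with hv
  have hv0 : 0 < v := by positivity
  have hv1 : v ≤ 1 := by rw [hv, div_le_one (by positivity)]; linarith
  have hvM : 1 / M = v + v := by rw [hv]; field_simp; norm_num
  set u₀ : ℝ := (σ.factorial : ℝ)⁻¹ * v ^ (2 * σ + 1) with hu
  have hu0 : 0 < u₀ := by positivity
  have hu1 : u₀ ≤ 1 := mul_le_one₀ (inv_le_one_of_one_le₀ hfac1) (by positivity)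
    (pow_le_one₀ hv0.le hv1)
  refine ⟨M, u₀, hM0, hu0, ?_⟩
  filter_upwards [eventually_pos, eventually_lt_of_pos (show 0 < M / 2 by positivity),
    eventually_lt_of_pos hv0] with q hq hqM hqv a b ha hb hka hba
  set c := (σ.factorial : ℝ)⁻¹ * q ^ (2 * σ + 1) with hc
  have hc0 : 0 < c := by positivity
  have hX := isStepCost_stepCost (σ := σ) hc0.le hu0
  have haM : M ≤ a * q := by
    have h1 : M / q ≤ a := (Nat.le_ceil _).trans (by exact_mod_cast hka)
    rwa [div_le_iff₀ hq] at h1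
  have haA : a * q ≤ 3 * M := by
    have h1 : ((⌈M / q⌉₊ : ℕ) : ℝ) < M / q + 1 := Nat.ceil_lt_add_one (by positivity)
    have h2 : (a : ℝ) ≤ 2 * (⌈M / q⌉₊ : ℕ) := by exact_mod_cast ha
    have h3 : (a : ℝ) ≤ 2 * (M / q + 1) := by linarith
    calc a * q ≤ 2 * (M / q + 1) * q := by gcongr
      _ = 2 * M + 2 * q := by field_simp
      _ ≤ 3 * M := by linarith
  have hba' : (b : ℝ) ≤ a := by exact_mod_cast hba
  have hbq : b * q ≤ 3 * M := (mul_le_mul_of_nonneg_right hba' hq.le).trans haA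
  rw [div_le_iff₀ hq]
  rcases le_or_gt (1 / M) (b * q) with hcase | hcase
  · -- completing the box to a square
    have h1 : pot (stepCost σ c u₀) a a ≤ pot (stepCost σ c u₀) a b +
        (3 * M / q) * hcost ((σ.factorial : ℝ)⁻¹ * M) := by
      obtain ⟨k, rfl⟩ := Nat.exists_eq_add_of_le hba
      have h2 := hX.pot_add_le (b + k) b 0 k
      have h3 : stepCost σ c u₀ b (b + k) ≤ hcost ((σ.factorial : ℝ)⁻¹ * M) := by
        refine hcost_anti (by positivity) ?_
        have e : c * (((b + k : ℕ) : ℝ) ^ (σ + 1) * (b : ℝ) ^ σ) =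
            (σ.factorial : ℝ)⁻¹ * ((((b + k : ℕ) : ℝ) * q) ^ (σ + 1) * (b * q) ^ σ) := by
          rw [hc]; ring
        rw [e]
        have h4 : M ≤ (((b + k : ℕ) : ℝ) * q) ^ (σ + 1) * (b * q) ^ σ := by
          calc M = M ^ (σ + 1) * (1 / M) ^ σ := by
                rw [one_div, inv_pow, pow_succ]; field_simp
            _ ≤ _ := by gcongr
        have := mul_le_mul_of_nonneg_left h4 (inv_nonneg.2 hfac.le)
        linarith
      have h5 : (k : ℝ) ≤ 3 * M / q := by
        rw [le_div_iff₀ hq]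
        push_cast at haA
        nlinarith [mul_nonneg (Nat.cast_nonneg (α := ℝ) b) hq.le]
      have h6 := mul_le_mul h5 h3 (hX.nonneg _ _) (by positivity)
      simp only [Nat.cast_zero, zero_mul, add_zero] at h2
      linarith
    have h2 : 3 * M * hcost ((σ.factorial : ℝ)⁻¹ * M) ≤ η / 4 := by
      have h3 := hcost_le_two_div_sq (show 0 < (σ.factorial : ℝ)⁻¹ * M by positivity)
      have h4 : 3 * M * (2 / ((σ.factorial : ℝ)⁻¹ * M) ^ 2) = 6 * (σ.factorial : ℝ) ^ 2 / M := by
        field_simp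
        norm_num
      have h5 : 6 * (σ.factorial : ℝ) ^ 2 / M ≤ η / 4 := by
        rw [div_le_iff₀ hM0]
        rw [div_le_iff₀ hη] at hn4
        linarith
      have := mul_le_mul_of_nonneg_left h3 (show 0 ≤ 3 * M by positivity)
      linarith
    have h3 : 2 * (nu σ - η / 8) ≤ pot (stepCost σ c u₀) a a * q := by
      have h4 := hX.diag_le_pot (le_refl a)
      rw [Finset.Ico_self, Finset.sum_empty, add_zero] at h4
      have h5 : ∀ k : ℕ, 2 * nuIntegrand σ ((k + 1 : ℕ) * q + v) ≤
          stepCost σ c u₀ k k + stepCost σ c u₀ k (k + 1) := by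
        intro k
        have h6 := hX.anti k k (k + 1) (k + 1) (by omega) (by omega)
        have h7 := hX.anti k (k + 1) (k + 1) (k + 1) (by omega) le_rfl
        have h8 : nuIntegrand σ ((k + 1 : ℕ) * q + v) ≤ stepCost σ c u₀ (k + 1) (k + 1) := by
          rw [nuIntegrand_eq]
          refine hcost_anti (by positivity) ?_
          have h9 := pow_add_pow_le (show 0 ≤ ((k + 1 : ℕ) : ℝ) * q by positivity) hv0.le
            (show 2 * σ + 1 ≠ 0 by omega)
          have h10 := mul_le_mul_of_nonneg_left h9 (inv_nonneg.2 hfac.le)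
          have e : c * (((k + 1 : ℕ) : ℝ) ^ (σ + 1) * ((k + 1 : ℕ) : ℝ) ^ σ) =
              (σ.factorial : ℝ)⁻¹ * (((k + 1 : ℕ) : ℝ) * q) ^ (2 * σ + 1) := by
            rw [hc]; ring
          rw [e, hu]
          linarith
        linarith
      have h6 := Finset.sum_le_sum fun k (_ : k ∈ Finset.range a) => h5 k
      rw [← Finset.mul_sum] at h6
      have h7 := integral_le_sum_of_antitone (antitoneOn_nuIntegrand σ) (integrableOn_nuIntegrand σ)
        hq hv0.le a
      have h8 : ∫ x in (1 / M)..M, nuIntegrand σ x ≤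
          ∫ x in (q + v)..((a + 1 : ℕ) * q + v), nuIntegrand σ x := by
        have h9 : 0 < q + v := by positivity
        have h10 : M ≤ (a + 1 : ℕ) * q + v := by push_cast; linarith
        have h11 : 1 / M ≤ M := by
          rw [div_le_iff₀ hM0]; nlinarith
        refine intervalIntegral.integral_mono_interval (by linarith) h11 h10 ?_ ?_
        · exact ae_restrict_of_forall_mem measurableSet_Ioc fun x hx =>
            (nuIntegrand_pos σ (h9.trans hx.1)).le
        · exact (intervalIntegrable_iff_integrableOn_Ioc_of_le (by linarith)).2
            ((integrableOn_nuIntegrand σ).mono_set fun x hx => h9.trans hx.1)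
      have h9 := mul_le_mul_of_nonneg_right (h6.trans h4) hq.le
      linarith
    have h4 := mul_le_mul_of_nonneg_right h1 hq.le
    have h5 : (pot (stepCost σ c u₀) a b + 3 * M / q * hcost ((σ.factorial : ℝ)⁻¹ * M)) * q =
        pot (stepCost σ c u₀) a b * q + 3 * M * hcost ((σ.factorial : ℝ)⁻¹ * M) := by
      field_simp
    rw [h5] at h4
    linarith
  · -- a narrow box
    have h1 := hX.le_pot a b
    have h2 : hcost 2 ≤ stepCost σ c u₀ a b := by
      refine hcost_anti (by positivity) ?_
      have e : c * ((b : ℝ) ^ (σ + 1) * (a : ℝ) ^ σ) =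
          (σ.factorial : ℝ)⁻¹ * ((b * q) ^ (σ + 1) * (a * q) ^ σ) := by
        rw [hc]; ring
      rw [e]
      have h3 : (b * q) ^ (σ + 1) * (a * q) ^ σ ≤ 1 := by
        calc (b * q) ^ (σ + 1) * (a * q) ^ σ ≤ (1 / M) ^ (σ + 1) * (3 * M) ^ σ := by gcongr
          _ = 3 ^ σ / M := by
            rw [mul_pow, pow_succ, one_div, inv_pow]; field_simp
          _ ≤ 1 := by rw [div_le_one hM0]; exact hn2
      have h4 : (σ.factorial : ℝ)⁻¹ * ((b * q) ^ (σ + 1) * (a * q) ^ σ) ≤ 1 :=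
        mul_le_one₀ (inv_le_one_of_one_le₀ hfac1) (by positivity) h3
      linarith
    rw [div_le_iff₀ hh2] at hn3
    have h3 := mul_le_mul haM h2 hh2.le (by positivity)
    have h4 := mul_le_mul_of_nonneg_right h1 hq.le
    linarith

lemma exp_neg_le_one_sub {t : ℝ} (h0 : 0 ≤ t) (h1 : t ≤ 1 / 2) :
    Real.exp (-(t + 2 * t ^ 2)) ≤ 1 - t := by
  have h2 : 0 < 1 - t := by linarith
  rw [← Real.le_log_iff_exp_le h2]
  refine le_trans ?_ (Real.one_sub_inv_le_log_of_pos h2)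
  have h3 : (1 - t)⁻¹ ≤ 1 + (t + 2 * t ^ 2) := by
    rw [inv_le_iff_one_le_mul₀ h2]
    nlinarith [mul_nonneg (mul_nonneg h0 h0) (show 0 ≤ 1 - 2 * t by linarith)]
  linarith

lemma card_left_le {l u : ℤ × ℤ} (o : Bool) (i : ℤ) :
    ((Finset.Icc l u).filter fun v => co o v ≤ i).card ≤ (i + 1 - co o l).toNat * side (!o) l u := by
  refine le_trans (Finset.card_le_card fun v hv => ?_) (card_strip_le l u o (co o l) i)
  obtain ⟨hv, hvi⟩ := Finset.mem_filter.1 hv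
  exact Finset.mem_filter.2 ⟨hv, (co_mem_Icc hv o).1, hvi⟩

lemma card_right_le {l u : ℤ × ℤ} (o : Bool) (i : ℤ) :
    ((Finset.Icc l u).filter fun v => i + 1 ≤ co o v).card ≤ (co o u - i).toNat * side (!o) l u := by
  refine le_trans (Finset.card_le_card fun v hv => ?_)
    ((card_strip_le l u o (i + 1) (co o u)).trans (le_of_eq ?_))
  · obtain ⟨hv, hvi⟩ := Finset.mem_filter.1 hv
    exact Finset.mem_filter.2 ⟨hv, hvi, (co_mem_Icc hv o).2⟩
  · congr 2
    omega

set_option maxHeartbeats 600000 in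
/-- For small `q`, a boundary outside a slightly smaller box is crossed with probability
at most the exponential of minus the step cost of the smaller box, with some room. -/
lemma eventually_cross {σ : ℕ} (hσ : 1 ≤ σ) {M u₀ : ℝ} (hM : 0 < M) (hu : 0 < u₀) :
    ∃ s₀ δ₀ : ℝ, 0 < s₀ ∧ 0 < δ₀ ∧ ∀ δ, 0 < δ → δ ≤ δ₀ → ∀ᶠ q : ℝ in 𝓝[>] 0, ∀ p : ℝ, 0 ≤ p →
      p ≤ 1 → p ^ σ = q ^ (2 * σ + 1) → p ≤ q ^ 2 → ∀ (E : Finset (Sym2 (ℤ × ℤ)))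
      (l u l₁ u₁ : ℤ × ℤ), (∀ o, side o l u ≤ 2 * ⌈M / q⌉₊) →
        (∀ o, co o l ≤ co o l₁ ∧ co o l₁ ≤ co o u₁ ∧ co o u₁ ≤ co o u) →
        hper l u ≤ hper l₁ u₁ + 2 * ⌊δ / q⌋₊ → ∀ o,
        ∀ i ∈ Finset.Ico (co o l) (co o u) \ Finset.Ico (co o l₁) (co o u₁),
        bprob E p (CrossWit σ (o, i) (Finset.Icc l u)) ≤
          Real.exp (-(stepCost σ ((σ.factorial : ℝ)⁻¹ * q ^ (2 * σ + 1)) u₀ (side o l₁ u₁)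
            (side (!o) l₁ u₁) + s₀)) := by
  have hfac : (0 : ℝ) < σ.factorial := by positivity
  have hfac1 : (1 : ℝ) ≤ σ.factorial := by exact_mod_cast σ.factorial_pos
  have hinv : (σ.factorial : ℝ)⁻¹ ≤ 1 := inv_le_one_of_one_le₀ hfac1
  set A := 3 * M with hA
  have hA0 : 0 < A := by positivity
  set G : ℝ × ℝ → ℝ := fun z => (σ.factorial : ℝ)⁻¹ * (z.2 ^ (σ + 1) * z.1 ^ σ) with hG
  have hGc : ContinuousOn G (Icc 0 A ×ˢ Icc 0 A) := by
    refine Continuous.continuousOn ?_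
    fun_prop
  obtain ⟨δ₁, hδ₁, hunif⟩ := Metric.uniformContinuousOn_iff.1
    ((isCompact_Icc.prod isCompact_Icc).uniformContinuousOn_of_continuous hGc) (u₀ / 2) (by positivity)
  set g := Real.exp (-A ^ (2 * σ + 1)) * (Real.exp (-(3 * u₀ / 4)) - Real.exp (-u₀)) with hg
  have hg0 : 0 < g := mul_pos (Real.exp_pos _) (sub_pos.2 (Real.exp_lt_exp.2 (by linarith)))
  obtain ⟨δ₀, hδ₀, hδ'⟩ := exists_between (show 0 < min (δ₁ / 2) (min (1 / 2)
    (g / (6 * A ^ (σ + 1)))) by positivity)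
  refine ⟨g / 3, δ₀, by positivity, hδ₀, fun δ hδ0 hle => ?_⟩
  have hδ := hle.trans_lt hδ'
  have hδa : 2 * δ < δ₁ := by linarith [hδ.trans_le (min_le_left _ _)]
  have hδ'' := hδ.trans_le (min_le_right _ _)
  have hδb : 2 * δ ≤ 1 := by linarith [hδ''.trans_le (min_le_left _ _)]
  have hδc : A ^ (σ + 1) * (2 * δ) ≤ g / 3 := by
    have := (hδ''.trans_le (min_le_right _ _)).le
    rw [le_div_iff₀ (by positivity)] at this
    linarith
  filter_upwards [eventually_pos, eventually_lt_of_pos (show 0 < M / 2 by positivity),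
    eventually_lt_of_pos (show 0 < 1 / (2 * A ^ (2 * σ)) by positivity),
    eventually_lt_of_pos (show 0 < u₀ / (8 * A ^ (4 * σ + 1)) by positivity),
    eventually_lt_of_pos (show 0 < g / (3 * A) by positivity)] with
    q hq hqM hq1 hq2 hq3 p hp0 hp1 hpq hpq2 E
  have hdq : ((⌊δ / q⌋₊ : ℕ) : ℝ) * q ≤ δ := by
    have := Nat.floor_le (show 0 ≤ δ / q by positivity)
    rwa [le_div_iff₀ hq] at this
  set d := ⌊δ / q⌋₊
  set c := (σ.factorial : ℝ)⁻¹ * q ^ (2 * σ + 1) with hc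
  -- the probabilities in terms of the rescaled sides
  have hpow : ∀ m : ℕ, (m * p) ^ σ / (σ.factorial : ℝ) =
      (σ.factorial : ℝ)⁻¹ * ((m : ℝ) ^ σ * q ^ (2 * σ + 1)) := by
    intro m
    rw [mul_pow, hpq, div_eq_inv_mul]
  intro l u l₁ u₁ hK hb hper2 o i hi
  have hside : ∀ o, (side o l u : ℝ) * q ≤ A := by
    intro o
    have h1 : ((⌈M / q⌉₊ : ℕ) : ℝ) < M / q + 1 := Nat.ceil_lt_add_one (by positivity)
    have h2 : (side o l u : ℝ) ≤ 2 * (⌈M / q⌉₊ : ℕ) := by exact_mod_cast hK o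
    have h3 : (side o l u : ℝ) ≤ 2 * (M / q + 1) := by linarith
    calc side o l u * q ≤ 2 * (M / q + 1) * q := by gcongr
      _ = 2 * M + 2 * q := by field_simp
      _ ≤ A := by rw [hA]; linarith
  have hle : ∀ o, side o l₁ u₁ ≤ side o l u := by
    intro o; have := hb o; unfold side; omega
  have hle2 : ∀ o, side o l u ≤ side o l₁ u₁ + 2 * d := by
    intro o
    have ht := hle true; have hf := hle false
    unfold hper at hper2
    cases o <;> omega
  set a := side o l u with ha
  set b := side (!o) l u with hbdef
  set a₁ := side o l₁ u₁ with ha₁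
  set b₁ := side (!o) l₁ u₁ with hb₁
  have haA : a * q ≤ A := hside o
  have hbA : b * q ≤ A := hside (!o)
  have ha₁a : (a₁ : ℝ) ≤ a := by exact_mod_cast hle o
  have hb₁b : (b₁ : ℝ) ≤ b := by exact_mod_cast hle (!o)
  have haa₁ : (a : ℝ) ≤ a₁ + 2 * d := by exact_mod_cast hle2 o
  have hbb₁ : (b : ℝ) ≤ b₁ + 2 * d := by exact_mod_cast hle2 (!o)
  set t := (((a * b : ℕ) : ℝ) * p) ^ σ / (σ.factorial : ℝ) with ht
  have ht' : t = (σ.factorial : ℝ)⁻¹ * ((a * q) ^ σ * (b * q) ^ σ * q) := by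
    rw [ht, hpow]; push_cast; ring
  have ht0 : 0 ≤ t := by rw [ht']; positivity
  have htA : t ≤ A ^ (2 * σ) * q := by
    rw [ht']
    have h1 : (a * q) ^ σ * (b * q) ^ σ * q ≤ A ^ σ * A ^ σ * q := by gcongr
    have h2 : A ^ σ * A ^ σ * q = A ^ (2 * σ) * q := by rw [two_mul, pow_add]
    calc _ ≤ 1 * ((a * q) ^ σ * (b * q) ^ σ * q) := by gcongr
      _ ≤ _ := by rw [one_mul, ← h2]; exact h1
  have ht2 : t ≤ 1 / 2 := by
    rw [lt_div_iff₀ (by positivity)] at hq1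
    linarith
  -- which side of the boundary is thin
  have hstrip : (((Finset.Icc l u).filter fun v => co o v ≤ i).card ≤ a * b ∧
      ((Finset.Icc l u).filter fun v => i + 1 ≤ co o v).card ≤ 2 * d * b) ∨
    (((Finset.Icc l u).filter fun v => co o v ≤ i).card ≤ 2 * d * b ∧
      ((Finset.Icc l u).filter fun v => i + 1 ≤ co o v).card ≤ a * b) := by
    have hleft := card_left_le (l := l) (u := u) o i
    have hright := card_right_le (l := l) (u := u) o i
    rw [Finset.mem_sdiff, Finset.mem_Ico, Finset.mem_Ico] at hi
    have hbo := hb o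
    have h2 : side o l u ≤ side o l₁ u₁ + 2 * d := hle2 o
    rcases lt_or_ge i (co o l₁) with h | h
    · refine Or.inr ⟨hleft.trans (Nat.mul_le_mul ?_ le_rfl), hright.trans (Nat.mul_le_mul ?_ le_rfl)⟩
      · unfold side at h2; omega
      · rw [ha]; unfold side; omega
    · refine Or.inl ⟨hleft.trans (Nat.mul_le_mul ?_ le_rfl), hright.trans (Nat.mul_le_mul ?_ le_rfl)⟩
      · rw [ha]; unfold side; omega
      · unfold side at h2; omega
  refine (bprob_crossWit_le hp0 hp1 l u o i (ht2.trans (by norm_num)) hstrip).trans ?_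
  rw [← hbdef, ← ht]
  -- the thin side and the lattice edges contribute little
  have hthin : b * ((((2 * d * b : ℕ) : ℝ) * p) ^ σ / (σ.factorial : ℝ)) ≤ g / 3 := by
    rw [hpow]
    have h1 : (b : ℝ) * ((σ.factorial : ℝ)⁻¹ * (((2 * d * b : ℕ) : ℝ) ^ σ * q ^ (2 * σ + 1))) =
        (σ.factorial : ℝ)⁻¹ * ((b * q) ^ (σ + 1) * (2 * (d * q)) ^ σ) := by
      push_cast; ring
    rw [h1]
    have h2 : (2 * (d * q)) ^ σ ≤ 2 * δ := by
      calc (2 * ((d : ℝ) * q)) ^ σ ≤ (2 * δ) ^ σ := by gcongr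
        _ ≤ 2 * δ := pow_le_of_le_one (by positivity) (by linarith) (by omega)
    calc _ ≤ 1 * ((b * q) ^ (σ + 1) * (2 * (d * q)) ^ σ) := by gcongr
      _ ≤ A ^ (σ + 1) * (2 * δ) := by rw [one_mul]; gcongr
      _ ≤ g / 3 := hδc
  have hedge : b * p ≤ g / 3 := by
    rw [lt_div_iff₀ (by positivity)] at hq3
    calc b * p ≤ b * q ^ 2 := by gcongr
      _ = (b * q) * q := by ring
      _ ≤ A * q := by gcongr
      _ ≤ g / 3 := by linarith
  -- the main term
  set U := c * ((b₁ : ℝ) ^ (σ + 1) * (a₁ : ℝ) ^ σ) with hU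
  have hUG : U = G (a₁ * q, b₁ * q) := by rw [hU, hG, hc]; ring
  have hbt : b * t = G (a * q, b * q) := by rw [ht', hG]; ring
  have hclose : b * t ≤ U + u₀ / 2 := by
    have h1 : dist ((a * q, b * q) : ℝ × ℝ) (a₁ * q, b₁ * q) < δ₁ := by
      rw [Prod.dist_eq, Real.dist_eq, Real.dist_eq, max_lt_iff]
      constructor
      · rw [← sub_mul, abs_of_nonneg (mul_nonneg (by linarith) hq.le)]
        have := mul_le_mul_of_nonneg_right (show (a : ℝ) - a₁ ≤ 2 * d by linarith) hq.le
        linarith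
      · rw [← sub_mul, abs_of_nonneg (mul_nonneg (by linarith) hq.le)]
        have := mul_le_mul_of_nonneg_right (show (b : ℝ) - b₁ ≤ 2 * d by linarith) hq.le
        linarith
    have h2 := hunif (a * q, b * q) ⟨⟨by positivity, haA⟩, by positivity, hbA⟩ (a₁ * q, b₁ * q)
      ⟨⟨by positivity, (mul_le_mul_of_nonneg_right ha₁a hq.le).trans haA⟩, by positivity,
        (mul_le_mul_of_nonneg_right hb₁b hq.le).trans hbA⟩ h1
    rw [Real.dist_eq, ← hUG, ← hbt] at h2
    linarith [(abs_lt.1 h2).2]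
  have hU0 : 0 ≤ U := by rw [hU]; positivity
  have hUA : U ≤ A ^ (2 * σ + 1) := by
    rw [hUG, hG]
    simp only
    calc _ ≤ 1 * ((b₁ * q) ^ (σ + 1) * (a₁ * q) ^ σ) := by gcongr
      _ ≤ A ^ (σ + 1) * A ^ σ := by
        rw [one_mul]
        have := (mul_le_mul_of_nonneg_right ha₁a hq.le).trans haA
        have := (mul_le_mul_of_nonneg_right hb₁b hq.le).trans hbA
        gcongr
      _ = A ^ (2 * σ + 1) := by ring
  have hsq : b * (2 * t ^ 2) ≤ u₀ / 4 := by
    rw [lt_div_iff₀ (by positivity)] at hq2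
    calc b * (2 * t ^ 2) ≤ b * (2 * (A ^ (2 * σ) * q) ^ 2) := by gcongr
      _ = 2 * (A ^ (4 * σ) * (b * q) * q) := by ring
      _ ≤ 2 * (A ^ (4 * σ) * A * q) := by gcongr
      _ = 2 * (q * A ^ (4 * σ + 1)) := by ring
      _ ≤ u₀ / 4 := by linarith
  have hmain : Real.exp (-(U + 3 * u₀ / 4)) ≤ (1 - t) ^ b := by
    have h1 := pow_le_pow_left₀ (Real.exp_pos _).le (exp_neg_le_one_sub ht0 ht2) b
    rw [← Real.exp_nat_mul] at h1
    exact le_trans (Real.exp_le_exp.2 (by linarith)) h1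
  have hgap : g ≤ Real.exp (-(U + 3 * u₀ / 4)) - Real.exp (-(U + u₀)) := by
    rw [neg_add, neg_add, Real.exp_add, Real.exp_add, ← mul_sub, hg]
    refine mul_le_mul_of_nonneg_right (Real.exp_le_exp.2 (by linarith)) ?_
    exact sub_nonneg.2 (Real.exp_le_exp.2 (by linarith))
  have hgoal : 1 - Real.exp (-(U + u₀)) - g / 3 ≤
      Real.exp (-(stepCost σ c u₀ a₁ b₁ + g / 3)) := by
    have e : Real.exp (-(stepCost σ c u₀ a₁ b₁ + g / 3)) =
        (1 - Real.exp (-(U + u₀))) * Real.exp (-(g / 3)) := by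
      rw [neg_add, Real.exp_add, stepCost, exp_neg_hcost (by positivity)]
    rw [e]
    have h1 := Real.one_sub_le_exp_neg (g / 3)
    have h2 := one_sub_exp_pos (show 0 < U + u₀ by positivity)
    have h3 := Real.exp_pos (-(U + u₀))
    have h4 := mul_le_mul_of_nonneg_left h1 h2.le
    have h5 := mul_nonneg h3.le hg0.le
    rw [mul_sub, mul_one] at h4
    linarith only [h4, h5]
  linarith only [hgoal, hgap, hmain, hthin, hedge]

/-- For small `q`, the boundaries of very small boxes are unlikely to be crossed. -/
lemma eventually_seed {σ : ℕ} {e₀ : ℝ} (he0 : 0 < e₀) :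
    ∃ δ₀ : ℝ, 0 < δ₀ ∧ ∀ δ, 0 < δ → δ ≤ δ₀ → ∀ᶠ q : ℝ in 𝓝[>] 0, ∀ p : ℝ, 0 ≤ p → p ≤ 1 →
      p ^ σ = q ^ (2 * σ + 1) → p ≤ q ^ 2 → ∀ (E : Finset (Sym2 (ℤ × ℤ))) (l u : ℤ × ℤ),
      hper l u ≤ 8 * ⌊δ / q⌋₊ → ∀ o, ∀ i ∈ Finset.Ico (co o l) (co o u),
        bprob E p (CrossWit σ (o, i) (Finset.Icc l u)) ≤ e₀ := by
  have hfac : (0 : ℝ) < σ.factorial := by positivity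
  have hfac1 : (1 : ℝ) ≤ σ.factorial := by exact_mod_cast σ.factorial_pos
  have hinv : (σ.factorial : ℝ)⁻¹ ≤ 1 := inv_le_one_of_one_le₀ hfac1
  refine ⟨min (1 / 8) (e₀ / 32), by positivity, fun δ hδ0 hδ => ?_⟩
  have hδb : 8 * δ ≤ 1 := by linarith [hδ.trans (min_le_left _ _)]
  have hδd : 16 * δ ≤ e₀ / 2 := by linarith [hδ.trans (min_le_right _ _)]
  filter_upwards [eventually_pos, eventually_lt_of_pos (show 0 < e₀ / 2 by positivity),
    eventually_lt_of_pos (zero_lt_one)] with q hq hq4 hq5 p hp0 hp1 hpq hpq2 E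
  have hdq : ((⌊δ / q⌋₊ : ℕ) : ℝ) * q ≤ δ := by
    have := Nat.floor_le (show 0 ≤ δ / q by positivity)
    rwa [le_div_iff₀ hq] at this
  set d := ⌊δ / q⌋₊
  -- the probabilities in terms of the rescaled sides
  have hpow : ∀ m : ℕ, (m * p) ^ σ / (σ.factorial : ℝ) =
      (σ.factorial : ℝ)⁻¹ * ((m : ℝ) ^ σ * q ^ (2 * σ + 1)) := by
    intro m
    rw [mul_pow, hpq, div_eq_inv_mul]
  intro l u hper2 o i hi
  set a := side o l u with ha
  set b := side (!o) l u with hbdef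
  have hab : a + b ≤ 8 * d := by
    rw [ha, hbdef]
    unfold hper at hper2
    cases o
    · simp only [Bool.not_false]; omega
    · simpa using hper2
  have haq : a * q ≤ 8 * δ := by
    have h1 : (a : ℝ) ≤ 8 * d := by exact_mod_cast (Nat.le_add_right a b).trans hab
    nlinarith [mul_le_mul_of_nonneg_right h1 hq.le]
  have hbq : b * q ≤ 8 * δ := by
    have h1 : (b : ℝ) ≤ 8 * d := by exact_mod_cast (Nat.le_add_left b a).trans hab
    nlinarith [mul_le_mul_of_nonneg_right h1 hq.le]
  set t := (((a * b : ℕ) : ℝ) * p) ^ σ / (σ.factorial : ℝ) with ht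
  have ht' : t = (σ.factorial : ℝ)⁻¹ * ((a * q) ^ σ * (b * q) ^ σ * q) := by
    rw [ht, hpow]; push_cast; ring
  have ht1 : t ≤ 1 := by
    rw [ht']
    refine mul_le_one₀ hinv (by positivity) (mul_le_one₀ (mul_le_one₀ (pow_le_one₀ (by positivity)
      (haq.trans hδb)) (by positivity) (pow_le_one₀ (by positivity) (hbq.trans hδb))) hq.le hq5.le)
  have hstrip : (((Finset.Icc l u).filter fun v => co o v ≤ i).card ≤ a * b ∧
      ((Finset.Icc l u).filter fun v => i + 1 ≤ co o v).card ≤ a * b) := by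
    have hleft := card_left_le (l := l) (u := u) o i
    have hright := card_right_le (l := l) (u := u) o i
    rw [Finset.mem_Ico] at hi
    refine ⟨hleft.trans (Nat.mul_le_mul ?_ le_rfl), hright.trans (Nat.mul_le_mul ?_ le_rfl)⟩
    · rw [ha]; unfold side; omega
    · rw [ha]; unfold side; omega
  refine (bprob_crossWit_le hp0 hp1 l u o i ht1 (Or.inl hstrip)).trans ?_
  rw [← hbdef, ← ht]
  have h1 : 1 - (1 - t) ^ b ≤ b * t := by
    have := one_add_mul_le_pow (show (-2 : ℝ) ≤ -t by linarith) b
    rw [← sub_eq_add_neg] at this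
    linarith
  have h2 : b * t ≤ 8 * δ := by
    rw [ht']
    calc (b : ℝ) * ((σ.factorial : ℝ)⁻¹ * ((a * q) ^ σ * (b * q) ^ σ * q))
        = (σ.factorial : ℝ)⁻¹ * ((b * q) * ((a * q) ^ σ * (b * q) ^ σ)) := by ring
      _ ≤ 1 * ((8 * δ) * (1 ^ σ * 1 ^ σ)) := by
        have := haq.trans hδb
        have := hbq.trans hδb
        gcongr
      _ = 8 * δ := by simp
  have h3 : b * p ≤ e₀ / 2 := by
    calc b * p ≤ b * q ^ 2 := by gcongr
      _ = (b * q) * q := by ring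
      _ ≤ 1 * q := by have := hbq.trans hδb; gcongr
      _ ≤ e₀ / 2 := by linarith
  linarith

/-- A box whose longer side is of the critical order is spanned with probability at most
`exp (-(2 ν - η) / q)`. -/
theorem exists_box_bound {σ : ℕ} (hσ : 1 ≤ σ) {η : ℝ} (hη : 0 < η) :
    ∃ M : ℝ, 0 < M ∧ ∀ᶠ q : ℝ in 𝓝[>] 0, ∀ p : ℝ, 0 ≤ p → p ≤ 1 →
      p ^ σ = q ^ (2 * σ + 1) → p ≤ q ^ 2 → ∀ (E : Finset (Sym2 (ℤ × ℤ))) (l u : ℤ × ℤ),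
      (∀ o, co o l ≤ co o u) → (∀ o, side o l u ≤ 2 * ⌈M / q⌉₊) → (∃ o, ⌈M / q⌉₊ ≤ side o l u) →
      bprob E p (SpEvent σ l u) ≤ Real.exp (-((2 * nu σ - η) / q)) := by
  obtain ⟨M, u₀, hM, hu, hpot⟩ := eventually_le_pot hσ hη
  obtain ⟨s₀, δ₁, hs₀, hδ₁, hcross⟩ := eventually_cross hσ hM hu
  obtain ⟨δ₂, hδ₂, hseed⟩ := eventually_seed (σ := σ) (Real.exp_pos (-(3 * hcost u₀)))
  refine ⟨M, hM, ?_⟩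
  have hH := hcost_pos hu
  set δ := min (M / 2) (min δ₁ δ₂) with hδdef
  have hδ : 0 < δ := by positivity
  have hδM : δ ≤ M / 2 := min_le_left _ _
  have hδ1 : δ ≤ δ₁ := (min_le_right _ _).trans (min_le_left _ _)
  have hδ2 : δ ≤ δ₂ := (min_le_right _ _).trans (min_le_right _ _)
  -- the entropy factors are negligible
  have hlim : Tendsto (fun q : ℝ => Real.exp s₀ * ((3 * M / q) ^ 4 * Real.exp (-(s₀ * δ / q))) +
      Real.exp (7 * hcost u₀) * ((3 * M / q) ^ 8 * Real.exp (-(hcost u₀ * δ / q))))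
      (𝓝[>] 0) (𝓝 0) := by
    have h1 := (tendsto_div_pow_mul_exp 4 (3 * M) (mul_pos hs₀ hδ)).const_mul (Real.exp s₀)
    have h2 := (tendsto_div_pow_mul_exp 8 (3 * M) (mul_pos hH hδ)).const_mul
      (Real.exp (7 * hcost u₀))
    simpa using h1.add h2
  filter_upwards [hpot, hcross δ hδ hδ1, hseed δ hδ hδ2, hlim.eventually (gt_mem_nhds zero_lt_one),
    eventually_pos, eventually_lt_of_pos (show 0 < M / 2 by positivity),
    eventually_lt_of_pos (show 0 < δ / 4 by positivity)]
    with q hpot hcross hseed hlim hq hqM hqδ p hp0 hp1 hpq hpq2 E l u hlu hK hk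
  have hc1 := hcross p hp0 hp1 hpq hpq2 E
  have hc2 := hseed p hp0 hp1 hpq hpq2 E
  have hfac : (0 : ℝ) < σ.factorial := by positivity
  set c := (σ.factorial : ℝ)⁻¹ * q ^ (2 * σ + 1) with hc
  have hX := isStepCost_stepCost (σ := σ) (show 0 ≤ c by positivity) hu
  have hX0 : stepCost σ c u₀ 0 0 = hcost u₀ := by simp [stepCost]
  have hdq : δ / q - 1 ≤ (⌊δ / q⌋₊ : ℕ) := (Nat.sub_one_lt_floor _).le
  have hdq2 : ((⌊δ / q⌋₊ : ℕ) : ℝ) ≤ δ / q := Nat.floor_le (by positivity)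
  have hd3 : 3 ≤ ⌊δ / q⌋₊ := by
    refine Nat.le_floor ?_
    rw [le_div_iff₀ hq]
    push_cast
    linarith
  set d := ⌊δ / q⌋₊
  have hKA : ((2 * ⌈M / q⌉₊ : ℕ) : ℝ) ≤ 3 * M / q := by
    have h1 : ((⌈M / q⌉₊ : ℕ) : ℝ) < M / q + 1 := Nat.ceil_lt_add_one (by positivity)
    rw [le_div_iff₀ hq]
    push_cast
    calc 2 * ((⌈M / q⌉₊ : ℕ) : ℝ) * q ≤ 2 * (M / q + 1) * q := by gcongr
      _ = 2 * M + 2 * q := by field_simp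
      _ ≤ 3 * M := by linarith
  have hcount : ((2 * ⌈M / q⌉₊ * (2 * ⌈M / q⌉₊) : ℕ) : ℝ) ^ 2 * Real.exp (-(s₀ * d)) +
      ((2 * ⌈M / q⌉₊ * (2 * ⌈M / q⌉₊) : ℕ) : ℝ) ^ 4 *
        Real.exp (-(stepCost σ c u₀ 0 0 * (d - 6))) ≤ 1 := by
    refine le_trans ?_ hlim.le
    rw [hX0]
    have h1 : ((2 * ⌈M / q⌉₊ * (2 * ⌈M / q⌉₊) : ℕ) : ℝ) ≤ (3 * M / q) ^ 2 := by
      rw [Nat.cast_mul, sq]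
      gcongr
    refine add_le_add ?_ ?_
    · calc _ ≤ ((3 * M / q) ^ 2) ^ 2 * Real.exp (s₀ + -(s₀ * δ / q)) := by
            gcongr
            have := mul_le_mul_of_nonneg_left hdq hs₀.le
            rw [mul_sub, mul_one, ← mul_div_assoc] at this
            linarith
        _ = _ := by rw [Real.exp_add]; ring
    · calc _ ≤ ((3 * M / q) ^ 2) ^ 4 * Real.exp (7 * hcost u₀ + -(hcost u₀ * δ / q)) := by
            gcongr
            have := mul_le_mul_of_nonneg_left hdq hH.le
            rw [mul_sub, mul_one, ← mul_div_assoc] at this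
            linarith
        _ = _ := by rw [Real.exp_add]; ring
  have hk' : (2 * nu σ - η) / q ≤ boxPot (stepCost σ c u₀) l u := by
    unfold boxPot
    rcases le_total (side false l u) (side true l u) with h | h
    · refine hpot _ _ (hK _) (hK _) ?_ h
      obtain ⟨o, ho⟩ := hk
      cases o
      · exact ho.trans h
      · exact ho
    · rw [pot_comm]
      refine hpot _ _ (hK _) (hK _) ?_ h
      obtain ⟨o, ho⟩ := hk
      cases o
      · exact ho
      · exact ho.trans h
  have hbig : 2 * d ≤ hper l u := by
    obtain ⟨o, ho⟩ := hk
    have h1 : 2 * d ≤ ⌈M / q⌉₊ := by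
      have h2 : (2 * d : ℝ) ≤ M / q := by
        rw [le_div_iff₀ hq]
        rw [le_div_iff₀ hq] at hdq2
        linarith
      exact_mod_cast h2.trans (Nat.le_ceil _)
    unfold hper
    cases o <;> omega
  refine (bprob_spEvent_le hX hp0 hp1 hs₀.le hd3 hc1 (by rw [hX0]; exact hc2) hcount l u hlu hK
    hbig).trans (Real.exp_le_exp.2 ?_)
  rw [hX0]
  have : 0 ≤ 2 * (d : ℝ) * hcost u₀ := by positivity
  linarith

end BoxBound

/-! ### General properties of jigsaw percolation -/

section General

variable {V : Type*} {puz ppl ppl' : SimpleGraph V} {σ τ θ : ℕ∞}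

lemma nbrCount_mono {G G' : SimpleGraph V} (hG : G ≤ G') (v : V) {S S' : Set V} (hS : S ⊆ S') :
    nbrCount G v S ≤ nbrCount G' v S' :=
  Set.encard_le_encard fun _ hw => ⟨hS hw.1, hG hw.2⟩

lemma Fits.mono {A A' B B' : Set V} (h : Fits puz ppl σ τ θ A B) (hp : ppl ≤ ppl') (hA : A ⊆ A')
    (hB : B ⊆ B') : Fits puz ppl' σ τ θ A' B' := by
  obtain ⟨v, hv, w, hw, h1, h2⟩ | ⟨v, hv, h⟩ | ⟨v, hv, h1, h2⟩ := h
  · exact Or.inl ⟨v, hA hv, w, hB hw, hp h1, h2⟩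
  · exact Or.inr (Or.inl ⟨v, hA hv, h.trans (nbrCount_mono le_rfl v hB)⟩)
  · exact Or.inr (Or.inr ⟨v, hA hv, h1.trans (nbrCount_mono hp v hB),
      h2.trans (nbrCount_mono le_rfl v hB)⟩)

lemma block_mk (r : Setoid V) (x : V) : block r (Quotient.mk r x) = {v | r v x} := by
  ext v
  exact Quotient.eq (r := r)

lemma le_step (r : Setoid V) : r ≤ step puz ppl σ τ θ r := by
  intro x y h
  have : Quotient.mk r x = Quotient.mk r y := Quotient.sound h
  change (clusterGraph puz ppl σ τ θ r).Reachable (Quotient.mk r x) (Quotient.mk r y)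
  rw [this]

lemma step_rel_of_fits {r : Setoid V} {x y : V}
    (h : Fits puz ppl σ τ θ {v | r v x} {v | r v y}) : step puz ppl σ τ θ r x y := by
  change (clusterGraph puz ppl σ τ θ r).Reachable (Quotient.mk r x) (Quotient.mk r y)
  by_cases hxy : Quotient.mk r x = Quotient.mk r y
  · rw [hxy]
  · refine SimpleGraph.Adj.reachable ?_
    rw [clusterGraph, SimpleGraph.fromRel_adj]
    refine ⟨hxy, Or.inl ?_⟩
    rwa [block_mk, block_mk]

/-- A step of jigsaw percolation yields the finest partition in which the clusters that fit together
are merged. -/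
lemma step_le {r s : Setoid V} (hr : r ≤ s)
    (h : ∀ x y, Fits puz ppl σ τ θ {v | r v x} {v | r v y} → s x y) :
    step puz ppl σ τ θ r ≤ s := by
  have key : ∀ q q' : Quotient r, (clusterGraph puz ppl σ τ θ r).Reachable q q' →
      ∀ x y, Quotient.mk r x = q → Quotient.mk r y = q' → s x y := by
    rintro q q' ⟨w⟩
    induction w with
    | nil =>
      intro x y hx hy
      exact hr (Quotient.exact (hx.trans hy.symm))
    | @cons a b c hadj w ih =>
      intro x y hx hy
      obtain ⟨z, rfl⟩ := Quotient.exists_rep b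
      refine s.trans ?_ (ih z y rfl hy)
      subst hx
      rw [clusterGraph, SimpleGraph.fromRel_adj, block_mk, block_mk] at hadj
      rcases hadj.2 with h' | h'
      · exact h _ _ h'
      · exact s.symm (h _ _ h')
  intro x y hxy
  exact key _ _ hxy x y rfl rfl

lemma step_mono {r r' : Setoid V} (hp : ppl ≤ ppl') (hr : r ≤ r') :
    step puz ppl σ τ θ r ≤ step puz ppl' σ τ θ r' :=
  step_le (hr.trans (le_step r')) fun _ _ h =>
    step_rel_of_fits (h.mono hp (fun _ hv => hr hv) (fun _ hv => hr hv))

lemma partitionAt_succ (t : ℕ) : partitionAt puz ppl σ τ θ (t + 1) =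
    step puz ppl σ τ θ (partitionAt puz ppl σ τ θ t) :=
  Function.iterate_succ_apply' _ _ _

lemma partitionAt_mono (hp : ppl ≤ ppl') (t : ℕ) :
    partitionAt puz ppl σ τ θ t ≤ partitionAt puz ppl' σ τ θ t := by
  induction t with
  | zero => exact le_rfl
  | succ t ih =>
    rw [partitionAt_succ, partitionAt_succ]
    exact step_mono hp ih

lemma Solve.mono (hp : ppl ≤ ppl') (h : Solve puz ppl σ τ θ) : Solve puz ppl' σ τ θ := by
  obtain ⟨t, ht⟩ := h
  exact ⟨t, top_le_iff.1 (ht ▸ partitionAt_mono hp t)⟩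

/-- On a finite set, the final partition has no two distinct clusters that fit together. -/
lemma exists_stable [Finite V] (puz ppl : SimpleGraph V) (σ τ θ : ℕ∞) :
    ∃ t, ∀ x y, Fits puz ppl σ τ θ {v | partitionAt puz ppl σ τ θ t v x}
      {v | partitionAt puz ppl σ τ θ t v y} → partitionAt puz ppl σ τ θ t x y := by
  have hfin : Finite (Setoid V) :=
    Finite.of_injective (fun r : Setoid V => (r : V → V → Prop)) fun r s h => Setoid.ext fun x y =>
      iff_of_eq (congrFun (congrFun h x) y)
  have hmono : Monotone (partitionAt puz ppl σ τ θ) := monotone_nat_of_le_succ fun t => by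
    rw [partitionAt_succ]
    exact le_step _
  obtain ⟨t, ht⟩ := WellFoundedGT.monotone_chain_condition ⟨_, hmono⟩
  refine ⟨t, fun x y h => ?_⟩
  have h1 : partitionAt puz ppl σ τ θ t = partitionAt puz ppl σ τ θ (t + 1) := ht (t + 1) (by omega)
  have h2 := step_rel_of_fits h
  rw [← partitionAt_succ, ← h1] at h2
  exact h2

/-- The internally solved sets of a puzzle: those that can be assembled from singletons, merging two
disjoint internally solved sets at a time. -/
inductive IntSolved (puz ppl : SimpleGraph V) (σ τ θ : ℕ∞) : Set V → Prop
  | single (v : V) : IntSolved puz ppl σ τ θ {v}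
  | merge (A B : Set V) (hA : IntSolved puz ppl σ τ θ A) (hB : IntSolved puz ppl σ τ θ B)
      (hd : Disjoint A B) (hf : Fits puz ppl σ τ θ A B) : IntSolved puz ppl σ τ θ (A ∪ B)

/-- The clusters that are merged at a time step can be merged one by one: a largest internally solved
union of such clusters contains them all. -/
lemma intSolved_step [Finite V] {r : Setoid V}
    (h : ∀ x, IntSolved puz ppl σ τ θ {v | r v x}) (x : V) :
    IntSolved puz ppl σ τ θ {v | step puz ppl σ τ θ r v x} := by
  set s := step puz ppl σ τ θ r with hs
  set F : Set (Set V) := {U | IntSolved puz ppl σ τ θ U ∧ x ∈ U ∧ (∀ y ∈ U, ∀ z, r z y → z ∈ U) ∧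
    ∀ y ∈ U, s y x} with hF
  have hne : F.Nonempty := ⟨{v | r v x}, h x, r.refl x, fun y hy z hz => r.trans hz hy,
    fun y hy => le_step r hy⟩
  obtain ⟨U, ⟨hU, hxU, hsat, hsub⟩, hmax⟩ := F.toFinite.exists_maximal hne
  -- no cluster outside `U` fits with a cluster in `U`
  have hout : ∀ y z, y ∈ U → z ∉ U → IntSolved puz ppl σ τ θ (U ∪ {v | r v z}) → s z y → False := by
    intro y z hy hz hI hsz
    have hmem : U ∪ {v | r v z} ∈ F := by
      refine ⟨hI, Or.inl hxU, ?_, ?_⟩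
      · rintro a (ha | ha) b hb
        · exact Or.inl (hsat a ha b hb)
        · exact Or.inr (r.trans hb ha)
      · rintro a (ha | ha)
        · exact hsub a ha
        · exact s.trans (le_step r ha) (s.trans hsz (hsub y hy))
    exact hz (hmax hmem Set.subset_union_left (Or.inr (r.refl z)))
  have hdisj : ∀ z, z ∉ U → Disjoint U {v | r v z} := by
    intro z hz
    rw [Set.disjoint_left]
    exact fun a ha ha' => hz (hsat a ha z (r.symm ha'))
  have hblock : ∀ y, y ∈ U → {v | r v y} ⊆ U := fun y hy z hz => hsat y hy z hz
  have hle : s ≤ Setoid.comap (· ∈ U) ⊥ := by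
    refine step_le (fun y z hyz => ?_) fun y z hf => ?_
    · exact propext ⟨fun hy => hsat y hy z (r.symm hyz), fun hz => hsat z hz y hyz⟩
    · refine propext ⟨fun hy => ?_, fun hz => ?_⟩
      · by_contra hz
        refine hout y z hy hz (IntSolved.merge _ _ hU (h z) (hdisj z hz)
          (hf.mono le_rfl (hblock y hy) subset_rfl)) (s.symm (step_rel_of_fits hf))
      · by_contra hy
        refine hout z y hz hy ?_ (step_rel_of_fits hf)
        rw [Set.union_comm]
        exact IntSolved.merge _ _ (h y) hU (hdisj y hy).symm (hf.mono le_rfl subset_rfl (hblock z hz))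
  have : {v | s v x} = U := by
    refine Set.Subset.antisymm (fun v hv => ?_) hsub
    have := hle hv
    exact (iff_of_eq this).2 hxU
  rwa [this]

lemma Solve.intSolved_univ [Finite V] [Nonempty V] (h : Solve puz ppl σ τ θ) :
    IntSolved puz ppl σ τ θ univ := by
  obtain ⟨t, ht⟩ := h
  have key : ∀ t x, IntSolved puz ppl σ τ θ {v | partitionAt puz ppl σ τ θ t v x} := by
    intro t
    induction t with
    | zero =>
      intro x
      have : {v | partitionAt puz ppl σ τ θ 0 v x} = {x} := by
        ext v; rfl
      rw [this]
      exact IntSolved.single x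
    | succ t ih =>
      intro x
      rw [partitionAt_succ]
      exact intSolved_step ih x
  have h1 := key t (Classical.arbitrary V)
  rw [ht] at h1
  have : {v : V | (⊤ : Setoid V) v (Classical.arbitrary V)} = univ := by
    ext v; exact ⟨fun _ => trivial, fun _ => trivial⟩
  rwa [this] at h1

lemma solve_top [Finite V] (hc : puz.Connected) : Solve puz ⊤ σ τ θ := by
  obtain ⟨t, ht⟩ := exists_stable puz ⊤ σ τ θ
  set r := partitionAt puz ⊤ σ τ θ t with hr
  refine ⟨t, ?_⟩
  have hadj : ∀ x y, puz.Adj x y → r x y := fun x y hxy =>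
    ht x y (Or.inl ⟨x, r.refl x, y, r.refl y, hxy.ne, hxy⟩)
  ext x y
  refine ⟨fun _ => trivial, fun _ => ?_⟩
  obtain ⟨w⟩ := hc.preconnected x y
  induction w with
  | nil => exact r.refl _
  | cons hadj' w ih => exact r.trans (hadj _ _ hadj') (ih trivial)

lemma not_solve_bot [Nontrivial V] (hσ : 1 ≤ σ) (hθ : 2 ≤ θ) : ¬ Solve puz ⊥ σ τ θ := by
  have hstep : step puz ⊥ σ τ θ ⊥ = ⊥ := by
    refine le_bot_iff.1 (step_le le_rfl fun x y h => ?_)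
    have h0 : {v : V | (⊥ : Setoid V) v y} = {y} := by ext v; rfl
    rw [h0] at h
    obtain ⟨v, _, w, _, h, _⟩ | ⟨v, _, h⟩ | ⟨v, _, h, _⟩ := h
    · exact absurd h (by simp)
    · have h1 : nbrCount puz v {y} ≤ 1 := by
        refine (Set.encard_le_encard (fun w hw => hw.1)).trans (Set.encard_singleton y).le
      exact absurd (hθ.trans (h.trans h1)) (by decide)
    · have h1 : nbrCount (⊥ : SimpleGraph V) v {y} = 0 := by
        simp [nbrCount]
      rw [h1] at h
      exact absurd (hσ.trans h) (by decide)
  have hbot : ∀ t, partitionAt puz ⊥ σ τ θ t = ⊥ := by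
    intro t
    induction t with
    | zero => rfl
    | succ t ih => rw [partitionAt_succ, ih, hstep]
  rintro ⟨t, ht⟩
  rw [hbot] at ht
  obtain ⟨x, y, hxy⟩ := exists_pair_ne V
  have : (⊥ : Setoid V) x y := by rw [ht]; trivial
  exact hxy this

end General

/-! ### The solving probability -/

section SolveProb

variable {V : Type*} [Fintype V]

open Classical in
/-- The possible edges of a graph on a finite set. -/
def allEdges (V : Type*) [Fintype V] : Finset (Sym2 V) := Finset.univ.filter fun e => ¬ e.IsDiag

lemma mem_allEdges {e : Sym2 V} : e ∈ allEdges V ↔ ¬ e.IsDiag := by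
  simp [allEdges]

lemma card_allEdges : (allEdges V).card = (Nat.card V).choose 2 := by
  classical
  rw [Nat.card_eq_fintype_card, ← Sym2.card_subtype_not_diag, Fintype.card_subtype]
  rfl

lemma binomialRandom_real_eq (p : unitInterval) (Q : SimpleGraph V → Prop) :
    (SimpleGraph.binomialRandom V p).real {G | Q G} =
      bprob (allEdges V) p fun S => Q (SimpleGraph.fromEdgeSet (S : Set (Sym2 V))) := by
  classical
  have h1 : {G : SimpleGraph V | Q G} =
      ((Finset.univ.filter Q : Finset (SimpleGraph V)) : Set (SimpleGraph V)) := by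
    ext; simp
  have : MeasurableSingletonClass (SimpleGraph V) := by
    refine ⟨fun G => ?_⟩
    have h2 : ({G} : Set (SimpleGraph V)) = SimpleGraph.edgeSet ⁻¹' {G.edgeSet} := by
      ext; simp
    rw [h2]
    exact SimpleGraph.measurableEmbedding_edgeSet.measurable (measurableSet_singleton _)
  rw [h1, ← sum_measureReal_singleton, bprob, ← Finset.sum_filter]
  symm
  refine Finset.sum_bij' (fun S _ => SimpleGraph.fromEdgeSet (S : Set (Sym2 V)))
    (fun G _ => G.edgeFinset) ?_ ?_ ?_ ?_ ?_
  · intro S hS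
    simpa using (Finset.mem_filter.1 hS).2
  · intro G hG
    rw [Finset.mem_filter, Finset.mem_powerset]
    refine ⟨fun e he => mem_allEdges.2 (G.not_isDiag_of_mem_edgeFinset he), ?_⟩
    simpa using (Finset.mem_filter.1 hG).2
  · intro S hS
    have hS' := Finset.mem_powerset.1 (Finset.mem_filter.1 hS).1
    ext e
    simp only [SimpleGraph.mem_edgeFinset, SimpleGraph.edgeSet_fromEdgeSet, Set.mem_sdiff,
      Finset.mem_coe]
    exact ⟨fun h => h.1, fun h => ⟨h, mem_allEdges.1 (hS' h)⟩⟩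
  · intro G hG
    simp
  · intro S hS
    have hS' := Finset.mem_powerset.1 (Finset.mem_filter.1 hS).1
    have he : (SimpleGraph.fromEdgeSet (S : Set (Sym2 V))).edgeSet = S := by
      ext e
      simp only [SimpleGraph.edgeSet_fromEdgeSet, Set.mem_sdiff, Finset.mem_coe]
      exact ⟨fun h => h.1, fun h => ⟨h, mem_allEdges.1 (hS' h)⟩⟩
    rw [measureReal_def, SimpleGraph.binomialRandom_singleton, he, Set.ncard_coe_finset,
      card_allEdges]
    simp [ENNReal.toReal_mul]

end SolveProb

/-! ### The square lattice as a covering of the torus -/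

section Cover

/-- The projection of the integers to the vertices of the cycle of length `m + 2`. -/
def cproj (m : ℕ) (x : ℤ) : Fin (m + 2) := ((x : ZMod (m + 2)) : ZMod (m + 2))

/-- The projection of the square lattice to the torus of side length `m + 2`. -/
def tproj (m : ℕ) (v : ℤ × ℤ) : Fin (m + 2) × Fin (m + 2) := (cproj m v.1, cproj m v.2)

variable {m : ℕ}

lemma cproj_eq_iff {x y : ℤ} : cproj m x = cproj m y ↔ ((m + 2 : ℕ) : ℤ) ∣ x - y := by
  unfold cproj
  exact eq_comm.trans ((ZMod.intCast_eq_intCast_iff y x (m + 2)).trans Int.modEq_iff_dvd)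

lemma cproj_surjective : Function.Surjective (cproj m) := ZMod.intCast_surjective (n := m + 2)

lemma cycle_adj_cproj_iff {x : ℤ} {b : Fin (m + 2)} :
    (SimpleGraph.cycleGraph (m + 2)).Adj (cproj m x) b ↔ cproj m (x - 1) = b ∨ cproj m (x + 1) = b := by
  rw [SimpleGraph.cycleGraph_adj]
  have h1 : cproj m (x - 1) = cproj m x - 1 := by
    change ((x - 1 : ℤ) : ZMod (m + 2)) = (x : ZMod (m + 2)) - 1
    push_cast; rfl
  have h2 : cproj m (x + 1) = cproj m x + 1 := by
    change ((x + 1 : ℤ) : ZMod (m + 2)) = (x : ZMod (m + 2)) + 1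
    push_cast; rfl
  rw [h1, h2]
  refine or_congr ?_ ?_
  · exact ⟨fun h => by rw [← h, sub_sub_cancel], fun h => by rw [← h, sub_sub_cancel]⟩
  · exact ⟨fun h => by rw [← h, add_sub_cancel], fun h => by rw [← h, add_sub_cancel_left]⟩

lemma tproj_eq_iff {u w : ℤ × ℤ} :
    tproj m u = tproj m w ↔ ∀ o, ((m + 2 : ℕ) : ℤ) ∣ co o u - co o w := by
  rw [Bool.forall_bool, tproj, tproj, Prod.mk.injEq, cproj_eq_iff, cproj_eq_iff, and_comm]
  rfl

lemma tproj_surjective : Function.Surjective (tproj m) := by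
  rintro ⟨a, b⟩
  obtain ⟨x, rfl⟩ := cproj_surjective a
  obtain ⟨y, rfl⟩ := cproj_surjective b
  exact ⟨(x, y), rfl⟩

lemma torus_adj_tproj_iff {u : ℤ × ℤ} {a : Fin (m + 2) × Fin (m + 2)} :
    (torus (m + 2)).Adj (tproj m u) a ↔ ∃ w, GAdj u w ∧ tproj m w = a := by
  obtain ⟨a, b⟩ := a
  rw [torus, SimpleGraph.boxProd_adj]
  simp only [tproj, cycle_adj_cproj_iff]
  constructor
  · rintro (⟨h | h, h'⟩ | ⟨h | h, h'⟩)
    · exact ⟨(u.1 - 1, u.2), by unfold GAdj; simp, by rw [← h, ← h']⟩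
    · exact ⟨(u.1 + 1, u.2), by unfold GAdj; simp, by rw [← h, ← h']⟩
    · exact ⟨(u.1, u.2 - 1), by unfold GAdj; simp, by rw [← h, ← h']⟩
    · exact ⟨(u.1, u.2 + 1), by unfold GAdj; simp, by rw [← h, ← h']⟩
  · rintro ⟨⟨x, y⟩, h, h'⟩
    rw [Prod.mk.injEq] at h'
    obtain ⟨rfl, rfl⟩ := h'
    obtain ⟨h1, h2 | h2⟩ | ⟨h1, h2 | h2⟩ := h <;> simp only at h1 h2
    · exact Or.inr ⟨Or.inl (by congr 1; omega), by rw [h1]⟩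
    · exact Or.inr ⟨Or.inr (by congr 1; omega), by rw [h1]⟩
    · exact Or.inl ⟨Or.inl (by congr 1; omega), by rw [h1]⟩
    · exact Or.inl ⟨Or.inr (by congr 1; omega), by rw [h1]⟩

lemma GAdj.torus_adj {u w : ℤ × ℤ} (h : GAdj u w) : (torus (m + 2)).Adj (tproj m u) (tproj m w) :=
  torus_adj_tproj_iff.2 ⟨w, h, rfl⟩

lemma GAdj.abs_le {u w : ℤ × ℤ} (h : GAdj u w) (o : Bool) :
    co o u - co o w ≤ 1 ∧ co o w - co o u ≤ 1 := by
  unfold GAdj at h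
  cases o <;> simp only [co_true, co_false] <;> omega

@[simp] lemma co_add (o : Bool) (u w : ℤ × ℤ) : co o (u + w) = co o u + co o w := by cases o <;> rfl
@[simp] lemma co_sub (o : Bool) (u w : ℤ × ℤ) : co o (u - w) = co o u - co o w := by cases o <;> rfl

lemma co_ext {u w : ℤ × ℤ} (h : ∀ o, co o u = co o w) : u = w := Prod.ext (h true) (h false)

/-- Two points of the lattice with the same projection are equal, if they are close. -/
lemma eq_of_tproj_eq {u w : ℤ × ℤ} (h : tproj m u = tproj m w)
    (hs : ∀ o, co o u - co o w < (m + 2 : ℕ) ∧ co o w - co o u < (m + 2 : ℕ)) : u = w := by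
  refine co_ext fun o => ?_
  have h1 := Int.eq_zero_of_abs_lt_dvd (tproj_eq_iff.1 h o) (abs_lt.2 ⟨by linarith [hs o], (hs o).1⟩)
  linarith

/-- The set `W` is contained in a square of side length `k`. -/
def Small (k : ℕ) (W : Finset (ℤ × ℤ)) : Prop := ∀ u ∈ W, ∀ w ∈ W, ∀ o, co o u - co o w < k

variable {G : SimpleGraph (Fin (m + 2) × Fin (m + 2))} {σ k : ℕ}

/-- The people relation of the torus, pulled back to the lattice. -/
def pullRel (m : ℕ) (G : SimpleGraph (Fin (m + 2) × Fin (m + 2))) (u w : ℤ × ℤ) : Prop :=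
  G.Adj (tproj m u) (tproj m w)

lemma GAdj.add_right {u w : ℤ × ℤ} (h : GAdj u w) (z : ℤ × ℤ) : GAdj (u + z) (w + z) := by
  unfold GAdj at *
  simp only [Prod.fst_add, Prod.snd_add]
  omega

lemma tproj_add_sub {x x' : ℤ × ℤ} (h : tproj m x' = tproj m x) (v : ℤ × ℤ) :
    tproj m (v + (x' - x)) = tproj m v := by
  rw [tproj_eq_iff] at h ⊢
  intro o
  simpa using h o

/-- If two lifts project to sets that fit together, then a translate of the second one fits with the
first one in the lattice. -/
lemma exists_translate_fits {W₁ W₂ : Finset (ℤ × ℤ)} (hk : k + 1 < m + 2) (hs : Small k W₂)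
    (hf : Fits (torus (m + 2)) G σ 1 2 (tproj m '' W₁) (tproj m '' W₂)) :
    ∃ z, (∀ v, tproj m (v + z) = tproj m v) ∧
      GFits (pullRel m G) σ W₁ (W₂.image (· + z)) := by
  classical
  obtain ⟨_, ⟨u, hu, rfl⟩, _, ⟨x, hx, rfl⟩, h1, h2⟩ | ⟨_, ⟨u, hu, rfl⟩, h⟩ |
    ⟨_, ⟨u, hu, rfl⟩, h1, h2⟩ := hf
  · obtain ⟨x', hx', he⟩ := torus_adj_tproj_iff.1 h2
    refine ⟨x' - x, tproj_add_sub he, Or.inl ⟨u, hu, x', Finset.mem_image.2 ⟨x, hx, by abel⟩, hx', ?_⟩⟩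
    unfold pullRel
    rwa [he]
  · obtain ⟨a, b, ⟨⟨x, hx, rfl⟩, ha⟩, ⟨⟨y, hy, rfl⟩, hb⟩, hab⟩ :=
      Set.one_lt_encard_iff.1 ((by decide : (1 : ℕ∞) < 2).trans_le h)
    obtain ⟨x', hx', hex⟩ := torus_adj_tproj_iff.1 ha
    obtain ⟨y', hy', hey⟩ := torus_adj_tproj_iff.1 hb
    have hyy : y + (x' - x) = y' := by
      refine eq_of_tproj_eq (m := m) ((tproj_add_sub hex y).trans hey.symm) fun o => ?_
      have h1 := hs x hx y hy o
      have h2 := hs y hy x hx o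
      have h3 := hx'.abs_le o
      have h4 := hy'.abs_le o
      rw [co_add, co_sub]
      omega
    refine ⟨x' - x, tproj_add_sub hex, Or.inr (Or.inl ⟨u, hu, x',
      Finset.mem_image.2 ⟨x, hx, by abel⟩, y', Finset.mem_image.2 ⟨y, hy, hyy⟩, ?_, hx', hy'⟩)⟩
    rintro rfl
    exact hab (hex.symm.trans hey)
  · obtain ⟨_, ⟨x, hx, rfl⟩, ha⟩ := Set.one_le_encard_iff_nonempty.1 h2
    obtain ⟨x', hx', hex⟩ := torus_adj_tproj_iff.1 ha
    refine ⟨x' - x, tproj_add_sub hex, Or.inr (Or.inr ⟨u, hu, ?_, x',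
      Finset.mem_image.2 ⟨x, hx, by abel⟩, hx'⟩)⟩
    set N := nbrs (pullRel m G) u (W₂.image (· + (x' - x))) with hN
    have h3 : {w ∈ tproj m '' (W₂ : Set (ℤ × ℤ)) | G.Adj (tproj m u) w} ⊆
        ((N.image (tproj m) : Finset _) : Set (Fin (m + 2) × Fin (m + 2))) := by
      rintro _ ⟨⟨y, hy, rfl⟩, hadj⟩
      rw [Finset.coe_image]
      refine ⟨y + (x' - x), ?_, tproj_add_sub hex y⟩
      rw [hN, Finset.mem_coe, mem_nbrs]
      refine ⟨Finset.mem_image_of_mem _ hy, ?_⟩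
      unfold pullRel
      rwa [tproj_add_sub hex]
    have h4 := h1.trans (Set.encard_le_encard h3)
    rw [Set.encard_coe_eq_coe_finsetCard] at h4
    exact (by exact_mod_cast h4 : σ ≤ (N.image (tproj m)).card).trans Finset.card_image_le

lemma IS.translate {W : Finset (ℤ × ℤ)} (h : IS (pullRel m G) σ W) {z : ℤ × ℤ}
    (hz : ∀ v, tproj m (v + z) = tproj m v) : IS (pullRel m G) σ (W.image (· + z)) :=
  h.image (add_left_injective z) (fun _ _ h => h.add_right z) fun u _ w _ h => by
    unfold pullRel at *
    rwa [hz, hz]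

/-- An internally solved set of the torus either has an internally solved lift of small extent, or
the lattice has an internally solved set whose extent is of a given order. -/
lemma IntSolved.exists_lift (hk : 1 ≤ k) (hkm : k + 1 < m + 2)
    {U : Set (Fin (m + 2) × Fin (m + 2))}
    (h : IntSolved (torus (m + 2)) G σ 1 2 U) :
    (∃ W : Finset (ℤ × ℤ), IS (pullRel m G) σ W ∧ tproj m '' W = U ∧ Small k W) ∨
    ∃ W : Finset (ℤ × ℤ), IS (pullRel m G) σ W ∧ ¬ Small k W ∧ Small (2 * k) W := by
  induction h with
  | single v =>
    obtain ⟨u, rfl⟩ := tproj_surjective (m := m) v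
    refine Or.inl ⟨{u}, IS.single u, by simp, ?_⟩
    intro x hx y hy o
    rw [Finset.mem_singleton] at hx hy
    rw [hx, hy, sub_self]
    omega
  | merge A B hA hB hd hf ihA ihB =>
    obtain ⟨W₁, hW₁, rfl, hs₁⟩ | h := ihA
    swap
    · exact Or.inr h
    obtain ⟨W₂, hW₂, rfl, hs₂⟩ | h := ihB
    swap
    · exact Or.inr h
    obtain ⟨z, hz, hfit⟩ := exists_translate_fits hkm hs₂ hf
    set W₃ := W₂.image (· + z) with hW₃
    have himg : tproj m '' W₃ = tproj m '' W₂ := by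
      rw [hW₃, Finset.coe_image, Set.image_image]
      simp only [hz]
    have hs₃ : Small k W₃ := by
      intro x hx y hy o
      obtain ⟨x', hx', rfl⟩ := Finset.mem_image.1 hx
      obtain ⟨y', hy', rfl⟩ := Finset.mem_image.1 hy
      have := hs₂ x' hx' y' hy' o
      simp only [co_add]
      omega
    have hdis : Disjoint W₁ W₃ := by
      rw [Finset.disjoint_left]
      intro x hx hx'
      refine Set.disjoint_left.1 hd (Set.mem_image_of_mem _ hx) ?_
      rw [← himg]
      exact Set.mem_image_of_mem _ hx'
    have hIS := IS.merge W₁ W₃ hW₁ (hW₂.translate hz) hdis hfit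
    by_cases hsm : Small k (W₁ ∪ W₃)
    · refine Or.inl ⟨_, hIS, ?_, hsm⟩
      rw [Finset.coe_union, Set.image_union, himg]
    · refine Or.inr ⟨_, hIS, hsm, ?_⟩
      obtain ⟨a, ha, b, hb, hab⟩ := hfit.exists_adj
      intro x hx y hy o
      have h0 := hab.abs_le o
      push_cast
      rcases Finset.mem_union.1 hx with hx | hx <;> rcases Finset.mem_union.1 hy with hy | hy
      · have := hs₁ x hx y hy o
        omega
      · have h1 := hs₁ x hx a ha o
        have h2 := hs₃ b hb y hy o
        omega
      · have h1 := hs₃ x hx b hb o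
        have h2 := hs₁ a ha y hy o
        omega
      · have := hs₃ x hx y hy o
        omega

lemma not_small_of_image_eq_univ {W : Finset (ℤ × ℤ)} (hkm : k < m + 2)
    (h : tproj m '' (W : Set (ℤ × ℤ)) = univ) : ¬ Small k W := by
  intro hs
  have hne : W.Nonempty := by
    obtain ⟨x, hx, _⟩ := (h ▸ Set.mem_univ (tproj m 0) : tproj m 0 ∈ tproj m '' (W : Set (ℤ × ℤ)))
    exact ⟨x, hx⟩
  obtain ⟨u, hu, hmin⟩ := Finset.exists_min_image W (co true) hne
  obtain ⟨w, hw, he⟩ :=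
    (h ▸ Set.mem_univ _ : tproj m (u + ((k : ℤ), 0)) ∈ tproj m '' (W : Set (ℤ × ℤ)))
  have h1 := tproj_eq_iff.1 he true
  have h2 := hs w hw u hu true
  have h3 := hmin w hw
  rw [co_add, co_true, co_true, co_true] at h1
  rw [co_true, co_true] at h2 h3
  have h4 := Int.eq_zero_of_abs_lt_dvd h1 (abs_lt.2 ⟨by push_cast; omega, by push_cast; omega⟩)
  omega

/-- If the torus puzzle is solved, then an internally solved set of the lattice spans a box of given
order, with its lower left corner in the fundamental domain. -/
lemma exists_spans_of_solve (hk : 1 ≤ k) (hkm : k + 1 < m + 2)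
    (h : Solve (torus (m + 2)) G σ 1 2) :
    ∃ W l u, IS (pullRel m G) σ W ∧ Spans l u W ∧ (∀ o, 0 ≤ co o l ∧ co o l < (m + 2 : ℕ)) ∧
      (∀ o, co o l ≤ co o u ∧ co o u - co o l < 2 * k) ∧ ∃ o, k ≤ co o u - co o l := by
  have h1 : ∃ W : Finset (ℤ × ℤ), IS (pullRel m G) σ W ∧ ¬ Small k W ∧ Small (2 * k) W := by
    obtain ⟨W, hW, himg, hs⟩ | h := h.intSolved_univ.exists_lift hk hkm
    · exact absurd hs (not_small_of_image_eq_univ (by omega) himg)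
    · exact h
  obtain ⟨W, hW, hs, hs2⟩ := h1
  obtain ⟨l, u, hlu⟩ := exists_spans hW.nonempty
  set n : ℤ := ((m + 2 : ℕ) : ℤ) with hn
  have hn0 : 0 < n := by omega
  set z : ℤ × ℤ := (-(n * (l.1 / n)), -(n * (l.2 / n))) with hz
  have hzdvd : ∀ o, n ∣ co o z := by
    intro o
    cases o
    · exact (dvd_mul_right _ _).neg_right
    · exact (dvd_mul_right _ _).neg_right
  refine ⟨W.image (· + z), l + z, u + z, hW.translate fun v => ?_, ⟨?_, fun o => ⟨?_, ?_⟩⟩,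
    fun o => ?_, fun o => ?_, ?_⟩
  · rw [tproj_eq_iff]
    intro o
    rw [co_add, add_sub_cancel_left]
    exact hzdvd o
  · intro v hv o
    obtain ⟨v', hv', rfl⟩ := Finset.mem_image.1 hv
    have := hlu.1 v' hv' o
    simp only [co_add]
    omega
  · obtain ⟨v, hv, hvl⟩ := (hlu.2 o).1
    exact ⟨v + z, Finset.mem_image_of_mem _ hv, by simp [hvl]⟩
  · obtain ⟨v, hv, hvl⟩ := (hlu.2 o).2
    exact ⟨v + z, Finset.mem_image_of_mem _ hv, by simp [hvl]⟩
  · have h1 : ∀ x : ℤ, x + -(n * (x / n)) = x % n := fun x => by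
      rw [Int.emod_def]; ring
    cases o
    · rw [co_add, co_false, co_false, hz, h1]
      exact ⟨Int.emod_nonneg _ hn0.ne', Int.emod_lt_of_pos _ hn0⟩
    · rw [co_add, co_true, co_true, hz, h1]
      exact ⟨Int.emod_nonneg _ hn0.ne', Int.emod_lt_of_pos _ hn0⟩
  · obtain ⟨⟨v, hv, hvl⟩, w, hw, hwu⟩ := hlu.2 o
    have h1 := hs2 w hw v hv o
    have h2 := hlu.1 v hv o
    simp only [co_add]
    push_cast at h1
    omega
  · unfold Small at hs
    push Not at hs
    obtain ⟨a, ha, b, hb, o, hab⟩ := hs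
    refine ⟨o, ?_⟩
    have h1 := hlu.1 a ha o
    have h2 := hlu.1 b hb o
    simp only [co_add]
    omega

end Cover

/-! ### Upper bound for the solving probability -/

section Transfer

lemma bprob_comap {α β : Type*} [DecidableEq α] [DecidableEq β] {E : Finset α} {F : Finset β} (p : ℝ)
    {f : α → β} (hf : InjOn f E) (hF : E.image f ⊆ F) (Q : Finset α → Prop) :
    bprob F p (fun S => Q (E.filter fun e => f e ∈ S)) = bprob E p Q := by
  have h1 := bprob_inter p hF (fun S => Q (E.filter fun e => f e ∈ S))
  rw [bprob_image p hf] at h1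
  refine Eq.trans (bprob_congr fun S _ => ?_) (h1.trans (bprob_congr fun S hS => ?_))
  · have : (E.filter fun e => f e ∈ S) = E.filter fun e => f e ∈ S ∩ E.image f := by
      refine Finset.filter_congr fun e he => ?_
      rw [Finset.mem_inter]
      exact ⟨fun h => ⟨h, Finset.mem_image_of_mem f he⟩, fun h => h.1⟩
    rw [this]
  · have : (E.filter fun e => f e ∈ S.image f) = S := by
      ext e
      rw [Finset.mem_filter, Finset.mem_image]
      refine ⟨?_, fun h => ⟨hS h, e, h, rfl⟩⟩
      rintro ⟨he, e', he', hee⟩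
      rwa [← hf (hS he') he hee]
    rw [this]

open Classical in
/-- The possible edges between the points of a finite subset of the lattice. -/
def edgesIn (B : Finset (ℤ × ℤ)) : Finset (Sym2 (ℤ × ℤ)) := B.sym2.filter fun e => ¬ e.IsDiag

lemma mk_mem_edgesIn {B : Finset (ℤ × ℤ)} {u w : ℤ × ℤ} :
    s(u, w) ∈ edgesIn B ↔ u ∈ B ∧ w ∈ B ∧ u ≠ w := by
  simp [edgesIn, and_assoc]

variable {m : ℕ}

lemma injOn_tproj {B : Finset (ℤ × ℤ)} (hB : Small (m + 2) B) : InjOn (tproj m) B :=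
  fun _ hu _ hw h => eq_of_tproj_eq h fun o => ⟨hB _ hu _ hw o, hB _ hw _ hu o⟩

lemma injOn_map_tproj {B : Finset (ℤ × ℤ)} (hB : Small (m + 2) B) :
    InjOn (Sym2.map (tproj m)) (edgesIn B) := by
  have hi := injOn_tproj hB
  intro e he e' he' h
  induction e with | _ a b
  induction e' with | _ c d
  obtain ⟨ha, hb, _⟩ := mk_mem_edgesIn.1 he
  obtain ⟨hc, hd, _⟩ := mk_mem_edgesIn.1 he'
  rw [Sym2.map_mk, Sym2.map_mk, Sym2.eq_iff] at h
  rw [Sym2.eq_iff]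
  rcases h with ⟨h1, h2⟩ | ⟨h1, h2⟩
  · exact Or.inl ⟨hi ha hc h1, hi hb hd h2⟩
  · exact Or.inr ⟨hi ha hd h1, hi hb hc h2⟩

open Classical in
lemma image_edgesIn_subset {B : Finset (ℤ × ℤ)} (hB : Small (m + 2) B) :
    (edgesIn B).image (Sym2.map (tproj m)) ⊆ allEdges (Fin (m + 2) × Fin (m + 2)) := by
  intro e he
  obtain ⟨e', he', rfl⟩ := Finset.mem_image.1 he
  induction e' with | _ a b
  obtain ⟨ha, hb, hab⟩ := mk_mem_edgesIn.1 he'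
  rw [mem_allEdges, Sym2.map_mk, Sym2.mk_isDiag_iff]
  exact fun h => hab (injOn_tproj hB ha hb h)

lemma small_Icc {l u : ℤ × ℤ} {k : ℕ} (h : ∀ o, co o u - co o l < k) : Small k (Finset.Icc l u) := by
  intro x hx y hy o
  have := co_mem_Icc hx o
  have := co_mem_Icc hy o
  have := h o
  omega

lemma solveProb_eq (σ : ℕ) (n : ℕ) (p : unitInterval) :
    solveProb σ 1 2 n p = bprob (allEdges (Fin n × Fin n)) p fun S =>
      Solve (torus n) (SimpleGraph.fromEdgeSet (S : Set (Sym2 (Fin n × Fin n)))) σ 1 2 :=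
  binomialRandom_real_eq p _

/-- The solving probability is at most the expected number of boxes of a given order that are spanned
by an internally solved set. -/
lemma solveProb_le {σ k : ℕ} (hk : 1 ≤ k) (hkm : 2 * k < m + 2) (p : unitInterval) {B : ℝ}
    (hB : ∀ (E : Finset (Sym2 (ℤ × ℤ))) (l u : ℤ × ℤ), (∀ o, co o l ≤ co o u) →
      (∀ o, side o l u ≤ 2 * k) → (∃ o, k ≤ side o l u) → bprob E p (SpEvent σ l u) ≤ B) :
    solveProb σ 1 2 (m + 2) p ≤ ((m + 2 : ℕ) : ℝ) ^ 2 * (2 * k : ℕ) ^ 2 * B := by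
  classical
  obtain ⟨h0, h1⟩ := p.2
  rw [solveProb_eq]
  set lo : (ℕ × ℕ) × ℕ × ℕ → ℤ × ℤ := fun i => (i.1.1, i.1.2)
  set hi : (ℕ × ℕ) × ℕ × ℕ → ℤ × ℤ := fun i => ((i.1.1 + i.2.1 : ℕ), (i.1.2 + i.2.2 : ℕ))
  set I := ((Finset.range (m + 2) ×ˢ Finset.range (m + 2)) ×ˢ
    (Finset.range (2 * k) ×ˢ Finset.range (2 * k))) with hI
  set J := I.filter fun i => ∃ o, k ≤ side o (lo i) (hi i) with hJ
  set Q : (ℕ × ℕ) × ℕ × ℕ → Finset (Sym2 (Fin (m + 2) × Fin (m + 2))) → Prop := fun i S =>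
    SpEvent σ (lo i) (hi i)
      ((edgesIn (Finset.Icc (lo i) (hi i))).filter fun e => Sym2.map (tproj m) e ∈ S) with hQ
  have hstep : ∀ S ⊆ allEdges (Fin (m + 2) × Fin (m + 2)),
      Solve (torus (m + 2)) (SimpleGraph.fromEdgeSet (S : Set (Sym2 (Fin (m + 2) × Fin (m + 2)))))
        σ 1 2 → ∃ i ∈ J, Q i S := by
    intro S _ hS
    obtain ⟨W, l, u, hW, hsp, hl, hu, o, ho⟩ := exists_spans_of_solve hk (by omega) hS
    have hl1 := hl true; have hl2 := hl false
    have hu1 := hu true; have hu2 := hu false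
    simp only [co_true, co_false] at hl1 hl2 hu1 hu2
    set i : (ℕ × ℕ) × ℕ × ℕ :=
      ((l.1.toNat, l.2.toNat), ((u.1 - l.1).toNat, (u.2 - l.2).toNat)) with hi'
    have hlo : lo i = l := Prod.ext (by simp only [lo, i]; omega) (by simp only [lo, i]; omega)
    have hhi : hi i = u := Prod.ext (by simp only [hi, i]; omega) (by simp only [hi, i]; omega)
    refine ⟨i, ?_, ?_⟩
    · rw [hJ, Finset.mem_filter, hlo, hhi]
      refine ⟨?_, o, by unfold side; omega⟩
      simp only [hI, i, Finset.mem_product, Finset.mem_range]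
      omega
    · simp only [hQ]
      rw [hlo, hhi]
      refine ⟨W, hW.congr fun x hx y hy hxy => ?_, hsp⟩
      unfold edgeRel
      rw [Finset.mem_filter, mk_mem_edgesIn, Sym2.map_mk]
      refine ⟨⟨hsp.mem_Icc hx, hsp.mem_Icc hy, ?_⟩, ?_⟩
      · rintro rfl
        exact hxy.ne rfl
      · exact ((SimpleGraph.fromEdgeSet_adj _).1 hxy).1
  refine (bprob_mono h0 h1 hstep).trans ((bprob_exists_le h0 h1 J Q).trans ?_)
  have hterm : ∀ i ∈ J, bprob (allEdges (Fin (m + 2) × Fin (m + 2))) p (Q i) ≤ B := by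
    intro i hi'
    obtain ⟨hiI, ho⟩ := Finset.mem_filter.1 hi'
    simp only [hI, Finset.mem_product, Finset.mem_range] at hiI
    have hside : ∀ o, co o (lo i) ≤ co o (hi i) ∧ co o (hi i) - co o (lo i) < (2 * k : ℕ) := by
      intro o
      cases o <;> simp only [lo, hi, co_true, co_false] <;> omega
    have hsm : Small (m + 2) (Finset.Icc (lo i) (hi i)) :=
      small_Icc fun o => (hside o).2.trans (by omega)
    simp only [hQ]
    rw [bprob_comap (p : ℝ) (injOn_map_tproj hsm) (image_edgesIn_subset hsm)]
    refine hB _ _ _ (fun o => (hside o).1) (fun o => ?_) ho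
    have := (hside o).2
    unfold side
    omega
  have hB0 : J.Nonempty → 0 ≤ B := fun ⟨i, hi'⟩ => (bprob_nonneg h0 h1 _).trans (hterm i hi')
  refine (Finset.sum_le_card_nsmul J _ B hterm).trans ?_
  rw [nsmul_eq_mul]
  rcases J.eq_empty_or_nonempty with h | h
  · have hB1 : 0 ≤ B := by
      refine (bprob_nonneg h0 h1 _).trans (hB ∅ 0 ((k : ℤ), 0) (fun o => ?_) (fun o => ?_) ⟨true, ?_⟩)
      · cases o <;> simp
      · cases o <;> simp [side] <;> omega
      · simp [side]
    rw [h, Finset.card_empty, Nat.cast_zero, zero_mul]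
    positivity
  · refine mul_le_mul_of_nonneg_right ?_ (hB0 h)
    have hc : J.card ≤ (m + 2) ^ 2 * (2 * k) ^ 2 := by
      refine (Finset.card_filter_le _ _).trans (le_of_eq ?_)
      rw [hI, Finset.card_product, Finset.card_product, Finset.card_product, Finset.card_range,
        Finset.card_range]
      ring
    exact_mod_cast hc

end Transfer

/-! ### Existence and uniqueness of the critical probability -/

section Critical

variable {σ n : ℕ}

lemma monotone_solve_fromEdgeSet {V : Type*} (puz : SimpleGraph V) (σ τ θ : ℕ∞) :
    Monotone fun S : Finset (Sym2 V) =>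
      Solve puz (SimpleGraph.fromEdgeSet (S : Set (Sym2 V))) σ τ θ :=
  fun _ _ h hS => hS.mono (SimpleGraph.fromEdgeSet_mono (Finset.coe_subset.2 h))

lemma solveProb_mono (σ n : ℕ) : Monotone (solveProb σ 1 2 n) := by
  classical
  intro p p' h
  rw [solveProb_eq, solveProb_eq]
  exact (bprob_sub_ge p.2.1 h p'.2.2 (monotone_solve_fromEdgeSet _ _ _ _)).1

lemma solveProb_le_one (σ n : ℕ) (p : unitInterval) : solveProb σ 1 2 n p ≤ 1 := by
  rw [solveProb_eq]
  exact bprob_le_one p.2.1 p.2.2 _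

lemma solveProb_nonneg (σ n : ℕ) (p : unitInterval) : 0 ≤ solveProb σ 1 2 n p := by
  rw [solveProb_eq]
  exact bprob_nonneg p.2.1 p.2.2 _

lemma continuous_solveProb (σ n : ℕ) : Continuous (solveProb σ 1 2 n) := by
  have : solveProb σ 1 2 n = (fun p : ℝ => bprob (allEdges (Fin n × Fin n)) p fun S =>
      Solve (torus n) (SimpleGraph.fromEdgeSet (S : Set (Sym2 (Fin n × Fin n)))) σ 1 2) ∘
        (Subtype.val : unitInterval → ℝ) := by
    funext p
    exact solveProb_eq σ n p
  rw [this]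
  exact (continuous_bprob _ _).comp continuous_subtype_val

lemma fromEdgeSet_allEdges {V : Type*} [Fintype V] :
    SimpleGraph.fromEdgeSet (allEdges V : Set (Sym2 V)) = ⊤ := by
  ext u w
  simp [mem_allEdges]

lemma torus_connected (hn : 2 ≤ n) : (torus n).Connected := by
  obtain ⟨m, rfl⟩ := Nat.exists_eq_add_of_le' hn
  exact (SimpleGraph.cycleGraph_connected (n := m + 1)).boxProd
    (SimpleGraph.cycleGraph_connected (n := m + 1))

lemma not_solve_empty (hσ : 1 ≤ σ) (hn : 2 ≤ n) : ¬ Solve (torus n)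
    (SimpleGraph.fromEdgeSet ((∅ : Finset (Sym2 (Fin n × Fin n))) : Set (Sym2 (Fin n × Fin n))))
      σ 1 2 := by
  have : Fact (1 < n) := ⟨hn⟩
  have : Nontrivial (Fin n) := Fin.nontrivial_iff_two_le.2 hn
  rw [Finset.coe_empty, SimpleGraph.fromEdgeSet_empty]
  exact not_solve_bot (by exact_mod_cast hσ) le_rfl

lemma existsUnique_isCriticalProb (hσ : 1 ≤ σ) (hn : 2 ≤ n) :
    ∃! p : unitInterval, IsCriticalProb σ 1 2 n p := by
  classical
  set E := allEdges (Fin n × Fin n) with hE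
  set Q : Finset (Sym2 (Fin n × Fin n)) → Prop := fun S =>
    Solve (torus n) (SimpleGraph.fromEdgeSet (S : Set (Sym2 (Fin n × Fin n)))) σ 1 2 with hQ
  have hQ0 : ¬ Q ∅ := not_solve_empty hσ hn
  have hQ1 : Q E := by
    simp only [hQ, hE]
    rw [fromEdgeSet_allEdges]
    exact solve_top (torus_connected hn)
  have hmono : Monotone Q := monotone_solve_fromEdgeSet _ _ _ _
  have h01 := (bprob_sub_ge (E := E) le_rfl zero_le_one le_rfl hmono).2 hQ0 hQ1
  have h0 := bprob_nonneg (E := E) (p := 0) le_rfl zero_le_one Q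
  have h1 := bprob_le_one (E := E) (p := 1) zero_le_one le_rfl Q
  rw [sub_zero, one_pow] at h01
  have hstrict : StrictMono (solveProb σ 1 2 n) := by
    intro p p' hp
    have hp' : (p : ℝ) < p' := hp
    have := (bprob_sub_ge (E := E) p.2.1 hp'.le p'.2.2 hmono).2 hQ0 hQ1
    have h3 : 0 < ((p' : ℝ) - p) ^ E.card := pow_pos (by linarith) _
    rw [solveProb_eq, solveProb_eq]
    linarith
  have hle : solveProb σ 1 2 n 0 ≤ 1 / 2 := by
    rw [solveProb_eq]
    change bprob E 0 Q ≤ _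
    linarith
  have hge : 1 / 2 ≤ solveProb σ 1 2 n 1 := by
    rw [solveProb_eq]
    change _ ≤ bprob E 1 Q
    linarith
  obtain ⟨p, hp⟩ := mem_range_of_exists_le_of_exists_ge (continuous_solveProb σ n) ⟨0, hle⟩ ⟨1, hge⟩
  exact ⟨p, hp, fun p' hp' => hstrict.injective (hp'.trans hp.symm)⟩

end Critical

/-! ### The subcritical regime -/

section Subcritical

lemma tendsto_div_log {a : ℝ} (ha : 0 < a) :
    Tendsto (fun n : ℕ => a / Real.log n) atTop (𝓝[>] 0) := by
  rw [tendsto_nhdsWithin_iff]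
  refine ⟨(Real.tendsto_log_atTop.comp tendsto_natCast_atTop_atTop).const_div_atTop a, ?_⟩
  filter_upwards [eventually_ge_atTop 2] with n hn
  exact div_pos ha (Real.log_pos (by exact_mod_cast hn))

lemma rpow_exponent {σ : ℕ} (hσ : 1 ≤ σ) {q : ℝ} (hq : 0 < q) :
    (q ^ ((2 : ℝ) + 1 / σ)) ^ σ = q ^ (2 * σ + 1) := by
  have hσ' : (σ : ℝ) ≠ 0 := by positivity
  rw [← Real.rpow_natCast, ← Real.rpow_mul hq.le, ← Real.rpow_natCast q]
  congr 1
  push_cast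
  field_simp

lemma rpow_exponent_le {σ : ℕ} {q : ℝ} (hq : 0 < q) (hq1 : q ≤ 1) :
    q ^ ((2 : ℝ) + 1 / σ) ≤ q ^ 2 := by
  rw [← Real.rpow_natCast q 2]
  exact Real.rpow_le_rpow_of_exponent_ge hq hq1 (by simp)

/-- The subcritical regime, in the scaling `p = q ^ (2 + 1 / σ)` with `q = a / log n`: the `n ^ 2`
positions of a spanned box of critical order contribute the factor `exp (2 a / q)` to the union
bound, which is beaten by the probability `exp (-2 ν / q)` of a single box when `a < ν`. -/
theorem tendsto_solveProb_zero {σ : ℕ} (hσ : 1 ≤ σ) {a : ℝ} (ha : 0 < a) (hν : a < nu σ) :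
    Tendsto (fun n : ℕ => solveProb σ 1 2 n
      (projIcc 0 1 zero_le_one ((a / Real.log n) ^ ((2 : ℝ) + 1 / σ)))) atTop (𝓝 0) := by
  obtain ⟨M, hM, hbox⟩ := exists_box_bound hσ (show 0 < nu σ - a by linarith)
  have hlim := tendsto_div_pow_mul_exp 2 (3 * M) (show 0 < nu σ - a by linarith)
  have hlim1 := tendsto_div_pow_mul_exp 1 (3 * M) ha
  refine squeeze_zero' (.of_forall fun n => solveProb_nonneg σ n _) ?_
    (hlim.comp (tendsto_div_log ha))
  have hev := hbox.and ((hlim1.eventually (gt_mem_nhds zero_lt_one)).and (eventually_pos.and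
    ((eventually_lt_of_pos zero_lt_one).and (eventually_lt_of_pos (show 0 < M / 2 by positivity)))))
  filter_upwards [(tendsto_div_log ha).eventually hev, eventually_ge_atTop 2] with n hn hn2
  obtain ⟨hbox, h1, hq, hq1, hqM⟩ := hn
  have hlog : 0 < Real.log n := Real.log_pos (by exact_mod_cast hn2)
  set q := a / Real.log n with hqdef
  have hnq : (n : ℝ) = Real.exp (a / q) := by
    rw [hqdef, div_div_cancel₀ ha.ne', Real.exp_log]
    positivity
  set p := q ^ ((2 : ℝ) + 1 / σ) with hp
  have hp0 : 0 ≤ p := Real.rpow_nonneg hq.le _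
  have hpq2 : p ≤ q ^ 2 := rpow_exponent_le hq hq1.le
  have hp1 : p ≤ 1 := hpq2.trans (pow_le_one₀ hq.le hq1.le)
  have hproj : ((projIcc 0 1 zero_le_one p : unitInterval) : ℝ) = p := by
    rw [projIcc_of_mem _ ⟨hp0, hp1⟩]
  have hk3 : ((2 * ⌈M / q⌉₊ : ℕ) : ℝ) ≤ 3 * M / q := by
    have h1 : ((⌈M / q⌉₊ : ℕ) : ℝ) < M / q + 1 := Nat.ceil_lt_add_one (by positivity)
    rw [le_div_iff₀ hq]
    push_cast
    calc 2 * ((⌈M / q⌉₊ : ℕ) : ℝ) * q ≤ 2 * (M / q + 1) * q := by gcongr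
      _ = 2 * M + 2 * q := by field_simp
      _ ≤ 3 * M := by linarith
  have hkn : 2 * ⌈M / q⌉₊ < n := by
    have h2 : 3 * M / q < n := by
      rw [hnq]
      rw [pow_one, Real.exp_neg, ← div_eq_mul_inv, div_lt_one (Real.exp_pos _)] at h1
      exact h1
    exact_mod_cast hk3.trans_lt h2
  have hk1 : 1 ≤ ⌈M / q⌉₊ := Nat.ceil_pos.2 (by positivity)
  obtain ⟨m, rfl⟩ := Nat.exists_eq_add_of_le' hn2
  have hB : ∀ (E : Finset (Sym2 (ℤ × ℤ))) (l u : ℤ × ℤ), (∀ o, co o l ≤ co o u) →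
      (∀ o, side o l u ≤ 2 * ⌈M / q⌉₊) → (∃ o, ⌈M / q⌉₊ ≤ side o l u) →
      bprob E (projIcc 0 1 zero_le_one p : unitInterval) (SpEvent σ l u) ≤
        Real.exp (-((2 * nu σ - (nu σ - a)) / q)) := by
    rw [hproj]
    exact hbox p hp0 hp1 (rpow_exponent hσ hq) hpq2
  refine (solveProb_le hk1 hkn _ hB).trans ?_
  simp only [Function.comp]
  calc _ ≤ ((m + 2 : ℕ) : ℝ) ^ 2 * (3 * M / q) ^ 2 *
        Real.exp (-((2 * nu σ - (nu σ - a)) / q)) := by gcongr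
    _ = (3 * M / q) ^ 2 * (Real.exp (a / q) * Real.exp (a / q) *
        Real.exp (-((2 * nu σ - (nu σ - a)) / q))) := by rw [hnq]; ring
    _ = _ := by
      rw [← Real.exp_add, ← Real.exp_add]
      congr 2
      ring

end Subcritical

/-! ### Growth of a nucleus -/

section Growth

/-- The square of side length `k` with lower left corner `x`. -/
def sq (x : ℤ × ℤ) (k : ℕ) : Finset (ℤ × ℤ) := Finset.Icc x (x + ((k : ℤ) - 1, (k : ℤ) - 1))

/-- The point whose coordinate in the direction `o` is `a`, and whose other coordinate is `b`. -/
def pt (o : Bool) (a b : ℤ) : ℤ × ℤ := cond o (a, b) (b, a)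

/-- The points next to the square `sq x k`, after it in the direction `o`. -/
def bline (o : Bool) (x : ℤ × ℤ) (k : ℕ) : Finset (ℤ × ℤ) :=
  (Finset.range k).image fun j : ℕ => x + pt o k j

/-- Some vertex next to the square, in the direction `o`, has `σ` people neighbors in the square. -/
def GrowRel (P : ℤ × ℤ → ℤ × ℤ → Prop) (σ : ℕ) (o : Bool) (x : ℤ × ℤ) (k : ℕ) : Prop :=
  ∃ v ∈ bline o x k, σ ≤ (nbrs P v (sq x k)).card

/-- The lattice edges on the two lower sides of the square `sq x m` are people edges. -/
def SeedRel (P : ℤ × ℤ → ℤ × ℤ → Prop) (m : ℕ) (x : ℤ × ℤ) : Prop :=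
  ∀ k ∈ Finset.Ico 1 m, ∀ o, P (x + pt o k 0) (x + pt o (k - 1) 0)

lemma mem_sq {x v : ℤ × ℤ} {k : ℕ} :
    v ∈ sq x k ↔ ∀ o, co o x ≤ co o v ∧ co o v < co o x + k := by
  rw [sq, Finset.mem_Icc, Prod.le_def, Prod.le_def, Bool.forall_bool]
  simp only [Prod.fst_add, Prod.snd_add, co_true, co_false]
  omega

lemma co_pt_self (o : Bool) (a b : ℤ) : co o (pt o a b) = a := by cases o <;> rfl
lemma co_pt_not (o : Bool) (a b : ℤ) : co (!o) (pt o a b) = b := by cases o <;> rfl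

lemma add_pt_mem_sq {x : ℤ × ℤ} {k : ℕ} {o : Bool} {a b : ℤ} :
    x + pt o a b ∈ sq x k ↔ (0 ≤ a ∧ a < k) ∧ 0 ≤ b ∧ b < k := by
  rw [mem_sq, Bool.forall_bool]
  cases o <;> simp [pt, co]
  omega

lemma eq_add_pt (o : Bool) (x v : ℤ × ℤ) : v = x + pt o (co o v - co o x) (co (!o) v - co (!o) x) := by
  refine co_ext fun o' => ?_
  cases o <;> cases o' <;> simp [pt]

lemma sq_mono {x : ℤ × ℤ} {j k : ℕ} (h : j ≤ k) : sq x j ⊆ sq x k := by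
  intro v hv
  rw [mem_sq] at hv ⊢
  intro o
  have := hv o
  omega

lemma bline_subset_sq (o : Bool) (x : ℤ × ℤ) (k : ℕ) : bline o x k ⊆ sq x (k + 1) := by
  intro v hv
  obtain ⟨j, hj, rfl⟩ := Finset.mem_image.1 hv
  rw [Finset.mem_range] at hj
  rw [add_pt_mem_sq]
  push_cast
  omega

lemma disjoint_bline_sq (o : Bool) (x : ℤ × ℤ) (k : ℕ) : Disjoint (bline o x k) (sq x k) := by
  rw [Finset.disjoint_left]
  intro v hv hv'
  obtain ⟨j, hj, rfl⟩ := Finset.mem_image.1 hv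
  rw [add_pt_mem_sq] at hv'
  omega

lemma card_bline (o : Bool) (x : ℤ × ℤ) (k : ℕ) : (bline o x k).card = k := by
  rw [bline, Finset.card_image_of_injective, Finset.card_range]
  intro i j h
  have := congrArg (co (!o)) h
  simpa [co_pt_not] using this

lemma card_sq (x : ℤ × ℤ) (k : ℕ) : (sq x k).card = k ^ 2 := by
  rw [sq, ← Finset.Icc_product_Icc, Finset.card_product, Int.card_Icc, Int.card_Icc]
  simp only [Prod.fst_add, Prod.snd_add]
  rw [_root_.sq]
  congr 1 <;> omega

lemma small_sq {x : ℤ × ℤ} {k n : ℕ} (h : k ≤ n) : Small n (sq x k) := by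
  intro u hu w hw o
  have := mem_sq.1 hu o
  have := mem_sq.1 hw o
  omega

variable {m : ℕ} {G : SimpleGraph (Fin (m + 2) × Fin (m + 2))} {σ : ℕ}
  {r : Setoid (Fin (m + 2) × Fin (m + 2))}

/-- No two distinct clusters of the partition `r` fit together. -/
def Stable (G : SimpleGraph (Fin (m + 2) × Fin (m + 2))) (σ : ℕ)
    (r : Setoid (Fin (m + 2) × Fin (m + 2))) : Prop :=
  ∀ x y, Fits (torus (m + 2)) G σ 1 2 {v | r v x} {v | r v y} → r x y

lemma tproj_ne {a b : ℤ × ℤ} (o : Bool) (h : co o a - co o b = 1) : tproj m a ≠ tproj m b := by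
  intro he
  have := tproj_eq_iff.1 he o
  rw [h] at this
  have := Int.le_of_dvd one_pos this
  omega

variable {c : Fin (m + 2) × Fin (m + 2)}

lemma Stable.rel_of_edge (hr : Stable G σ r) {v w : ℤ × ℤ} (hvw : GAdj v w) (hP : pullRel m G v w)
    (hw : r (tproj m w) c) : r (tproj m v) c :=
  r.trans (hr _ _ (Or.inl ⟨_, r.refl _, _, r.refl _, hP, hvw.torus_adj⟩)) hw

lemma Stable.rel_of_two (hr : Stable G σ r) {v a b : ℤ × ℤ} (ha : GAdj v a) (hb : GAdj v b)
    (hab : tproj m a ≠ tproj m b) (hac : r (tproj m a) c) (hbc : r (tproj m b) c) :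
    r (tproj m v) c := by
  refine hr _ _ (Or.inr (Or.inl ⟨_, r.refl _, ?_⟩))
  have h1 : ({tproj m a, tproj m b} : Set (Fin (m + 2) × Fin (m + 2))) ⊆
      {w ∈ {v | r v c} | (torus (m + 2)).Adj (tproj m v) w} := by
    rintro w (rfl | rfl)
    · exact ⟨hac, ha.torus_adj⟩
    · exact ⟨hbc, hb.torus_adj⟩
  have h2 := Set.encard_le_encard h1
  rwa [Set.encard_pair hab] at h2

lemma Stable.rel_of_star (hr : Stable G σ r) {B : Finset (ℤ × ℤ)} (hB : Small (m + 2) B)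
    (hBc : ∀ w ∈ B, r (tproj m w) c) {v w : ℤ × ℤ} (hw : w ∈ B) (hvw : GAdj v w)
    (hc : σ ≤ (nbrs (pullRel m G) v B).card) : r (tproj m v) c := by
  classical
  refine hr _ _ (Or.inr (Or.inr ⟨_, r.refl _, ?_, ?_⟩))
  · have h1 : (((nbrs (pullRel m G) v B).image (tproj m) : Finset _) :
        Set (Fin (m + 2) × Fin (m + 2))) ⊆ {w ∈ {v | r v c} | G.Adj (tproj m v) w} := by
      intro y hy
      obtain ⟨x, hx, rfl⟩ := Finset.mem_image.1 (Finset.mem_coe.1 hy)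
      obtain ⟨hxB, hx⟩ := mem_nbrs.1 hx
      exact ⟨hBc x hxB, hx⟩
    have h2 := Set.encard_le_encard h1
    rw [Set.encard_coe_eq_coe_finsetCard, Finset.card_image_of_injOn
      ((injOn_tproj hB).mono fun x hx => (mem_nbrs.1 hx).1)] at h2
    exact le_trans (by exact_mod_cast hc) h2
  · exact Set.one_le_encard_iff_nonempty.2 ⟨_, hBc w hw, hvw.torus_adj⟩

/-- If a cluster contains a square and a point of the next line, then it contains the next line. -/
lemma Stable.line (hr : Stable G σ r) {x : ℤ × ℤ} {k : ℕ} (hsq : ∀ v ∈ sq x k, r (tproj m v) c)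
    {o : Bool} {v : ℤ × ℤ} (hv : v ∈ bline o x k) (hvc : r (tproj m v) c) :
    ∀ j : ℤ, 0 ≤ j → j < k → r (tproj m (x + pt o k j)) c := by
  obtain ⟨i, hi, rfl⟩ := Finset.mem_image.1 hv
  rw [Finset.mem_range] at hi
  have hin : ∀ j : ℤ, 0 ≤ j → j < k → r (tproj m (x + pt o (k - 1) j)) c := fun j h0 h1 =>
    hsq _ (add_pt_mem_sq.2 ⟨⟨by omega, by omega⟩, h0, h1⟩)
  have hadj : ∀ j : ℤ, GAdj (x + pt o k j) (x + pt o (k - 1) j) := by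
    intro j; cases o <;> simp [GAdj, pt] <;> omega
  have hadj' : ∀ j : ℤ, GAdj (x + pt o k j) (x + pt o k (j + 1)) := by
    intro j; cases o <;> simp [GAdj, pt] <;> omega
  have hne : ∀ j j' : ℤ, tproj m (x + pt o k j) ≠ tproj m (x + pt o (k - 1) j') := by
    intro j j'
    refine tproj_ne o ?_
    rw [co_add, co_add, co_pt_self, co_pt_self]
    omega
  have hup : ∀ d : ℕ, (i : ℤ) + d < k → r (tproj m (x + pt o k (i + d))) c := by
    intro d
    induction d with
    | zero => intro _; simpa using hvc
    | succ d ih =>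
      intro hd
      push_cast at hd ⊢
      refine hr.rel_of_two (a := x + pt o k (i + d)) ?_ (hadj _) (hne _ _) (ih (by omega))
        (hin _ (by omega) (by omega))
      rw [← add_assoc]
      exact (hadj' _).symm
  have hdown : ∀ d : ℕ, 0 ≤ (i : ℤ) - d → r (tproj m (x + pt o k (i - d))) c := by
    intro d
    induction d with
    | zero => intro _; simpa using hvc
    | succ d ih =>
      intro hd
      push_cast at hd ⊢
      refine hr.rel_of_two (a := x + pt o k (i - d)) ?_ (hadj _) (hne _ _) (ih (by omega))
        (hin _ (by omega) (by omega))
      have := hadj' (i - (d + 1))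
      rwa [show (i : ℤ) - (d + 1) + 1 = i - d by ring] at this
  intro j h0 h1
  rcases le_total (i : ℤ) j with h | h
  · have := hup (j - i).toNat (by omega)
    rwa [show (i : ℤ) + ((j - i).toNat : ℕ) = j by omega] at this
  · have := hdown (i - j).toNat (by omega)
    rwa [show (i : ℤ) - ((i - j).toNat : ℕ) = j by omega] at this

/-- If a cluster contains a square, and a point next to it in both directions, then it contains the
next larger square. -/
lemma Stable.sq_succ (hr : Stable G σ r) {x : ℤ × ℤ} {k : ℕ} (hk : 1 ≤ k)
    (hsq : ∀ v ∈ sq x k, r (tproj m v) c)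
    (hl : ∀ o, ∃ v ∈ bline o x k, r (tproj m v) c) : ∀ v ∈ sq x (k + 1), r (tproj m v) c := by
  have hline : ∀ o, ∀ j : ℤ, 0 ≤ j → j < k → r (tproj m (x + pt o k j)) c := by
    intro o
    obtain ⟨v, hv, hvc⟩ := hl o
    exact hr.line hsq hv hvc
  intro v hv
  rw [eq_add_pt true x v] at hv ⊢
  set a := co true v - co true x
  set b := co (!true) v - co (!true) x
  rw [add_pt_mem_sq] at hv
  push_cast at hv
  by_cases ha : a < k
  · by_cases hb : b < k
    · exact hsq _ (add_pt_mem_sq.2 (by omega))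
    · have hb' : b = k := by omega
      have := hline false a (by omega) ha
      rw [hb']
      exact this
  · have ha' : a = k := by omega
    rw [ha']
    by_cases hb : b < k
    · exact hline true b (by omega) hb
    · have hb' : b = k := by omega
      rw [hb']
      refine hr.rel_of_two (a := x + pt true k (k - 1)) (b := x + pt false k (k - 1)) ?_ ?_ ?_
        (hline true _ (by omega) (by omega)) (hline false _ (by omega) (by omega))
      · simp [GAdj, pt]
        omega
      · simp [GAdj, pt]
        omega
      · refine tproj_ne true ?_
        simp [pt]

lemma Stable.sq_succ_of_grow (hr : Stable G σ r) {x : ℤ × ℤ} {k : ℕ} (hk : 1 ≤ k) (hkm : k ≤ m + 2)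
    (hsq : ∀ v ∈ sq x k, r (tproj m v) c) (hg : ∀ o, GrowRel (pullRel m G) σ o x k) :
    ∀ v ∈ sq x (k + 1), r (tproj m v) c := by
  refine hr.sq_succ hk hsq fun o => ?_
  obtain ⟨v, hv, hc⟩ := hg o
  refine ⟨v, hv, ?_⟩
  obtain ⟨j, hj, rfl⟩ := Finset.mem_image.1 hv
  rw [Finset.mem_range] at hj
  refine hr.rel_of_star (small_sq hkm) hsq (w := x + pt o (k - 1) j)
    (add_pt_mem_sq.2 (by omega)) ?_ hc
  cases o <;> simp [GAdj, pt] <;> omega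

/-- A nucleus, which grows to a square of side length `L`, solves the puzzle if every square of side
length `L` grows further. -/
theorem solve_of_nucleus {m₀ L : ℕ} (hm₀ : 1 ≤ m₀) (hmL : m₀ ≤ L) (hL : L ≤ m + 2) {x : ℤ × ℤ}
    (hseed : SeedRel (pullRel m G) m₀ x)
    (hgrow : ∀ k ∈ Finset.Ico m₀ L, ∀ o, GrowRel (pullRel m G) σ o x k)
    (hall : ∀ y o, GrowRel (pullRel m G) σ o y L) : Solve (torus (m + 2)) G σ 1 2 := by
  obtain ⟨t, ht⟩ := exists_stable (torus (m + 2)) G σ 1 2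
  refine ⟨t, ?_⟩
  set r := partitionAt (torus (m + 2)) G σ 1 2 t
  have hr : Stable G σ r := ht
  set c := tproj m x with hc
  -- the seed
  have h1 : ∀ k : ℕ, 1 ≤ k → k ≤ m₀ → ∀ v ∈ sq x k, r (tproj m v) c := by
    intro k hk
    induction k, hk using Nat.le_induction with
    | base =>
      intro _ v hv
      have : v = x := by
        rw [mem_sq] at hv
        refine co_ext fun o => ?_
        have := hv o
        push_cast at this
        omega
      rw [this]
    | succ k hk ih =>
      intro hkm
      have ih := ih (by omega)
      refine hr.sq_succ hk ih fun o => ⟨x + pt o k 0, ?_, ?_⟩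
      · exact Finset.mem_image.2 ⟨0, Finset.mem_range.2 hk, by simp⟩
      · refine hr.rel_of_edge (w := x + pt o (k - 1) 0) ?_
          (hseed k (Finset.mem_Ico.2 ⟨hk, by omega⟩) o) (ih _ (add_pt_mem_sq.2 (by omega)))
        cases o <;> simp [GAdj, pt] <;> omega
  -- the nucleus
  have h2 : ∀ k : ℕ, m₀ ≤ k → k ≤ L → ∀ v ∈ sq x k, r (tproj m v) c := by
    intro k hk
    induction k, hk using Nat.le_induction with
    | base => exact fun _ => h1 m₀ hm₀ le_rfl
    | succ k hk ih =>
      intro hkL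
      exact hr.sq_succ_of_grow (hm₀.trans hk) (by omega) (ih (by omega))
        (hgrow k (Finset.mem_Ico.2 ⟨hk, by omega⟩))
  -- translates of the square of side length `L`
  have h3 : ∀ (o : Bool) (y : ℤ × ℤ), (∀ v ∈ sq y L, r (tproj m v) c) →
      ∀ v ∈ sq (y + pt o 1 0) L, r (tproj m v) c := by
    intro o y hy v hv
    refine hr.sq_succ_of_grow (hm₀.trans hmL) hL hy (hall y) v ?_
    rw [mem_sq, Bool.forall_bool] at hv ⊢
    simp only [co_add] at hv
    cases o <;> simp [pt] at hv ⊢ <;> omega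
  have h4 : ∀ i j : ℕ, ∀ v ∈ sq (x + ((i : ℤ), (j : ℤ))) L, r (tproj m v) c := by
    intro i j
    induction i with
    | zero =>
      induction j with
      | zero =>
        have : x + (((0 : ℕ) : ℤ), ((0 : ℕ) : ℤ)) = x := by ext <;> simp
        rw [this]
        exact h2 L hmL le_rfl
      | succ j ih =>
        have := h3 false _ ih
        have e : x + (((0 : ℕ) : ℤ), (j : ℤ)) + pt false 1 0 = x + (((0 : ℕ) : ℤ), ((j + 1 : ℕ) : ℤ)) := by
          ext <;> simp [pt, add_assoc]
        rwa [e] at this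
    | succ i ih =>
      have := h3 true _ ih
      have e : x + ((i : ℤ), (j : ℤ)) + pt true 1 0 = x + (((i + 1 : ℕ) : ℤ), (j : ℤ)) := by
        ext <;> simp [pt, add_assoc]
      rwa [e] at this
  have h5 : ∀ a, r a c := by
    intro a
    obtain ⟨v, rfl⟩ := tproj_surjective a
    set n : ℤ := ((m + 2 : ℕ) : ℤ) with hn
    have hn0 : 0 < n := by omega
    have h6 := h4 ((v.1 - x.1) % n).toNat ((v.2 - x.2) % n).toNat _
      (mem_sq.2 fun o => ⟨le_rfl, by have := hm₀.trans hmL; omega⟩)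
    have h7 := Int.emod_nonneg (v.1 - x.1) hn0.ne'
    have h8 := Int.emod_nonneg (v.2 - x.2) hn0.ne'
    rw [Int.toNat_of_nonneg h7, Int.toNat_of_nonneg h8] at h6
    have h9 : tproj m (x + ((v.1 - x.1) % n, (v.2 - x.2) % n)) = tproj m v := by
      rw [tproj_eq_iff]
      have key : ∀ a b : ℤ, n ∣ a + (b - a) % n - b := fun a b => by
        rw [Int.emod_def]
        exact ⟨-((b - a) / n), by ring⟩
      intro o
      cases o
      · exact key x.2 v.2
      · exact key x.1 v.1
    rwa [h9] at h6
  ext a b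
  exact ⟨fun _ => trivial, fun _ => r.trans (h5 a) (r.symm (h5 b))⟩

end Growth

/-! ### Lower bound for the probability of a nucleus -/

section NucleusProb

/-- A lower bound for the probability that a vertex has `σ` people neighbors in a set of `k`
vertices. -/
def starProb (σ k : ℕ) (p : ℝ) : ℝ := (k.choose σ : ℝ) * (p ^ σ * (1 - p) ^ (k - σ))

variable {σ : ℕ} {p : ℝ}

/-- The Harris inequality for a finite family of increasing events. -/
lemma bprob_harris_finset {α ι : Type*} [DecidableEq α] {E : Finset α} (h0 : 0 ≤ p) (h1 : p ≤ 1)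
    (I : Finset ι) (Q : ι → Finset α → Prop) (hQ : ∀ i ∈ I, Monotone (Q i)) :
    ∏ i ∈ I, bprob E p (Q i) ≤ bprob E p fun S => ∀ i ∈ I, Q i S := by
  classical
  induction I using Finset.induction_on with
  | empty => simp [bprob_true]
  | insert i I hi ih =>
    rw [Finset.prod_insert hi]
    have h2 := ih fun j hj => hQ j (Finset.mem_insert_of_mem hj)
    have h3 : Monotone fun S : Finset α => ∀ j ∈ I, Q j S := fun S S' h hS j hj =>
      hQ j (Finset.mem_insert_of_mem hj) h (hS j hj)
    refine (mul_le_mul_of_nonneg_left h2 (bprob_nonneg h0 h1 _)).trans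
      ((bprob_harris h0 h1 (hQ i (Finset.mem_insert_self i I)) h3).trans (le_of_eq ?_))
    exact bprob_congr fun S _ => (Finset.forall_mem_insert i I (fun j => Q j S)).symm

lemma GrowRel.mono {P P' : ℤ × ℤ → ℤ × ℤ → Prop} {o : Bool} {x : ℤ × ℤ} {k : ℕ}
    (h : GrowRel P σ o x k) (hP : ∀ u w, P u w → P' u w) : GrowRel P' σ o x k := by
  obtain ⟨v, hv, hc⟩ := h
  refine ⟨v, hv, hc.trans (Finset.card_le_card fun w hw => ?_)⟩
  rw [mem_nbrs] at hw ⊢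
  exact ⟨hw.1, hP _ _ hw.2⟩

lemma monotone_growRel (o : Bool) (x : ℤ × ℤ) (k : ℕ) :
    Monotone fun S : Finset (Sym2 (ℤ × ℤ)) => GrowRel (edgeRel S) σ o x k :=
  fun _ _ h hS => hS.mono fun _ _ hP => h hP

/-- The number of neighbors can be counted in any smaller square to bound the probability of
growth. -/
lemma le_bprob_growRel (h0 : 0 ≤ p) (h1 : p ≤ 1) (o : Bool) (x : ℤ × ℤ) {j k : ℕ} (hjk : j ≤ k)
    {E : Finset (Sym2 (ℤ × ℤ))} (hE : edgesIn (sq x (k + 1)) ⊆ E) :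
    1 - Real.exp (-(k * starProb σ (j ^ 2) p)) ≤
      bprob E p fun S => GrowRel (edgeRel S) σ o x k := by
  classical
  have hd : Disjoint (bline o x k) (sq x j) :=
    (disjoint_bline_sq o x k).mono_right (sq_mono hjk)
  have h2 : bprob E p (fun S => ∃ v ∈ bline o x k, σ ≤ ((sq x j).filter fun w => s(v, w) ∈ S).card) ≤
      bprob E p fun S => GrowRel (edgeRel S) σ o x k := by
    refine bprob_mono h0 h1 fun S _ => ?_
    rintro ⟨v, hv, hc⟩
    refine ⟨v, hv, hc.trans (Finset.card_le_card fun w hw => ?_)⟩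
    rw [Finset.mem_filter] at hw
    exact mem_nbrs.2 ⟨sq_mono hjk hw.1, hw.2⟩
  refine le_trans ?_ h2
  rw [bprob_exists_star p hd]
  have h3 : ∀ v ∈ bline o x k, 1 - bprob E p (fun S => σ ≤ (S ∩ star v (sq x j)).card) ≤
      Real.exp (-starProb σ (j ^ 2) p) := by
    intro v hv
    have hsub : star v (sq x j) ⊆ E := by
      intro e he
      obtain ⟨w, hw, rfl⟩ := Finset.mem_image.1 he
      refine hE (mk_mem_edgesIn.2 ⟨bline_subset_sq o x k hv, sq_mono (by omega) hw, ?_⟩)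
      rintro rfl
      exact Finset.disjoint_left.1 hd hv hw
    have h4 := le_bprob_card_ge h0 h1 hsub σ
    rw [card_star, card_sq] at h4
    have h5 := Real.one_sub_le_exp_neg (starProb σ (j ^ 2) p)
    unfold starProb at h5 ⊢
    linarith
  have h4 : ∏ v ∈ bline o x k, (1 - bprob E p (fun S => σ ≤ (S ∩ star v (sq x j)).card)) ≤
      Real.exp (-(k * starProb σ (j ^ 2) p)) := by
    refine (Finset.prod_le_prod (fun v _ => ?_) h3).trans (le_of_eq ?_)
    · exact sub_nonneg.2 (bprob_le_one h0 h1 _)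
    · rw [Finset.prod_const, card_bline, ← Real.exp_nat_mul]
      congr 1
      ring
  linarith

/-- A nucleus: a seed of side length `m`, which grows to a square of side length `L`. -/
def Nucleus (P : ℤ × ℤ → ℤ × ℤ → Prop) (σ m L : ℕ) (x : ℤ × ℤ) : Prop :=
  SeedRel P m x ∧ ∀ i ∈ Finset.Ico m L ×ˢ (Finset.univ : Finset Bool), GrowRel P σ i.2 x i.1

lemma Nucleus.mono {P P' : ℤ × ℤ → ℤ × ℤ → Prop} {m L : ℕ} {x : ℤ × ℤ} (h : Nucleus P σ m L x)
    (hP : ∀ u w, P u w → P' u w) : Nucleus P' σ m L x :=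
  ⟨fun k hk o => hP _ _ (h.1 k hk o), fun i hi => (h.2 i hi).mono hP⟩

/-- By the Harris inequality, the probability of a nucleus is at least the product of the
probabilities of the growth steps. -/
lemma le_bprob_nucleus (h0 : 0 ≤ p) (h1 : p ≤ 1) {m L : ℕ} (hmL : m ≤ L) (x : ℤ × ℤ)
    (f : ℕ → ℕ) (hf : ∀ k, f k ≤ k) (hpos : ∀ k ∈ Finset.Ico m L, 0 < k * starProb σ (f k ^ 2) p) :
    p ^ (2 * m) * Real.exp (-(2 * ∑ k ∈ Finset.Ico m L, hcost (k * starProb σ (f k ^ 2) p))) ≤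
      bprob (edgesIn (sq x L)) p fun S => Nucleus (edgeRel S) σ m L x := by
  classical
  set E := edgesIn (sq x L) with hE
  -- the seed
  have hseed : p ^ (2 * m) ≤ bprob E p fun S => SeedRel (edgeRel S) m x := by
    set T : Finset (Sym2 (ℤ × ℤ)) := (Finset.Ico 1 m ×ˢ (Finset.univ : Finset Bool)).image
      fun i => s(x + pt i.2 i.1 0, x + pt i.2 (i.1 - 1) 0) with hT
    have hTE : T ⊆ E := by
      intro e he
      obtain ⟨⟨k, o⟩, hk, rfl⟩ := Finset.mem_image.1 he
      rw [Finset.mem_product, Finset.mem_Ico] at hk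
      simp only at hk
      rw [hE, mk_mem_edgesIn, add_pt_mem_sq, add_pt_mem_sq]
      refine ⟨by omega, by omega, fun h => ?_⟩
      have := congrArg (co o) h
      simp only [co_add, co_pt_self] at this
      omega
    have hc : T.card ≤ 2 * m := by
      refine Finset.card_image_le.trans ?_
      rw [Finset.card_product, Nat.card_Ico, Finset.card_univ, Fintype.card_bool]
      omega
    calc p ^ (2 * m) ≤ p ^ T.card := pow_le_pow_of_le_one h0 h1 hc
      _ = bprob E p fun S => T ⊆ S := (bprob_subset p hTE).symm
      _ ≤ _ := by
        refine bprob_mono h0 h1 fun S _ hTS k hk o => hTS ?_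
        exact Finset.mem_image.2 ⟨(k, o), Finset.mem_product.2 ⟨hk, Finset.mem_univ _⟩, rfl⟩
  -- the growth steps
  have hgrow : Real.exp (-(2 * ∑ k ∈ Finset.Ico m L, hcost (k * starProb σ (f k ^ 2) p))) ≤
      bprob E p fun S => ∀ i ∈ Finset.Ico m L ×ˢ (Finset.univ : Finset Bool),
        GrowRel (edgeRel S) σ i.2 x i.1 := by
    refine le_trans ?_ (bprob_harris_finset h0 h1 _ _ fun i _ => monotone_growRel i.2 x i.1)
    have h2 : Real.exp (-(2 * ∑ k ∈ Finset.Ico m L, hcost (k * starProb σ (f k ^ 2) p))) =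
        ∏ i ∈ Finset.Ico m L ×ˢ (Finset.univ : Finset Bool),
          Real.exp (-hcost (i.1 * starProb σ (f i.1 ^ 2) p)) := by
      rw [← Real.exp_sum, Finset.sum_product, Finset.mul_sum, ← Finset.sum_neg_distrib]
      congr 1
      refine Finset.sum_congr rfl fun k _ => ?_
      rw [Fintype.sum_bool]
      ring
    rw [h2]
    refine Finset.prod_le_prod (fun i _ => (Real.exp_pos _).le) fun i hi => ?_
    have hi' := (Finset.mem_product.1 hi).1
    rw [exp_neg_hcost (hpos i.1 hi')]
    refine le_bprob_growRel h0 h1 i.2 x (hf i.1) fun e he => ?_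
    rw [Finset.mem_Ico] at hi'
    induction e with | _ a b
    rw [hE, mk_mem_edgesIn] at *
    exact ⟨sq_mono (by omega) he.1, sq_mono (by omega) he.2.1, he.2.2⟩
  have hmono : Monotone fun S : Finset (Sym2 (ℤ × ℤ)) => SeedRel (edgeRel S) m x :=
    fun S S' h hS k hk o => h (hS k hk o)
  have hmono' : Monotone fun S : Finset (Sym2 (ℤ × ℤ)) =>
      ∀ i ∈ Finset.Ico m L ×ˢ (Finset.univ : Finset Bool), GrowRel (edgeRel S) σ i.2 x i.1 :=
    fun S S' h hS i hi => monotone_growRel i.2 x i.1 h (hS i hi)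
  exact (mul_le_mul hseed hgrow (Real.exp_pos _).le (bprob_nonneg h0 h1 _)).trans
    (bprob_harris h0 h1 hmono hmono')

end NucleusProb

/-! ### Lower bound for the solving probability -/

section LowerBound

variable {m σ : ℕ} {p : ℝ}

/-- The edges of the lattice that project to the edges in `S`. -/
def liftEdges (m : ℕ) (B : Finset (ℤ × ℤ)) (S : Finset (Sym2 (Fin (m + 2) × Fin (m + 2)))) :
    Finset (Sym2 (ℤ × ℤ)) := by
  classical exact (edgesIn B).filter fun e => Sym2.map (tproj m) e ∈ S

lemma pullRel_of_edgeRel_liftEdges {B : Finset (ℤ × ℤ)}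
    {S : Finset (Sym2 (Fin (m + 2) × Fin (m + 2)))}
    (hS : S ⊆ allEdges (Fin (m + 2) × Fin (m + 2))) {u w : ℤ × ℤ}
    (h : edgeRel (liftEdges m B S) u w) :
    pullRel m (SimpleGraph.fromEdgeSet (S : Set (Sym2 (Fin (m + 2) × Fin (m + 2))))) u w := by
  classical
  unfold edgeRel liftEdges at h
  rw [Finset.mem_filter, Sym2.map_mk] at h
  refine (SimpleGraph.fromEdgeSet_adj _).2 ⟨h.2, fun he => ?_⟩
  have := mem_allEdges.1 (hS h.2)
  rw [Sym2.mk_isDiag_iff] at this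
  exact this he

lemma bprob_liftEdges {B : Finset (ℤ × ℤ)} (hB : Small (m + 2) B) (p : ℝ)
    (Q : Finset (Sym2 (ℤ × ℤ)) → Prop) :
    bprob (allEdges (Fin (m + 2) × Fin (m + 2))) p (fun S => Q (liftEdges m B S)) =
      bprob (edgesIn B) p Q := by
  classical
  have := bprob_comap p (injOn_map_tproj hB) (image_edgesIn_subset hB) Q
  exact this

/-- The corners of disjoint squares of side length `L`. -/
def corner (L : ℕ) (i : ℕ × ℕ) : ℤ × ℤ := ((i.1 * L : ℕ), (i.2 * L : ℕ))

lemma eq_of_tproj_eq_of_mem_sq {L N : ℕ} (hN : N * L ≤ m + 2) {i j : ℕ × ℕ}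
    (hi : i ∈ Finset.range N ×ˢ Finset.range N) (hj : j ∈ Finset.range N ×ˢ Finset.range N)
    {a b : ℤ × ℤ} (ha : a ∈ sq (corner L i) L) (hb : b ∈ sq (corner L j) L)
    (h : tproj m a = tproj m b) : i = j := by
  rw [Finset.mem_product, Finset.mem_range, Finset.mem_range] at hi hj
  have key : ∀ s t : ℕ, ∀ y z : ℤ, s < N → t < N → ((s * L : ℕ) : ℤ) ≤ y → y < ((s * L : ℕ) : ℤ) + L →
      ((t * L : ℕ) : ℤ) ≤ z → z < ((t * L : ℕ) : ℤ) + L → ((m + 2 : ℕ) : ℤ) ∣ y - z → s = t := by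
    intro s t y z hs ht h1 h2 h3 h4 h5
    have hs' : (s + 1) * L ≤ N * L := Nat.mul_le_mul_right L hs
    have ht' : (t + 1) * L ≤ N * L := Nat.mul_le_mul_right L ht
    rw [add_mul, one_mul] at hs' ht'
    have h6 := Int.eq_zero_of_abs_lt_dvd h5 (abs_lt.2 ⟨by omega, by omega⟩)
    rcases lt_trichotomy s t with h7 | h7 | h7
    · have := Nat.mul_le_mul_right L h7
      rw [Nat.succ_mul] at this
      omega
    · exact h7
    · have := Nat.mul_le_mul_right L h7
      rw [Nat.succ_mul] at this
      omega
  rw [tproj_eq_iff] at h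
  rw [mem_sq] at ha hb
  have h1 := key i.1 j.1 a.1 b.1 hi.1 hj.1 (ha true).1 (ha true).2 (hb true).1 (hb true).2 (h true)
  have h2 := key i.2 j.2 a.2 b.2 hi.2 hj.2 (ha false).1 (ha false).2 (hb false).1 (hb false).2
    (h false)
  exact Prod.ext h1 h2

/-- If a nucleus has probability at least `ρ`, then there are none in `N²` disjoint squares with
probability at most `exp (-N² ρ)`. -/
lemma bprob_no_nucleus_le (h0 : 0 ≤ p) (h1 : p ≤ 1) {m₀ L N : ℕ} (hLm : L ≤ m + 2)
    (hN : N * L ≤ m + 2) {ρ : ℝ}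
    (hρ : ∀ x, ρ ≤ bprob (edgesIn (sq x L)) p fun S => Nucleus (edgeRel S) σ m₀ L x) :
    bprob (allEdges (Fin (m + 2) × Fin (m + 2))) p (fun S =>
      ∀ i ∈ Finset.range N ×ˢ Finset.range N, ¬ Nucleus (edgeRel (liftEdges m (sq (corner L i) L) S))
        σ m₀ L (corner L i)) ≤ Real.exp (-(N ^ 2 * ρ)) := by
  classical
  have hsm : ∀ x, Small (m + 2) (sq x L) := fun x => small_sq hLm
  rw [bprob_forall_of_indep p _ (fun i => (edgesIn (sq (corner L i) L)).image (Sym2.map (tproj m)))]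
  · have h2 : ∀ i ∈ Finset.range N ×ˢ Finset.range N,
        bprob (allEdges (Fin (m + 2) × Fin (m + 2))) p (fun S =>
          ¬ Nucleus (edgeRel (liftEdges m (sq (corner L i) L) S)) σ m₀ L (corner L i)) ≤
        Real.exp (-ρ) := by
      intro i _
      rw [bprob_not, bprob_liftEdges (hsm _) p fun S => Nucleus (edgeRel S) σ m₀ L (corner L i)]
      have := hρ (corner L i)
      have := Real.one_sub_le_exp_neg ρ
      linarith
    refine (Finset.prod_le_prod (fun i _ => bprob_nonneg h0 h1 _) h2).trans (le_of_eq ?_)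
    rw [Finset.prod_const, Finset.card_product, Finset.card_range, ← Real.exp_nat_mul]
    congr 1
    push_cast
    ring
  · intro i hi j hj hij
    rw [Finset.disjoint_left]
    intro e he he'
    obtain ⟨a, ha, rfl⟩ := Finset.mem_image.1 he
    obtain ⟨b, hb, hab⟩ := Finset.mem_image.1 he'
    induction a with | _ a₁ a₂
    induction b with | _ b₁ b₂
    rw [mk_mem_edgesIn] at ha hb
    rw [Sym2.map_mk, Sym2.map_mk, Sym2.eq_iff] at hab
    rcases hab with ⟨h, _⟩ | ⟨h, _⟩
    · exact hij (eq_of_tproj_eq_of_mem_sq hN hi hj ha.1 hb.1 h.symm)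
    · exact hij (eq_of_tproj_eq_of_mem_sq hN hi hj ha.2.1 hb.1 h.symm)
  · intro i _ S _
    have : liftEdges m (sq (corner L i) L) S = liftEdges m (sq (corner L i) L)
        (S ∩ (edgesIn (sq (corner L i) L)).image (Sym2.map (tproj m))) := by
      unfold liftEdges
      refine Finset.filter_congr fun e he => ?_
      rw [Finset.mem_inter]
      exact ⟨fun h => ⟨h, Finset.mem_image_of_mem _ he⟩, fun h => h.1⟩
    rw [← this]

lemma pullRel_growRel_congr {G : SimpleGraph (Fin (m + 2) × Fin (m + 2))} {o : Bool} {x z : ℤ × ℤ}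
    {k : ℕ} (hz : ∀ v, tproj m (v + z) = tproj m v) (h : GrowRel (pullRel m G) σ o x k) :
    GrowRel (pullRel m G) σ o (x + z) k := by
  classical
  obtain ⟨v, hv, hc⟩ := h
  obtain ⟨j, hj, rfl⟩ := Finset.mem_image.1 hv
  refine ⟨x + pt o k j + z, Finset.mem_image.2 ⟨j, hj, by abel⟩, hc.trans ?_⟩
  rw [← Finset.card_image_of_injective _ (add_left_injective z)]
  refine Finset.card_le_card fun w hw => ?_
  obtain ⟨w', hw', rfl⟩ := Finset.mem_image.1 hw
  rw [mem_nbrs] at hw' ⊢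
  refine ⟨?_, ?_⟩
  · rw [mem_sq] at hw' ⊢
    intro o'
    have := hw'.1 o'
    simp only [co_add]
    omega
  · unfold pullRel at *
    rw [hz, hz]
    exact hw'.2

/-- The puzzle is solved if there is a nucleus, and all squares of its final size grow further. -/
theorem one_sub_solveProb_le (p : unitInterval) {m₀ L N j : ℕ} (hm₀ : 1 ≤ m₀) (hmL : m₀ ≤ L)
    (hL : L + 1 ≤ m + 2) (hN : N * L ≤ m + 2) (hj : j ≤ L) {ρ : ℝ}
    (hρ : ∀ x, ρ ≤ bprob (edgesIn (sq x L)) p fun S => Nucleus (edgeRel S) σ m₀ L x) :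
    1 - solveProb σ 1 2 (m + 2) p ≤ Real.exp (-(N ^ 2 * ρ)) +
      2 * ((m + 2 : ℕ) : ℝ) ^ 2 * Real.exp (-(L * starProb σ (j ^ 2) p)) := by
  classical
  obtain ⟨h0, h1⟩ := p.2
  rw [solveProb_eq, ← bprob_not]
  set V := Fin (m + 2) × Fin (m + 2)
  set I := (Finset.range (m + 2) ×ˢ Finset.range (m + 2)) ×ˢ (Finset.univ : Finset Bool) with hI
  set pos : (ℕ × ℕ) × Bool → ℤ × ℤ := fun i => ((i.1.1 : ℤ), (i.1.2 : ℤ)) with hpos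
  set Q₁ : Finset (Sym2 V) → Prop := fun S => ∀ i ∈ Finset.range N ×ˢ Finset.range N,
    ¬ Nucleus (edgeRel (liftEdges m (sq (corner L i) L) S)) σ m₀ L (corner L i)
  set Q₂ : (ℕ × ℕ) × Bool → Finset (Sym2 V) → Prop := fun i S =>
    ¬ GrowRel (edgeRel (liftEdges m (sq (pos i) (L + 1)) S)) σ i.2 (pos i) L
  have hstep : ∀ S ⊆ allEdges V, ¬ Solve (torus (m + 2))
      (SimpleGraph.fromEdgeSet (S : Set (Sym2 V))) σ 1 2 → Q₁ S ∨ ∃ i ∈ I, Q₂ i S := by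
    intro S hS hns
    by_contra! hcon
    obtain ⟨hQ1, hQ2⟩ := hcon
    simp only [Q₁] at hQ1
    push Not at hQ1
    obtain ⟨i, _, hi⟩ := hQ1
    obtain ⟨hseed, hgrow⟩ := hi.mono fun u w => pullRel_of_edgeRel_liftEdges hS
    refine hns (solve_of_nucleus hm₀ hmL (by omega) hseed
      (fun k hk o => hgrow (k, o) (Finset.mem_product.2 ⟨hk, Finset.mem_univ o⟩)) fun y o => ?_)
    -- reduction to the fundamental domain
    set n : ℤ := ((m + 2 : ℕ) : ℤ) with hn
    have hn0 : 0 < n := by omega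
    set i' : (ℕ × ℕ) × Bool := (((y.1 % n).toNat, (y.2 % n).toNat), o) with hi'
    have hy1 := Int.emod_nonneg y.1 hn0.ne'
    have hy2 := Int.emod_nonneg y.2 hn0.ne'
    have hy1' := Int.emod_lt_of_pos y.1 hn0
    have hy2' := Int.emod_lt_of_pos y.2 hn0
    have hmem : i' ∈ I := by
      rw [hI, hi', Finset.mem_product, Finset.mem_product, Finset.mem_range, Finset.mem_range]
      refine ⟨⟨?_, ?_⟩, Finset.mem_univ _⟩ <;> simp only <;> omega
    have h2 := not_not.1 (hQ2 i' hmem)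
    have h3 := h2.mono fun u w => pullRel_of_edgeRel_liftEdges hS
    have h4 := pullRel_growRel_congr (z := y - pos i') (fun v => ?_) h3
    · rwa [add_sub_cancel] at h4
    · rw [tproj_eq_iff]
      intro o'
      rw [co_add, add_sub_cancel_left, co_sub]
      have key : ∀ a : ℤ, 0 ≤ a % n → n ∣ a - ((a % n).toNat : ℤ) := fun a ha => by
        rw [Int.toNat_of_nonneg ha]
        exact Int.dvd_self_sub_emod
      cases o'
      · exact key y.2 hy2
      · exact key y.1 hy1
  refine (bprob_mono h0 h1 hstep).trans ((bprob_or_le h0 h1 _ _).trans (add_le_add ?_ ?_))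
  · exact bprob_no_nucleus_le h0 h1 (by omega) hN hρ
  · refine (bprob_exists_le h0 h1 I Q₂).trans ?_
    have hterm : ∀ i ∈ I, bprob (allEdges V) p (Q₂ i) ≤ Real.exp (-(L * starProb σ (j ^ 2) p)) := by
      intro i _
      simp only [Q₂]
      rw [bprob_not, bprob_liftEdges (small_sq hL) p fun S => GrowRel (edgeRel S) σ i.2 (pos i) L]
      have := le_bprob_growRel (σ := σ) h0 h1 i.2 (pos i) hj
        (Finset.Subset.refl (edgesIn (sq (pos i) (L + 1))))
      linarith
    refine (Finset.sum_le_card_nsmul I _ _ hterm).trans (le_of_eq ?_)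
    rw [nsmul_eq_mul, hI, Finset.card_product, Finset.card_product, Finset.card_range,
      Finset.card_univ, Fintype.card_bool]
    push_cast
    ring

end LowerBound

/-! ### The supercritical regime -/

section Supercritical

variable {σ : ℕ} {p q : ℝ}

/-- The probability that a vertex has `σ` neighbors in a square, up to a factor `s` for the binomial
coefficient, and another one for the absence of further edges. -/
lemma le_starProb {s : ℝ} (hs0 : 0 ≤ s) (h0 : 0 ≤ p) (h1 : p ≤ 1) (hq : 0 ≤ q)
    (hpq : p ^ σ = q ^ (2 * σ + 1)) {k : ℕ} (hk : 1 ≤ k) (hkσ : (σ : ℝ) ^ 2 ≤ (1 - s) * k ^ 2)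
    (hkp : k ^ 2 * p ≤ 1 - s) :
    s ^ 2 * (σ.factorial : ℝ)⁻¹ * (k * q) ^ (2 * σ) * q ≤ starProb σ (k ^ 2) p := by
  have hk0 : (0 : ℝ) < k ^ 2 := by positivity
  have hfac : (0 : ℝ) < σ.factorial := by positivity
  have hσk : σ ≤ k ^ 2 := by
    have h2 : σ ≤ σ ^ 2 := Nat.le_self_pow (by norm_num) σ
    have h3 : ((σ ^ 2 : ℕ) : ℝ) ≤ (k ^ 2 : ℕ) := by
      push_cast
      nlinarith
    exact h2.trans (by exact_mod_cast h3)
  have hσk' : (σ : ℝ) ≤ k ^ 2 := by exact_mod_cast hσk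
  -- the binomial coefficient
  have hch : s * (k : ℝ) ^ (2 * σ) ≤ σ.factorial * ((k ^ 2).choose σ : ℝ) := by
    have h2 : (k ^ 2 - σ) ^ σ ≤ (k ^ 2).descFactorial σ :=
      (Nat.pow_le_pow_left (by omega) σ).trans (Nat.pow_sub_le_descFactorial _ _)
    rw [Nat.descFactorial_eq_factorial_mul_choose] at h2
    have h3 : (((k ^ 2 - σ : ℕ) : ℝ)) ^ σ ≤ σ.factorial * ((k ^ 2).choose σ : ℝ) := by
      exact_mod_cast h2
    refine le_trans ?_ h3
    rw [Nat.cast_sub hσk]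
    push_cast
    have h4 : (k : ℝ) ^ 2 - σ = k ^ 2 * (1 + -(σ / k ^ 2)) := by field_simp; ring
    have h5 : (-2 : ℝ) ≤ -(σ / k ^ 2) := by
      have : (σ : ℝ) / k ^ 2 ≤ 1 := (div_le_one hk0).2 hσk'
      linarith
    have h6 := one_add_mul_le_pow h5 σ
    have h7 : s ≤ 1 + (σ : ℝ) * -(σ / k ^ 2) := by
      have : (σ : ℝ) * (σ / k ^ 2) ≤ 1 - s := by
        rw [← mul_div_assoc, div_le_iff₀ hk0, ← _root_.sq]
        exact hkσ
      linarith
    rw [h4, mul_pow, ← pow_mul, mul_comm s]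
    exact mul_le_mul_of_nonneg_left (h7.trans h6) (by positivity)
  have hpow : s ≤ (1 - p) ^ (k ^ 2 - σ) := by
    have h2 := one_add_mul_le_pow (show (-2 : ℝ) ≤ -p by linarith) (k ^ 2)
    rw [← sub_eq_add_neg] at h2
    push_cast at h2
    have h3 : (1 - p) ^ (k ^ 2) ≤ (1 - p) ^ (k ^ 2 - σ) :=
      pow_le_pow_of_le_one (by linarith) (by linarith) (Nat.sub_le _ _)
    linarith
  unfold starProb
  rw [hpq]
  have h2 : s * (k : ℝ) ^ (2 * σ) * (σ.factorial : ℝ)⁻¹ ≤ ((k ^ 2).choose σ : ℝ) := by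
    rw [← div_eq_mul_inv, div_le_iff₀ hfac, mul_comm _ (σ.factorial : ℝ)]
    exact hch
  calc s ^ 2 * (σ.factorial : ℝ)⁻¹ * (k * q) ^ (2 * σ) * q
      = (s * (k : ℝ) ^ (2 * σ) * (σ.factorial : ℝ)⁻¹) * (q ^ (2 * σ + 1) * s) := by ring
    _ ≤ _ := by gcongr

/-- The cost of the growth of a nucleus: the squares of side length up to `K`, of the critical order,
contribute a Riemann sum of the integral `ν`, and the larger squares contribute little. -/
lemma exists_growth_bound (hσ : 1 ≤ σ) {η : ℝ} (hη : 0 < η) :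
    ∃ (m₀ : ℕ) (M D : ℝ), 1 ≤ m₀ ∧ 0 < M ∧ 0 < D ∧ ∀ᶠ q : ℝ in 𝓝[>] 0, ∃ K : ℕ, m₀ ≤ K ∧
      (K : ℝ) ≤ M / q ∧ ∀ p : ℝ, 0 ≤ p → p ≤ 1 → p ^ σ = q ^ (2 * σ + 1) →
      D * q ≤ starProb σ (K ^ 2) p ∧ ∀ L : ℕ,
      (∀ k ∈ Finset.Ico m₀ L, 0 < k * starProb σ ((min k K) ^ 2) p) ∧
      ∑ k ∈ Finset.Ico m₀ L, hcost (k * starProb σ ((min k K) ^ 2) p) ≤ (nu σ + η) / q := by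
  have hν := nu_pos σ
  have hfac : (0 : ℝ) < σ.factorial := by positivity
  set s : ℝ := nu σ / (nu σ + η / 2) with hs
  have hs0 : 0 < s := by positivity
  have hs1 : s < 1 := by rw [hs, div_lt_one (by positivity)]; linarith
  set D : ℝ := s ^ 2 * (σ.factorial : ℝ)⁻¹ with hD
  have hD0 : 0 < D := by positivity
  obtain ⟨m₀, hm₀⟩ := exists_nat_ge (max 1 ((σ : ℝ) ^ 2 / (1 - s)))
  have hm1 : (1 : ℝ) ≤ m₀ := (le_max_left _ _).trans hm₀
  have hm1' : 1 ≤ m₀ := by exact_mod_cast hm1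
  have hm2 : (σ : ℝ) ^ 2 ≤ (1 - s) * m₀ := by
    have := (le_max_right _ _).trans hm₀
    rwa [div_le_iff₀ (by linarith), mul_comm] at this
  set M : ℝ := max 2 (8 / (D ^ 2 * η)) with hM
  have hM2 : 2 ≤ M := le_max_left _ _
  have hM0 : 0 < M := by linarith
  have hM3 : 8 ≤ M * (D ^ 2 * η) := by
    rw [← div_le_iff₀ (by positivity)]
    exact le_max_right _ _
  set κ : ℝ := (1 - s) / M ^ 2 with hκ
  have hκ0 : 0 < κ := div_pos (by linarith) (by positivity)
  refine ⟨m₀, M, D, hm1', hM0, hD0, ?_⟩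
  filter_upwards [eventually_pos, eventually_lt_of_pos (show 0 < M / 2 by positivity),
    eventually_lt_of_pos (show 0 < M / m₀ by positivity),
    eventually_lt_of_pos (show 0 < κ ^ σ by positivity)] with q hq hqM hqm hqκ
  have hmK : m₀ ≤ ⌊M / q⌋₊ := by
    refine Nat.le_floor ?_
    rw [le_div_iff₀ hq, mul_comm, ← le_div_iff₀ (by positivity)]
    exact hqm.le
  have hKM : ((⌊M / q⌋₊ : ℕ) : ℝ) ≤ M / q := Nat.floor_le (by positivity)
  have hKM' : M / q < (⌊M / q⌋₊ : ℕ) + 1 := Nat.lt_floor_add_one _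
  refine ⟨⌊M / q⌋₊, hmK, hKM, fun p h0 h1 hpq => ?_⟩
  set K := ⌊M / q⌋₊
  rw [le_div_iff₀ hq] at hKM
  rw [div_lt_iff₀ hq] at hKM'
  have hK1 : M / 2 ≤ K * q := by linarith
  have hpκ : p ≤ κ * q ^ 2 := by
    rw [← pow_le_pow_iff_left₀ h0 (by positivity) (show σ ≠ 0 by omega), hpq, mul_pow, ← pow_mul,
      pow_succ, mul_comm]
    exact mul_le_mul_of_nonneg_right hqκ.le (by positivity)
  -- the probabilities for the squares of side length at most `K`
  have hstar : ∀ k : ℕ, m₀ ≤ k → k ≤ K → D * (k * q) ^ (2 * σ) * q ≤ starProb σ (k ^ 2) p := by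
    intro k hk hkK
    have hk1 : 1 ≤ k := hm1'.trans hk
    have hkr : (m₀ : ℝ) ≤ k := by exact_mod_cast hk
    refine le_starProb hs0.le h0 h1 hq.le hpq hk1 ?_ ?_
    · refine hm2.trans (mul_le_mul_of_nonneg_left ?_ (by linarith))
      nlinarith
    · have h2 : (k : ℝ) * q ≤ M := by
        refine le_trans ?_ hKM
        gcongr
      calc (k : ℝ) ^ 2 * p ≤ k ^ 2 * (κ * q ^ 2) := by gcongr
        _ = κ * (k * q) ^ 2 := by ring
        _ ≤ κ * M ^ 2 := by gcongr
        _ = 1 - s := by rw [hκ]; field_simp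
  have hKstar : D * q ≤ starProb σ (K ^ 2) p := by
    refine le_trans ?_ (hstar K hmK le_rfl)
    have h2 : 1 ≤ ((K : ℝ) * q) ^ (2 * σ) := one_le_pow₀ (by linarith)
    have h3 := mul_le_mul_of_nonneg_left h2 hD0.le
    rw [mul_one] at h3
    exact mul_le_mul_of_nonneg_right h3 hq.le
  have hsmall : ∀ k : ℕ, m₀ ≤ k → k ≤ K →
      (σ.factorial : ℝ)⁻¹ * (s * (k * q)) ^ (2 * σ + 1) ≤ k * starProb σ (k ^ 2) p := by
    intro k hk hkK
    have h2 : s ^ (2 * σ + 1) ≤ s ^ 2 := pow_le_pow_of_le_one hs0.le hs1.le (by omega)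
    calc (σ.factorial : ℝ)⁻¹ * (s * (k * q)) ^ (2 * σ + 1)
        = s ^ (2 * σ + 1) * ((σ.factorial : ℝ)⁻¹ * (k * q) ^ (2 * σ + 1)) := by ring
      _ ≤ s ^ 2 * ((σ.factorial : ℝ)⁻¹ * (k * q) ^ (2 * σ + 1)) := by gcongr
      _ = k * (D * (k * q) ^ (2 * σ) * q) := by rw [hD]; ring
      _ ≤ _ := mul_le_mul_of_nonneg_left (hstar k hk hkK) (by positivity)
  refine ⟨hKstar, fun L => ⟨fun k hk => ?_, ?_⟩⟩
  · have hk' := (Finset.mem_Ico.1 hk).1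
    have hk0 : (0 : ℝ) < k := by exact_mod_cast hm1'.trans hk'
    refine mul_pos hk0 ?_
    have hpos : ∀ j : ℕ, m₀ ≤ j → j ≤ K → 0 < starProb σ (j ^ 2) p := by
      intro j hj hjK
      refine lt_of_lt_of_le ?_ (hstar j hj hjK)
      have : (0 : ℝ) < j := by exact_mod_cast hm1'.trans hj
      positivity
    exact hpos _ (le_min hk' hmK) (min_le_right _ _)
  · rw [← Finset.sum_filter_add_sum_filter_not _ (fun k => k ≤ K)]
    -- the Riemann sum
    have hsum1 : ∑ k ∈ (Finset.Ico m₀ L).filter (fun k => k ≤ K),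
        hcost (k * starProb σ ((min k K) ^ 2) p) ≤ (nu σ + η / 2) / q := by
      have h2 : ∀ k ∈ (Finset.Ico m₀ L).filter (fun k => k ≤ K),
          hcost (k * starProb σ ((min k K) ^ 2) p) ≤ nuIntegrand σ (s * (k * q)) := by
        intro k hk
        rw [Finset.mem_filter, Finset.mem_Ico] at hk
        have hk0 : (0 : ℝ) < k := by exact_mod_cast hm1'.trans hk.1.1
        rw [min_eq_left hk.2, nuIntegrand_eq]
        exact hcost_anti (by positivity) (hsmall k hk.1.1 hk.2)
      have h3 : ∑ k ∈ (Finset.Ico m₀ L).filter (fun k => k ≤ K), nuIntegrand σ (s * (k * q)) ≤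
          ∑ k ∈ Finset.Ico 1 (K + 1), nuIntegrand σ (s * (k * q)) := by
        refine Finset.sum_le_sum_of_subset_of_nonneg (fun k hk => ?_) fun k hk _ => ?_
        · rw [Finset.mem_filter, Finset.mem_Ico] at hk
          rw [Finset.mem_Ico]
          omega
        · have hk0 : (0 : ℝ) < k := by exact_mod_cast (Finset.mem_Ico.1 hk).1
          exact (nuIntegrand_pos σ (by positivity)).le
      have h4 : ∑ k ∈ Finset.Ico 1 (K + 1), nuIntegrand σ (s * (k * q)) =
          ∑ k ∈ Finset.range K, nuIntegrand σ (s * ((k + 1 : ℕ) * q)) := by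
        rw [Finset.sum_Ico_eq_sum_range, Nat.add_sub_cancel]
        exact Finset.sum_congr rfl fun k _ => by rw [add_comm]
      have h5 : AntitoneOn (fun x : ℝ => nuIntegrand σ (s * x)) (Ioi 0) := fun x hx y hy hxy =>
        antitoneOn_nuIntegrand σ (mul_pos hs0 hx) (mul_pos hs0 hy) (by gcongr)
      have h6 : IntegrableOn (fun x : ℝ => nuIntegrand σ (s * x)) (Ioi 0) := by
        rw [integrableOn_Ioi_comp_mul_left_iff _ _ hs0, mul_zero]
        exact integrableOn_nuIntegrand σ
      have h7 := sum_le_integral_of_antitone h5 h6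
        (fun x hx => (nuIntegrand_pos σ (mul_pos hs0 hx)).le) hq K
      rw [integral_comp_mul_left_Ioi _ _ hs0, mul_zero, smul_eq_mul, ← nu] at h7
      have h8 : s⁻¹ * nu σ = nu σ + η / 2 := by rw [hs]; field_simp
      rw [h8] at h7
      rw [le_div_iff₀ hq, mul_comm]
      refine le_trans (mul_le_mul_of_nonneg_left ?_ hq.le) h7
      exact (Finset.sum_le_sum h2).trans (h3.trans h4.le)
    -- the squares of side length larger than `K`
    have hsum2 : ∑ k ∈ (Finset.Ico m₀ L).filter (fun k => ¬ k ≤ K),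
        hcost (k * starProb σ ((min k K) ^ 2) p) ≤ (η / 2) / q := by
      have hK0 : K ≠ 0 := by omega
      have h2 : ∀ k ∈ (Finset.Ico m₀ L).filter (fun k => ¬ k ≤ K),
          hcost (k * starProb σ ((min k K) ^ 2) p) ≤ 2 / (D * q) ^ 2 * ((k : ℝ) ^ 2)⁻¹ := by
        intro k hk
        rw [Finset.mem_filter, Finset.mem_Ico] at hk
        have hk0 : (0 : ℝ) < k := by exact_mod_cast hm1'.trans hk.1.1
        rw [min_eq_right (by omega)]
        have h3 := mul_le_mul_of_nonneg_left hKstar hk0.le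
        refine (hcost_anti (by positivity) h3).trans ((hcost_le_two_div_sq (by positivity)).trans
          (le_of_eq ?_))
        field_simp
      have h3 : ∑ k ∈ (Finset.Ico m₀ L).filter (fun k => ¬ k ≤ K), 2 / (D * q) ^ 2 * ((k : ℝ) ^ 2)⁻¹ ≤
          ∑ k ∈ Finset.Ioc K (max K L), 2 / (D * q) ^ 2 * ((k : ℝ) ^ 2)⁻¹ := by
        refine Finset.sum_le_sum_of_subset_of_nonneg (fun k hk => ?_) fun k _ _ => by positivity
        rw [Finset.mem_filter, Finset.mem_Ico] at hk
        rw [Finset.mem_Ioc]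
        omega
      have h4 := sum_Ioc_inv_sq_le_sub (α := ℝ) hK0 (le_max_left K L)
      have h5 : (0 : ℝ) ≤ ((max K L : ℕ) : ℝ)⁻¹ := by positivity
      refine (Finset.sum_le_sum h2).trans (h3.trans ?_)
      rw [← Finset.mul_sum]
      calc 2 / (D * q) ^ 2 * ∑ k ∈ Finset.Ioc K (max K L), ((k : ℝ) ^ 2)⁻¹
          ≤ 2 / (D * q) ^ 2 * (K : ℝ)⁻¹ := by
            refine mul_le_mul_of_nonneg_left ?_ (by positivity)
            linarith
        _ ≤ (η / 2) / q := by
            have hKr : (0 : ℝ) < K := by positivity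
            rw [← div_eq_mul_inv, div_div, div_le_div_iff₀ (by positivity) hq]
            have h6 : D ^ 2 * η * (M / 2) ≤ D ^ 2 * η * (K * q) := by gcongr
            have h7 : 4 ≤ D ^ 2 * η * (K * q) := by linarith
            have h8 := mul_le_mul_of_nonneg_right h7 hq.le
            linarith [show η / 2 * ((D * q) ^ 2 * K) = D ^ 2 * η * (K * q) * q / 2 by ring]
    have : (nu σ + η) / q = (nu σ + η / 2) / q + (η / 2) / q := by ring
    rw [this]
    exact add_le_add hsum1 hsum2

/-- The supercritical regime, in the scaling `p = q ^ (2 + 1 / σ)` with `q = a / log n`: the number of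
disjoint squares is `exp (2 a / q)` up to a power of `q`, and each of them is a nucleus with
probability about `exp (-2 ν / q)`, so that one of them is a nucleus when `ν < a`. -/
theorem tendsto_solveProb_one (hσ : 1 ≤ σ) {a : ℝ} (hν : nu σ < a) :
    Tendsto (fun n : ℕ => solveProb σ 1 2 n
      (projIcc 0 1 zero_le_one ((a / Real.log n) ^ ((2 : ℝ) + 1 / σ)))) atTop (𝓝 1) := by
  have ha : 0 < a := (nu_pos σ).trans hν
  obtain ⟨m₀, M, D, hm₀, hM, hD, hgrowth⟩ :=
    exists_growth_bound hσ (show 0 < (a - nu σ) / 2 by linarith)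
  have hlim1 := (tendsto_div_pow_mul_exp (6 * m₀ + 6) 1
    (show 0 < a - nu σ by linarith)).const_mul 16
  have hlim2 := (tendsto_div_pow_mul_exp 0 1 ha).const_mul 2
  have hlim3 := tendsto_div_pow_mul_exp 3 2 ha
  have hlim := hlim1.add hlim2
  rw [mul_zero, mul_zero, add_zero] at hlim
  suffices h : Tendsto (fun n : ℕ => 1 - solveProb σ 1 2 n
      (projIcc 0 1 zero_le_one ((a / Real.log n) ^ ((2 : ℝ) + 1 / σ)))) atTop (𝓝 0) by
    have h2 := h.const_sub 1
    simpa using h2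
  refine squeeze_zero' (.of_forall fun n => sub_nonneg.2 (solveProb_le_one σ n _)) ?_
    (hlim.comp (tendsto_div_log ha))
  have hev := hgrowth.and ((hlim3.eventually (gt_mem_nhds zero_lt_one)).and (eventually_pos.and
    ((eventually_lt_of_pos zero_lt_one).and ((eventually_lt_of_pos (show 0 < 1 / M by positivity)).and
      (eventually_lt_of_pos (show 0 < D / (3 * a) by positivity))))))
  filter_upwards [(tendsto_div_log ha).eventually hev, eventually_ge_atTop 2] with n hn hn2
  obtain ⟨⟨K, hmK, hKM, hK⟩, h3, hq, hq1, hqM, hqD⟩ := hn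
  have hlog : 0 < Real.log n := Real.log_pos (by exact_mod_cast hn2)
  set q := a / Real.log n with hqdef
  have hnq : (n : ℝ) = Real.exp (a / q) := by
    rw [hqdef, div_div_cancel₀ ha.ne', Real.exp_log]
    positivity
  set p := q ^ ((2 : ℝ) + 1 / σ) with hp
  have hp0 : 0 ≤ p := Real.rpow_nonneg hq.le _
  have hp1 : p ≤ 1 := (rpow_exponent_le hq hq1.le).trans (pow_le_one₀ hq.le hq1.le)
  have hp3 : q ^ 3 ≤ p := by
    rw [hp, ← Real.rpow_natCast q 3]
    refine Real.rpow_le_rpow_of_exponent_ge hq hq1.le ?_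
    have : (1 : ℝ) / σ ≤ 1 := by
      rw [div_le_one (by positivity)]
      exact_mod_cast hσ
    push_cast
    linarith
  have hproj : ((projIcc 0 1 zero_le_one p : unitInterval) : ℝ) = p := by
    rw [projIcc_of_mem _ ⟨hp0, hp1⟩]
  obtain ⟨hKD, hL⟩ := hK p hp0 hp1 (rpow_exponent hσ hq)
  -- the size of the nucleus: of order `q ^ (-3)`, so that the failure of the growth of a larger
  -- square is unlikely even among all the `n ^ 2` positions
  set L := ⌈(1 / q) ^ 3⌉₊ with hLdef
  have hq' : 1 ≤ 1 / q := by rw [le_div_iff₀ hq]; linarith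
  have hq3 : 1 ≤ (1 / q) ^ 3 := one_le_pow₀ hq'
  have hL1 : (1 / q) ^ 3 ≤ L := Nat.le_ceil _
  have hL2 : (L : ℝ) ≤ 2 * (1 / q) ^ 3 := by
    have : (L : ℝ) < (1 / q) ^ 3 + 1 := Nat.ceil_lt_add_one (by positivity)
    linarith
  have hKL : K ≤ L := by
    have h4 : (K : ℝ) ≤ L := by
      refine hKM.trans (le_trans ?_ hL1)
      rw [div_le_iff₀ hq]
      rw [lt_div_iff₀ hM] at hqM
      have h5 : M ≤ 1 / q := by rw [le_div_iff₀ hq]; linarith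
      calc M ≤ 1 / q := h5
        _ ≤ (1 / q) * (1 / q) := le_mul_of_one_le_left (by positivity) hq'
        _ = (1 / q) ^ 3 * q := by field_simp
    exact_mod_cast h4
  have hnL : 4 * (L : ℝ) ≤ n := by
    rw [Real.exp_neg, ← div_eq_mul_inv, div_lt_one (Real.exp_pos _), ← hnq] at h3
    have : (2 / q) ^ 3 = 8 * (1 / q) ^ 3 := by ring
    linarith
  have hL0 : 1 ≤ L := hm₀.trans (hmK.trans hKL)
  have hnL' : 4 * L ≤ n := by exact_mod_cast hnL
  obtain ⟨m, rfl⟩ := Nat.exists_eq_add_of_le' hn2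
  set N := (m + 2) / L with hN
  have hNL : N * L ≤ m + 2 := Nat.div_mul_le_self _ _
  have hNn : ((m + 2 : ℕ) : ℝ) * q ^ 3 / 4 ≤ N := by
    have h4 : m + 2 < (N + 1) * L := by
      have h5 := Nat.div_add_mod (m + 2) L
      have h6 := Nat.mod_lt (m + 2) (show L > 0 by omega)
      rw [← hN] at h5
      rw [add_mul, one_mul, mul_comm N L]
      omega
    have h5 : ((m + 2 : ℕ) : ℝ) < (N + 1) * L := by exact_mod_cast h4
    have h6 : ((m + 2 : ℕ) : ℝ) ≤ 2 * (N * L) := by nlinarith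
    have h7 : ((m + 2 : ℕ) : ℝ) ≤ 2 * (N * (2 * (1 / q) ^ 3)) := h6.trans (by gcongr)
    calc ((m + 2 : ℕ) : ℝ) * q ^ 3 / 4 ≤ 2 * (N * (2 * (1 / q) ^ 3)) * q ^ 3 / 4 := by gcongr
      _ = (N : ℝ) := by field_simp; ring
  -- the probability of a nucleus
  set ρ : ℝ := q ^ (6 * m₀) * Real.exp (-((nu σ + a) / q)) with hρdef
  have hρ : ∀ x, ρ ≤ bprob (edgesIn (sq x L)) (projIcc 0 1 zero_le_one p : unitInterval)
      fun S => Nucleus (edgeRel S) σ m₀ L x := by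
    intro x
    rw [hproj]
    refine le_trans ?_ (le_bprob_nucleus hp0 hp1 (hmK.trans hKL) x (fun k => min k K)
      (fun k => min_le_left _ _) (hL L).1)
    refine mul_le_mul ?_ (Real.exp_le_exp.2 ?_) (Real.exp_pos _).le (by positivity)
    · calc q ^ (6 * m₀) = (q ^ 3) ^ (2 * m₀) := by rw [← pow_mul]; congr 1; ring
        _ ≤ p ^ (2 * m₀) := by gcongr
    · have h4 := (hL L).2
      have h5 : (nu σ + a) / q = 2 * ((nu σ + (a - nu σ) / 2) / q) := by ring
      rw [h5]
      linarith
  have hmain := one_sub_solveProb_le (σ := σ) (projIcc 0 1 zero_le_one p : unitInterval) hm₀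
    (hmK.trans hKL) (by omega) hNL hKL hρ
  rw [hproj] at hmain
  refine hmain.trans (add_le_add ?_ ?_)
  · have h4 : (q ^ (6 * m₀ + 6) / 16) * Real.exp ((a - nu σ) / q) ≤ N ^ 2 * ρ := by
      calc (q ^ (6 * m₀ + 6) / 16) * Real.exp ((a - nu σ) / q)
          = (Real.exp (a / q) * q ^ 3 / 4) ^ 2 * ρ := by
            have : Real.exp ((a - nu σ) / q) =
                Real.exp (a / q) * Real.exp (a / q) * Real.exp (-((nu σ + a) / q)) := by
              rw [← Real.exp_add, ← Real.exp_add]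
              congr 1
              ring
            rw [this, hρdef]
            ring
        _ ≤ N ^ 2 * ρ := by rw [← hnq]; gcongr
    have h5 : 0 < (q ^ (6 * m₀ + 6) / 16) * Real.exp ((a - nu σ) / q) := by positivity
    calc Real.exp (-(N ^ 2 * ρ)) ≤ (N ^ 2 * ρ)⁻¹ := by
          rw [Real.exp_neg]
          have h6 := Real.add_one_le_exp ((N : ℝ) ^ 2 * ρ)
          exact inv_anti₀ (h5.trans_le h4) (by linarith)
      _ ≤ ((q ^ (6 * m₀ + 6) / 16) * Real.exp ((a - nu σ) / q))⁻¹ := inv_anti₀ h5 h4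
      _ = _ := by
        rw [Real.exp_neg, mul_inv, inv_div]
        ring
  · rw [pow_zero, one_mul]
    have h4 : 3 * a / q ≤ L * starProb σ (K ^ 2) p := by
      rw [lt_div_iff₀ (by positivity)] at hqD
      calc 3 * a / q ≤ (D / q) / q := by
            gcongr
            rw [le_div_iff₀ hq]
            linarith
        _ = (1 / q) ^ 3 * (D * q) := by field_simp
        _ ≤ _ := by gcongr
    calc 2 * ((m + 2 : ℕ) : ℝ) ^ 2 * Real.exp (-(L * starProb σ (K ^ 2) p))
        ≤ 2 * ((m + 2 : ℕ) : ℝ) ^ 2 * Real.exp (-(3 * a / q)) := by gcongr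
      _ = 2 * (Real.exp (a / q) * Real.exp (a / q) * Real.exp (-(3 * a / q))) := by
        rw [hnq]; ring
      _ = _ := by
        rw [← Real.exp_add, ← Real.exp_add]
        congr 2
        ring

end Supercritical

/-! ### The critical probability -/

section Limit

variable {σ : ℕ} {pc : ℕ → unitInterval}

lemma eventually_lt_criticalProb (hσ : 1 ≤ σ) (hpc : ∀ n, 2 ≤ n → IsCriticalProb σ 1 2 n (pc n))
    {a : ℝ} (ha : 0 < a) (hν : a < nu σ) :
    ∀ᶠ n : ℕ in atTop, (a / Real.log n) ^ ((2 : ℝ) + 1 / σ) < pc n := by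
  filter_upwards [(tendsto_solveProb_zero hσ ha hν).eventually
    (gt_mem_nhds (show (0 : ℝ) < 1 / 2 by norm_num)), eventually_ge_atTop 2] with n hn hn2
  by_contra! h
  have h1 := monotone_projIcc (zero_le_one (α := ℝ)) h
  rw [projIcc_val] at h1
  have h2 := solveProb_mono σ n h1
  rw [hpc n hn2] at h2
  linarith

lemma eventually_criticalProb_lt (hσ : 1 ≤ σ) (hpc : ∀ n, 2 ≤ n → IsCriticalProb σ 1 2 n (pc n))
    {a : ℝ} (hν : nu σ < a) :
    ∀ᶠ n : ℕ in atTop, pc n < (a / Real.log n) ^ ((2 : ℝ) + 1 / σ) := by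
  filter_upwards [(tendsto_solveProb_one hσ hν).eventually
    (lt_mem_nhds (show (1 / 2 : ℝ) < 1 by norm_num)), eventually_ge_atTop 2] with n hn hn2
  by_contra! h
  have h1 := monotone_projIcc (zero_le_one (α := ℝ)) h
  rw [projIcc_val] at h1
  have h2 := solveProb_mono σ n h1
  rw [hpc n hn2] at h2
  linarith

lemma exists_rpow_gt {s ν b : ℝ} (hν : 0 < ν) (h : b < ν ^ s) : ∃ a, 0 < a ∧ a < ν ∧ b < a ^ s := by
  have hc : ContinuousAt (fun x : ℝ => x ^ s) ν := Real.continuousAt_rpow_const _ _ (Or.inl hν.ne')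
  have h1 : ∀ᶠ a in 𝓝[<] ν, b < a ^ s := (hc.eventually (lt_mem_nhds h)).filter_mono nhdsWithin_le_nhds
  obtain ⟨a, ⟨h2, h3⟩, h4⟩ := ((h1.and (mem_nhdsWithin_of_mem_nhds (Ioi_mem_nhds hν))).and
    self_mem_nhdsWithin).exists
  exact ⟨a, h3, h4, h2⟩

lemma exists_rpow_lt {s ν b : ℝ} (hν : 0 < ν) (h : ν ^ s < b) : ∃ a, ν < a ∧ a ^ s < b := by
  have hc : ContinuousAt (fun x : ℝ => x ^ s) ν := Real.continuousAt_rpow_const _ _ (Or.inl hν.ne')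
  have h1 : ∀ᶠ a in 𝓝[>] ν, a ^ s < b := (hc.eventually (gt_mem_nhds h)).filter_mono nhdsWithin_le_nhds
  obtain ⟨a, h2, h3⟩ := (h1.and self_mem_nhdsWithin).exists
  exact ⟨a, h3, h2⟩

theorem tendsto_criticalProb (hσ : 1 ≤ σ) (hpc : ∀ n, 2 ≤ n → IsCriticalProb σ 1 2 n (pc n)) :
    Tendsto (fun n : ℕ => (pc n : ℝ) * Real.log n ^ ((2 : ℝ) + 1 / σ)) atTop
      (𝓝 (nu σ ^ ((2 : ℝ) + 1 / σ))) := by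
  have hν := nu_pos σ
  refine tendsto_order.2 ⟨fun b hb => ?_, fun b hb => ?_⟩
  · obtain ⟨a, ha, haν, hab⟩ := exists_rpow_gt hν hb
    filter_upwards [eventually_lt_criticalProb hσ hpc ha haν, eventually_ge_atTop 2] with n hn hn2
    have hlog : 0 < Real.log n := Real.log_pos (by exact_mod_cast hn2)
    rw [Real.div_rpow ha.le hlog.le, div_lt_iff₀ (by positivity)] at hn
    exact hab.trans hn
  · obtain ⟨a, haν, hab⟩ := exists_rpow_lt hν hb
    filter_upwards [eventually_criticalProb_lt hσ hpc haν, eventually_ge_atTop 2] with n hn hn2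
    have hlog : 0 < Real.log n := Real.log_pos (by exact_mod_cast hn2)
    rw [Real.div_rpow (hν.trans haν).le hlog.le, lt_div_iff₀ (by positivity)] at hn
    exact hn.trans hab

theorem sharpTransition (hσ : 1 ≤ σ) (hpc : ∀ n, 2 ≤ n → IsCriticalProb σ 1 2 n (pc n)) :
    SharpTransition σ 1 2 pc := by
  have hν := nu_pos σ
  intro ε hε
  set s : ℝ := (2 : ℝ) + 1 / σ with hs
  have hνs : 0 < nu σ ^ s := by positivity
  constructor
  · -- `(1 - ε) * pc` is eventually below a subcritical probability
    obtain ⟨a, ha, haν, hab⟩ := exists_rpow_gt (s := s) hν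
      (show max (1 - ε) 0 * nu σ ^ s < nu σ ^ s from
        mul_lt_of_lt_one_left hνs (max_lt (by linarith) zero_lt_one))
    obtain ⟨b, hb, hba⟩ : ∃ b, nu σ < b ∧ max (1 - ε) 0 * b ^ s ≤ a ^ s := by
      rcases (le_max_right (1 - ε) 0).eq_or_lt with h0 | h0
      · exact ⟨nu σ + 1, by linarith, by rw [← h0, zero_mul]; positivity⟩
      · rw [mul_comm, ← lt_div_iff₀ h0] at hab
        obtain ⟨b, hb, hb'⟩ := exists_rpow_lt hν hab
        rw [lt_div_iff₀ h0, mul_comm] at hb'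
        exact ⟨b, hb, hb'.le⟩
    refine squeeze_zero' (.of_forall fun n => solveProb_nonneg σ n _) ?_
      (tendsto_solveProb_zero hσ ha haν)
    filter_upwards [eventually_criticalProb_lt hσ hpc hb, eventually_ge_atTop 2] with n hn hn2
    have hlog : 0 < Real.log n := Real.log_pos (by exact_mod_cast hn2)
    refine solveProb_mono σ n (monotone_projIcc _ ?_)
    calc (1 - ε) * (pc n : ℝ) ≤ max (1 - ε) 0 * (b / Real.log n) ^ s :=
          mul_le_mul (le_max_left _ _) hn.le (pc n).2.1 (le_max_right _ _)
      _ = max (1 - ε) 0 * b ^ s / Real.log n ^ s := by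
          rw [Real.div_rpow (hν.trans hb).le hlog.le, mul_div_assoc]
      _ ≤ a ^ s / Real.log n ^ s := by gcongr
      _ = (a / Real.log n) ^ s := (Real.div_rpow ha.le hlog.le _).symm
  · -- `(1 + ε) * pc` is eventually above a supercritical probability
    obtain ⟨a, ha, haν, hab⟩ := exists_rpow_gt (s := s) (b := nu σ ^ s / (1 + ε)) hν
      (div_lt_self hνs (by linarith))
    rw [div_lt_iff₀ (by linarith)] at hab
    obtain ⟨b, hb, hba⟩ := exists_rpow_lt hν hab
    refine tendsto_of_tendsto_of_tendsto_of_le_of_le' (tendsto_solveProb_one hσ hb)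
      tendsto_const_nhds ?_ (.of_forall fun n => solveProb_le_one σ n _)
    filter_upwards [eventually_lt_criticalProb hσ hpc ha haν, eventually_ge_atTop 2] with n hn hn2
    have hlog : 0 < Real.log n := Real.log_pos (by exact_mod_cast hn2)
    refine solveProb_mono σ n (monotone_projIcc _ ?_)
    calc (b / Real.log n) ^ s = b ^ s / Real.log n ^ s := Real.div_rpow (hν.trans hb).le hlog.le _
      _ ≤ a ^ s * (1 + ε) / Real.log n ^ s := by gcongr
      _ = (1 + ε) * (a / Real.log n) ^ s := by rw [Real.div_rpow ha.le hlog.le]; ring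
      _ ≤ (1 + ε) * pc n := by gcongr

end Limit

end Jigsaw

end

theorem theorem7 (σ : ℕ) (hσ : 1 ≤ σ) :
    IntegrableOn (Jigsaw.nuIntegrand σ) (Ioi (0 : ℝ)) ∧
    (∀ n : ℕ, 2 ≤ n → ∃! p : unitInterval, Jigsaw.IsCriticalProb (σ : ℕ∞) 1 2 n p) ∧
    ∀ pc : ℕ → unitInterval,
      (∀ n : ℕ, 2 ≤ n → Jigsaw.IsCriticalProb (σ : ℕ∞) 1 2 n (pc n)) →
      Tendsto (fun n : ℕ => (pc n : ℝ) * Real.log (n : ℝ) ^ ((2 : ℝ) + 1 / (σ : ℝ))) atTop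
        (𝓝 (Jigsaw.nu σ ^ ((2 : ℝ) + 1 / (σ : ℝ)))) ∧
      Jigsaw.SharpTransition (σ : ℕ∞) 1 2 pc :=
  ⟨Jigsaw.integrableOn_nuIntegrand σ, fun _ hn => Jigsaw.existsUnique_isCriticalProb hσ hn,
    fun _ hpc => ⟨Jigsaw.tendsto_criticalProb hσ hpc, Jigsaw.sharpTransition hσ hpc⟩⟩
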